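/- **Setting.** Let $n\ge 3$ and $\alpha_4,\dots,\alpha_n\in\mathbb C$ (no parameters if $n=3$); put $\alpha_k=0$ for $k\notin\{4,\dots,n\}$. Let $R_5=R_5(\alpha_4,\dots,\alpha_n)$ be the $(n+1)$-dimensional complex (right) Leibniz algebra with basis $e_1,\dots,e_n,x$ and products $$[e_1,e_1]=e_3,\quad [e_i,e_1]=e_{i+1}\ (2\le i\le n-1),\quad [e_1,x]=e_2+\sum_{i=4}^{n-1}\alpha_ie_i,\quad [e_i,x]=e_i+\sum_{j=i+2}^{n}\alpha_{j-i+2}e_j\ (2\le i\le n),$$ omitted products of basis vectors being zero. Let $ZL^2$ be the space of bilinear maps $\varphi:R_5\times R_5\to R_5$ with $$[u,\varphi(v,w)]-[\varphi(u,v),w]+[\varphi(u,w),v]+\varphi(u,[v,w])-\varphi([u,v],w)+\varphi([u,w],v)=0\quad\text{for all }u,v,w,$$ $BL^2$ the space of bilinear maps $(u,v)\mapsto[d(u),v]+[u,d(v)]-d([u,v])$ with $d:R_5\to R_5$ linear, and $HL^2=ZL^2/BL^2$. Put $e_{n+1}=0$; empty sums are zero. **(1) General form.** A bilinear map $\varphi$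 lies in $ZL^2$ if and only if there are complex numbers $a_{1,i}$ $(3\le i\le n)$, $a_{i,s}$ $(2\le i\le n-1,\ 0\le s\le n)$, $a_{n,i}$ $(2\le i\le n)$, $c_i$ $(0\le i\le n+1)$, $d_i$ $(2\le i\le n)$, $\beta$ such that, with $\lambda=-c_0+\sum_{j=4}^n\alpha_ja_{j-1,0}$ and $\mu=-c_1+\sum_{j=4}^n\alpha_ja_{j-1,1}$, $$\begin{aligned} \varphi(e_1,e_1)&=a_{2,0}x+a_{2,1}e_1+(a_{2,2}-\alpha_na_{n,2})e_2+\sum_{i=3}^na_{1,i}e_i,\\ \varphi(e_i,e_1)&=a_{i,0}x+\sum_{s=1}^na_{i,s}e_s\quad(2\le i\le n-1),\qquad \varphi(e_n,e_1)=\sum_{i=2}^na_{n,i}e_i,\\ \varphi(e_1,e_2)&=\lambda e_2+\mu e_3+\sum_{i=4}^{n-1}\alpha_i\lambda e_i,\\ \varphi(e_i,e_2)&=\lambda e_i+\mu e_{i+1}+\sum_{k=i+2}^n\alpha_{k-i+2}\lambda e_k\quad(2\le i\le n),\\ \varphi(e_1,e_j)&=-a_{j-1,0}e_2-a_{j-1,1}e_3-a_{j-1,0}\sum_{k=4}^{n-1}\alpha_ke_k\quad(3\le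 j\le n),\\ \varphi(e_i,e_j)&=-a_{j-1,0}e_i-a_{j-1,1}e_{i+1}-a_{j-1,0}\sum_{k=i+2}^n\alpha_{k-i+2}e_k\quad(2\le i\le n,\ 3\le j\le n),\\ \varphi(e_1,x)&=(c_0-\alpha_na_{n-1,0})x+(c_1+d_2-\alpha_na_{n-1,1})e_1\\ &\quad+(c_2+a_{1,3}-a_{2,3}-d_2+\alpha_na_{n-1,1}+\alpha_na_{n,3})e_2\\ &\quad+\sum_{i=3}^{n-1}\Big(c_i+a_{1,i+1}-a_{2,i+1}+\alpha_n(a_{n,i+1}-\alpha_{i+1}a_{n,2})+\sum_{j=4}^i\alpha_j(a_{1,i-j+3}-a_{2,i-j+3})\Big)e_i+c_{n+1}e_n,\\ \varphi(e_2,x)&=c_0x+\sum_{i=1}^nc_ie_i,\\ \varphi(e_3,x)&=\Big(a_{2,0}+\sum_{j=4}^{n-1}\alpha_ja_{j,0}\Big)x+\Big(a_{2,1}+\sum_{j=4}^{n-1}\alpha_ja_{j,1}\Big)e_1+\Big(-a_{2,1}+\sum_{j=4}^n\alpha_ja_{j,2}\Big)e_2\\ &\quad+\Big(c_1+c_2+d_2+\sum_{j=4}^n\alpha_ja_{j,3}\Big)e_3\\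 &\quad+\sum_{k=4}^n\Big(c_{k-1}-a_{2,1}\alpha_k-\sum_{j=2}^{k-2}\alpha_{k-j+2}a_{2,j}+\sum_{j=4}^n\alpha_ja_{j,k}\Big)e_k+a_{2,1}\alpha_ne_n, \end{aligned}$$ for $3\le i\le n-1$ $$\begin{aligned} \varphi(e_{i+1},x)&=\Big(a_{i,0}+\sum_{j=i+2}^{n-1}\alpha_{j-i+2}a_{j,0}\Big)x+\Big(a_{i,1}+\sum_{j=i+2}^{n-1}\alpha_{j-i+2}a_{j,1}\Big)e_1+\Big(-a_{i,1}+\sum_{j=i+2}^n\alpha_{j-i+2}a_{j,2}\Big)e_2\\ &\quad+\sum_{k=3}^{i-1}\Big(\sum_{j=i+1}^{n-1}\alpha_{j-i+k}a_{j,1}+\sum_{s=2}^{k-1}\sum_{j=i+1}^n\alpha_{j+k-i-s+2}a_{j,s}+\sum_{j=i+2}^n\alpha_{j-i+2}a_{j,k}\Big)e_k\\ &\quad+\Big(\sum_{j=i+1}^{n-1}\alpha_ja_{j,1}+\sum_{s=2}^{i-1}\sum_{j=i+1}^n\alpha_{j-s+2}a_{j,s}+\sum_{j=i+2}^n\alpha_{j-i+2}a_{j,i}\Big)e_i\\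 &\quad+\Big(c_1+c_2+(i-1)d_2-\sum_{j=3}^i\alpha_{j+1}(a_{j,1}+a_{j,2})+\sum_{s=3}^i\sum_{j=i+1}^n\alpha_{j-s+3}a_{j,s}+\sum_{j=i+2}^n\alpha_{j-i+2}a_{j,i+1}\Big)e_{i+1}\\ &\quad+\sum_{k=i+2}^n\Big(c_{k+1-i}-\sum_{j=2}^i\alpha_{k-i+j}a_{j,1}-\sum_{s=2}^i\sum_{j=2}^{k-s}\alpha_{k+4-j-s}a_{i-s+2,j}+\sum_{s=2}^i\sum_{j=s+2}^n\alpha_{j-s+2}a_{j,k-i+s}\Big)e_k+\alpha_na_{i,1}e_n, \end{aligned}$$ and $$\begin{aligned} \varphi(x,e_1)&=-d_2e_1+\sum_{i=2}^nd_ie_i,\qquad \varphi(x,e_j)=0\quad(2\le j\le n),\\ \varphi(x,x)&=\sum_{i=2}^{n-1}\Big(d_{i+1}+\sum_{j=4}^i\alpha_jd_{i+3-j}\Big)e_i+\alpha_nd_2e_{n-1}+\beta e_n. \end{aligned}$$ **(2) Dimensions.** $\dim ZL^2=n^2+3n-3$; $\dim HL^2=2n-4$ if all $\alpha_i=0$,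 and $\dim HL^2=2n-5$ if some $\alpha_i\ne0$. **(3) Bases.** Define bilinear maps (omitted values on pairs of basis vectors are zero): - $\rho(e_1,x)=e_1-e_2$, $\rho(e_i,x)=(i-2)e_i$ $(3\le i\le n)$, $\rho(x,e_1)=e_2-e_1$, $\rho(x,x)=\alpha_ne_{n-1}$; - for $4\le k\le n-1$: $\psi_k(e_1,x)=e_k$, $\psi_k(e_i,x)=e_{k+i-2}$ $(2\le i\le n-k+2)$; and, for $n\ge4$, $\psi_n(e_2,x)=e_n$; - $\varphi_{n,2}(e_n,e_1)=e_2$, $\varphi_{n,2}(e_1,e_1)=-\alpha_ne_2$, $\varphi_{n,2}(e_1,x)=-\alpha_n\sum_{j=3}^{n-1}\alpha_{j+1}e_j$, $\varphi_{n,2}(e_i,x)=\sum_{j=2}^{i-1}\alpha_{n+j+1-i}e_j$ $(3\le i\le n-1)$, $\varphi_{n,2}(e_n,x)=\sum_{j=3}^{n-1}\alpha_{j+1}e_j$; - for $3\le k\le n-1$: $\varphi_{n,k}(e_n,e_1)=e_k$, $\varphi_{n,k}(e_1,x)=\alpha_ne_{k-1}$, $\varphi_{n,k}(e_i,x)=\sum_{j=k}^{i+k-3}\alpha_{n+j+3-i-k}e_j$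 $(3\le i\le n-1,\ i\le n+2-k)$, $\varphi_{n,k}(e_i,x)=\sum_{j=k}^{n}\alpha_{n+j+3-i-k}e_j$ $(n+3-k\le i\le n-1)$, $\varphi_{n,k}(e_n,x)=\sum_{j=k+1}^n\alpha_{j+3-k}e_j$. All of these are 2-cocycles. If all $\alpha_i=0$, the classes of $\rho$, $\psi_k$ $(4\le k\le n)$ and $\varphi_{n,k}$ $(2\le k\le n-1)$ form a basis of $HL^2$. If some $\alpha_i\neq0$, then for every $m$ with $\alpha_m\ne0$ the classes of $\rho$, $\psi_k$ $(4\le k\le n,\ k\ne m)$ and $\varphi_{n,k}$ $(2\le k\le n-1)$ form a basis of $HL^2$. -/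

import Mathlib

open Finset

set_option maxSynthPendingDepth 3

namespace LeibnizR5

noncomputable section

/-! Leibniz algebras and their second cohomology with adjoint coefficients -/

/-- Bilinear maps `L × L → L`. -/
abbrev Bil (F L : Type*) [Field F] [AddCommGroup L] [Module F L] : Type _ :=
  L →ₗ[F] L →ₗ[F] L

/-- The (right) Leibniz identity for the bracket `[x,y] = μ x y`. -/
def IsLeibniz {F L : Type*} [Field F] [AddCommGroup L] [Module F L] (μ : Bil F L) : Prop :=
  ∀ x y z : L, μ x (μ y z) = μ (μ x y) z - μ (μ x z) y

/-- The space `ZL²(L,L)` of 2-cocycles of the algebra `(L, μ)`. -/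
def ZL2 {F L : Type*} [Field F] [AddCommGroup L] [Module F L] (μ : Bil F L) :
    Submodule F (Bil F L) where
  carrier := {φ | ∀ x y z : L,
    μ x (φ y z) - μ (φ x y) z + μ (φ x z) y
      + φ x (μ y z) - φ (μ x y) z + φ (μ x z) y = 0}
  zero_mem' := by
    intro x y z
    simp
  add_mem' := by
    intro φ ψ hφ hψ x y z
    have h := congrArg₂ (· + ·) (hφ x y z) (hψ x y z)
    simp only [LinearMap.add_apply, map_add, add_zero] at h ⊢
    rw [← h]
    abel
  smul_mem' := by
    intro t φ hφ x y z
    have h := congrArg (fun v => t • v) (hφ x y z)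
    simpa only [LinearMap.smul_apply, map_smul, smul_sub, smul_add, smul_zero] using h

/-- The space `BL²(L,L)` of 2-coboundaries: `f(x,y) = [d x, y] + [x, d y] - d [x,y]` for some
linear map `d`. -/
def BL2 {F L : Type*} [Field F] [AddCommGroup L] [Module F L] (μ : Bil F L) :
    Submodule F (Bil F L) where
  carrier := {f | ∃ d : L →ₗ[F] L, ∀ x y : L, f x y = μ (d x) y + μ x (d y) - d (μ x y)}
  zero_mem' := ⟨0, by intro x y; simp⟩
  add_mem' := by
    rintro f g ⟨d, hd⟩ ⟨d', hd'⟩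
    refine ⟨d + d', fun x y => ?_⟩
    simp only [LinearMap.add_apply, map_add, hd, hd']
    abel
  smul_mem' := by
    rintro t f ⟨d, hd⟩
    refine ⟨t • d, fun x y => ?_⟩
    simp only [LinearMap.smul_apply, map_smul, hd, smul_sub, smul_add]

/-- In a Leibniz algebra every 2-coboundary is a 2-cocycle. -/
theorem BL2_le_ZL2 {F L : Type*} [Field F] [AddCommGroup L] [Module F L] {μ : Bil F L}
    (h : IsLeibniz μ) : BL2 μ ≤ ZL2 μ := by
  rintro f ⟨d, hd⟩ x y z
  have e1 := h (d x) y z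
  have e2 := h x (d y) z
  have e3 := h x y (d z)
  have e4 := congrArg d (h x y z)
  simp only [hd, map_add, map_sub, LinearMap.add_apply, LinearMap.sub_apply] at *
  rw [e1, e2, e3, e4]
  abel

/-- The second cohomology space `HL²(L,L) = ZL²(L,L) / BL²(L,L)`. -/
abbrev HL2 {F L : Type*} [Field F] [AddCommGroup L] [Module F L] (μ : Bil F L) : Type _ :=
  ↥(ZL2 μ) ⧸ (BL2 μ).submoduleOf (ZL2 μ)

/-- The bilinear maps `f i` are 2-cocycles, and their cohomology classes form a basis of
`HL²(L,L)`. -/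
def ClassesFormBasis {F L ι : Type*} [Field F] [AddCommGroup L] [Module F L] (μ : Bil F L)
    (f : ι → Bil F L) : Prop :=
  ∃ b : Module.Basis ι F (HL2 μ), ∀ i, ∃ h : f i ∈ ZL2 μ,
    b i = Submodule.Quotient.mk (⟨f i, h⟩ : ↥(ZL2 μ))

/-! The algebra `R₅(α₄, …, αₙ)` -/

/-- The `(n+1)`-dimensional space with basis `x, e₁, …, eₙ`; the coordinate of `x` is the one with
index `0`, that of `eᵢ` the one with index `i`. -/
abbrev V (n : ℕ) : Type := Fin (n + 1) → ℂ

/-- The basis vector `eᵢ` for `1 ≤ i ≤ n`, with the conventions `e 0 = x` and `eᵢ = 0` for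
`i > n`. -/
def e (n i : ℕ) : V n := fun j => if (j : ℕ) = i then 1 else 0

/-- The basis vector `x`. -/
abbrev x (n : ℕ) : V n := e n 0

/-- The bilinear map whose value at the pair of basis vectors with indices `i`, `j` is `t i j`. -/
def ofTable (n : ℕ) (t : ℕ → ℕ → V n) : Bil ℂ (V n) :=
  LinearMap.mk₂ ℂ (fun u v => ∑ i : Fin (n + 1), ∑ j : Fin (n + 1), (u i * v j) • t i j)
    (by intro u u' v; simp only [Pi.add_apply, add_mul, add_smul, sum_add_distrib])
    (by intro c u v; simp only [Pi.smul_apply, smul_eq_mul, mul_assoc, mul_smul, smul_sum])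
    (by intro u v v'; simp only [Pi.add_apply, mul_add, add_smul, sum_add_distrib])
    (by intro c u v
        simp only [Pi.smul_apply, smul_eq_mul, mul_left_comm _ c, mul_smul, smul_sum])

theorem ofTable_e (n : ℕ) (t : ℕ → ℕ → V n) {i j : ℕ} (hi : i ≤ n) (hj : j ≤ n) :
    ofTable n t (e n i) (e n j) = t i j := by
  have hi' : i < n + 1 := by omega
  have hj' : j < n + 1 := by omega
  have h1 : ∀ k : Fin (n + 1), e n i k = if k = ⟨i, hi'⟩ then 1 else 0 := by
    intro k; simp only [e, Fin.ext_iff]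
  have h2 : ∀ k : Fin (n + 1), e n j k = if k = ⟨j, hj'⟩ then 1 else 0 := by
    intro k; simp only [e, Fin.ext_iff]
  simp [ofTable, h1, h2]

/-- The bracket of `R₅(α₄, …, αₙ)`:
`[e₁,e₁] = e₃`, `[eᵢ,e₁] = eᵢ₊₁` (`2 ≤ i ≤ n-1`), `[e₁,x] = e₂ + ∑_{i=4}^{n-1} αᵢ eᵢ`,
`[eᵢ,x] = eᵢ + ∑_{j=i+2}^{n} α_{j-i+2} eⱼ` (`2 ≤ i ≤ n`), other products of basis vectors zero. -/
def R5 (n : ℕ) (α : ℕ → ℂ) : Bil ℂ (V n) :=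
  ofTable n fun i j =>
    if j = 1 then
      if i = 1 then e n 3
      else if 2 ≤ i ∧ i ≤ n - 1 then e n (i + 1)
      else 0
    else if j = 0 then
      if i = 1 then e n 2 + ∑ k ∈ Icc 4 (n - 1), α k • e n k
      else if 2 ≤ i ∧ i ≤ n then e n i + ∑ k ∈ Icc (i + 2) n, α (k - i + 2) • e n k
      else 0
    else 0

theorem linearMap_ext {n : ℕ} {W : Type*} [AddCommGroup W] [Module ℂ W] {f g : V n →ₗ[ℂ] W}
    (h : ∀ i ≤ n, f (e n i) = g (e n i)) : f = g := by
  refine (Pi.basisFun ℂ (Fin (n + 1))).ext fun i => ?_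
  have h1 : Pi.basisFun ℂ (Fin (n + 1)) i = e n i := by
    ext j
    simp [e, Pi.single_apply, Fin.ext_iff]
  rw [h1]
  exact h i (by omega)

theorem R5_e_of_two_le {n : ℕ} {α : ℕ → ℂ} {i j : ℕ} (hi : i ≤ n) (hj : j ≤ n) (h : 2 ≤ j) :
    R5 n α (e n i) (e n j) = 0 := by
  rw [R5, ofTable_e n _ hi hj, if_neg (by omega), if_neg (by omega)]

/-- `R₅(α₄, …, αₙ)` is a Leibniz algebra. -/
theorem R5_isLeibniz {n : ℕ} (hn : 3 ≤ n) (α : ℕ → ℂ) : IsLeibniz (R5 n α) := by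
  have hz : ∀ i ≤ n, ∀ j ≤ n, ∀ k ≤ n, R5 n α (e n i) (R5 n α (e n j) (e n k)) = 0 := by
    intro i hi j hj k hk
    conv_lhs => rw [R5, ofTable_e n _ hj hk]
    rw [← R5]
    have hs : ∀ (m r : ℕ) (t : ℕ → ℂ), 2 ≤ m → r ≤ n →
        R5 n α (e n i) (∑ l ∈ Icc m r, t l • e n l) = 0 := by
      intro m r t hm hr
      rw [map_sum]
      refine sum_eq_zero fun l hl => ?_
      rw [mem_Icc] at hl
      rw [map_smul, R5_e_of_two_le hi (by omega) (by omega), smul_zero]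
    split_ifs
    · exact R5_e_of_two_le hi (by omega) (by omega)
    · exact R5_e_of_two_le hi (by omega) (by omega)
    · simp
    · rw [map_add, R5_e_of_two_le hi (by omega) (by omega), hs _ _ _ (by omega) (by omega),
        add_zero]
    · rw [map_add, R5_e_of_two_le hi (by omega) (by omega), hs _ _ _ (by omega) (by omega),
        add_zero]
    · simp
    · simp
  have hc : ∀ i ≤ n, R5 n α (R5 n α (e n i) (e n 0)) (e n 1) =
      R5 n α (R5 n α (e n i) (e n 1)) (e n 0) := by
    have t1 : ∀ i ≤ n, 2 ≤ i → R5 n α (e n i) (e n 1) = e n (i + 1) := by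
      intro i hi h2
      rw [R5, ofTable_e n _ hi (by omega), if_pos rfl, if_neg (by omega)]
      split_ifs with h
      · rfl
      · ext j
        have := j.isLt
        simp only [e, Pi.zero_apply]
        rw [if_neg (by omega)]
    have t0 : ∀ i ≤ n, 2 ≤ i → R5 n α (e n i) (e n 0) =
        e n i + ∑ k ∈ Icc (i + 2) n, α (k - i + 2) • e n k := by
      intro i hi h2
      rw [R5, ofTable_e n _ hi (by omega), if_neg (by omega), if_pos rfl, if_neg (by omega),
        if_pos ⟨h2, hi⟩]
    have big : ∀ i, n < i → e n i = 0 := by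
      intro i hi
      ext j
      have := j.isLt
      simp only [e, Pi.zero_apply]
      rw [if_neg (by omega)]
    have ts : ∀ (m r : ℕ) (t : ℕ → ℂ), 2 ≤ m → r ≤ n →
        R5 n α (∑ l ∈ Icc m r, t l • e n l) (e n 1) =
          ∑ l ∈ Icc (m + 1) (r + 1), t (l - 1) • e n l := by
      intro m r t hm hr
      rw [map_sum, LinearMap.sum_apply, ← Finset.map_add_right_Icc, Finset.sum_map]
      refine sum_congr rfl fun l hl => ?_
      rw [mem_Icc] at hl
      rw [map_smul, LinearMap.smul_apply, t1 l (by omega) (by omega)]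
      simp
    intro i hi
    obtain rfl | rfl | h2 : i = 0 ∨ i = 1 ∨ 2 ≤ i := by omega
    · have a0 : R5 n α (e n 0) (e n 0) = 0 := by
        rw [R5, ofTable_e n _ hi hi]
        simp
      have a1 : R5 n α (e n 0) (e n 1) = 0 := by
        rw [R5, ofTable_e n _ hi (by omega)]
        simp
      rw [a0, a1]
      simp
    · have a0 : R5 n α (e n 1) (e n 0) = e n 2 + ∑ k ∈ Icc 4 (n - 1), α k • e n k := by
        rw [R5, ofTable_e n _ hi (by omega)]
        simp
      have a1 : R5 n α (e n 1) (e n 1) = e n 3 := by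
        rw [R5, ofTable_e n _ hi (by omega)]
        simp
      rw [a0, a1, map_add, LinearMap.add_apply, ts _ _ _ (by omega) (by omega),
        t1 2 (by omega) (by omega), t0 3 hn (by omega), Nat.sub_add_cancel (by omega)]
      congr 1
      refine sum_congr rfl fun l hl => ?_
      rw [mem_Icc] at hl
      congr 2
      omega
    · rw [t0 i hi h2, t1 i hi h2, map_add, LinearMap.add_apply, ts _ _ _ (by omega) le_rfl,
        t1 i hi h2]
      obtain h3 | h3 : i = n ∨ i + 1 ≤ n := by omega
      · rw [big (i + 1) (by omega), Icc_eq_empty (by omega)]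
        simp
      · rw [t0 (i + 1) h3 (by omega)]
        congr 1
        have hd : ∑ l ∈ Icc (i + 2 + 1) (n + 1), α (l - 1 - i + 2) • e n l =
            ∑ l ∈ Icc (i + 1 + 2) n, α (l - 1 - i + 2) • e n l := by
          refine (sum_subset (Icc_subset_Icc (by omega) (by omega)) fun l hl hl' => ?_).symm
          rw [mem_Icc] at hl hl'
          rw [big l (by omega), smul_zero]
        rw [hd]
        refine sum_congr rfl fun l hl => ?_
        rw [mem_Icc] at hl
        congr 2
        omega
  have key : ∀ i ≤ n, ∀ j ≤ n, ∀ k ≤ n, R5 n α (e n i) (R5 n α (e n j) (e n k)) =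
      R5 n α (R5 n α (e n i) (e n j)) (e n k) - R5 n α (R5 n α (e n i) (e n k)) (e n j) := by
    have hu : ∀ j ≤ n, 2 ≤ j → (R5 n α).flip (e n j) = 0 := by
      intro j hj h2
      refine linearMap_ext fun i hi => ?_
      simpa using R5_e_of_two_le hi hj h2
    have hu' : ∀ j ≤ n, 2 ≤ j → ∀ u, R5 n α u (e n j) = 0 := by
      intro j hj h2 u
      simpa using congrArg (fun f => f u) (hu j hj h2)
    intro i hi j hj k hk
    rw [hz i hi j hj k hk]
    by_cases hj2 : 2 ≤ j
    · simp [hu' j hj hj2]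
    by_cases hk2 : 2 ≤ k
    · simp [hu' k hk hk2]
    obtain rfl | rfl : j = 0 ∨ j = 1 := by omega
    all_goals
      obtain rfl | rfl : k = 0 ∨ k = 1 := by omega
      all_goals simp [hc i hi]
  intro u v w
  have s1 : ∀ j ≤ n, ∀ k ≤ n, (R5 n α).flip (R5 n α (e n j) (e n k)) =
      (R5 n α).flip (e n k) ∘ₗ (R5 n α).flip (e n j)
        - (R5 n α).flip (e n j) ∘ₗ (R5 n α).flip (e n k) := by
    intro j hj k hk
    exact linearMap_ext fun i hi => by simpa using key i hi j hj k hk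
  have s2 : ∀ k ≤ n, R5 n α u ∘ₗ (R5 n α).flip (e n k) =
      (R5 n α).flip (e n k) ∘ₗ R5 n α u - R5 n α (R5 n α u (e n k)) := by
    intro k hk
    exact linearMap_ext fun j hj => by simpa using congrArg (fun f => f u) (s1 j hj k hk)
  have s3 : R5 n α u ∘ₗ R5 n α v = R5 n α (R5 n α u v) - (R5 n α).flip v ∘ₗ R5 n α u := by
    exact linearMap_ext fun k hk => by simpa using congrArg (fun f => f v) (s2 k hk)
  simpa using congrArg (fun f => f w) s3

/-! The general form of the 2-cocycles of `R₅(α₄, …, αₙ)` -/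

/-- The bilinear map `φ` has the general form with parameters
`a_{1,i}` (`3 ≤ i ≤ n`), `a_{i,s}` (`2 ≤ i ≤ n-1`, `0 ≤ s ≤ n`), `a_{n,i}` (`2 ≤ i ≤ n`),
`cᵢ` (`0 ≤ i ≤ n+1`), `dᵢ` (`2 ≤ i ≤ n`) and `β`. Here `αₖ` is understood to be zero unless
`4 ≤ k ≤ n`, and `e_{n+1} = 0`. -/
structure IsGeneralForm (n : ℕ) (α : ℕ → ℂ) (a : ℕ → ℕ → ℂ) (c d : ℕ → ℂ) (β : ℂ)
    (φ : Bil ℂ (V n)) : Prop where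
  e1_e1 : φ (e n 1) (e n 1) =
    a 2 0 • x n + a 2 1 • e n 1 + (a 2 2 - α n * a n 2) • e n 2 + ∑ i ∈ Icc 3 n, a 1 i • e n i
  ei_e1 : ∀ i ∈ Icc 2 (n - 1), φ (e n i) (e n 1) = a i 0 • x n + ∑ s ∈ Icc 1 n, a i s • e n s
  en_e1 : φ (e n n) (e n 1) = ∑ i ∈ Icc 2 n, a n i • e n i
  e1_e2 : φ (e n 1) (e n 2) =
    (-c 0 + ∑ j ∈ Icc 4 n, α j * a (j - 1) 0) • e n 2
      + (-c 1 + ∑ j ∈ Icc 4 n, α j * a (j - 1) 1) • e n 3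
      + ∑ i ∈ Icc 4 (n - 1), (α i * (-c 0 + ∑ j ∈ Icc 4 n, α j * a (j - 1) 0)) • e n i
  ei_e2 : ∀ i ∈ Icc 2 n, φ (e n i) (e n 2) =
    (-c 0 + ∑ j ∈ Icc 4 n, α j * a (j - 1) 0) • e n i
      + (-c 1 + ∑ j ∈ Icc 4 n, α j * a (j - 1) 1) • e n (i + 1)
      + ∑ k ∈ Icc (i + 2) n,
          (α (k - i + 2) * (-c 0 + ∑ j ∈ Icc 4 n, α j * a (j - 1) 0)) • e n k
  e1_ej : ∀ j ∈ Icc 3 n, φ (e n 1) (e n j) =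
    -a (j - 1) 0 • e n 2 - a (j - 1) 1 • e n 3
      - a (j - 1) 0 • ∑ k ∈ Icc 4 (n - 1), α k • e n k
  ei_ej : ∀ i ∈ Icc 2 n, ∀ j ∈ Icc 3 n, φ (e n i) (e n j) =
    -a (j - 1) 0 • e n i - a (j - 1) 1 • e n (i + 1)
      - a (j - 1) 0 • ∑ k ∈ Icc (i + 2) n, α (k - i + 2) • e n k
  e1_x : φ (e n 1) (x n) =
    (c 0 - α n * a (n - 1) 0) • x n + (c 1 + d 2 - α n * a (n - 1) 1) • e n 1
      + (c 2 + a 1 3 - a 2 3 - d 2 + α n * a (n - 1) 1 + α n * a n 3) • e n 2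
      + ∑ i ∈ Icc 3 (n - 1),
          (c i + a 1 (i + 1) - a 2 (i + 1) + α n * (a n (i + 1) - α (i + 1) * a n 2)
            + ∑ j ∈ Icc 4 i, α j * (a 1 (i - j + 3) - a 2 (i - j + 3))) • e n i
      + c (n + 1) • e n n
  e2_x : φ (e n 2) (x n) = c 0 • x n + ∑ i ∈ Icc 1 n, c i • e n i
  e3_x : φ (e n 3) (x n) =
    (a 2 0 + ∑ j ∈ Icc 4 (n - 1), α j * a j 0) • x n
      + (a 2 1 + ∑ j ∈ Icc 4 (n - 1), α j * a j 1) • e n 1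
      + (-a 2 1 + ∑ j ∈ Icc 4 n, α j * a j 2) • e n 2
      + (c 1 + c 2 + d 2 + ∑ j ∈ Icc 4 n, α j * a j 3) • e n 3
      + ∑ k ∈ Icc 4 n,
          (c (k - 1) - a 2 1 * α k - ∑ j ∈ Icc 2 (k - 2), α (k - j + 2) * a 2 j
            + ∑ j ∈ Icc 4 n, α j * a j k) • e n k
      + (a 2 1 * α n) • e n n
  ei_x : ∀ i ∈ Icc 3 (n - 1), φ (e n (i + 1)) (x n) =
    (a i 0 + ∑ j ∈ Icc (i + 2) (n - 1), α (j - i + 2) * a j 0) • x n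
      + (a i 1 + ∑ j ∈ Icc (i + 2) (n - 1), α (j - i + 2) * a j 1) • e n 1
      + (-a i 1 + ∑ j ∈ Icc (i + 2) n, α (j - i + 2) * a j 2) • e n 2
      + ∑ k ∈ Icc 3 (i - 1),
          (∑ j ∈ Icc (i + 1) (n - 1), α (j - i + k) * a j 1
            + ∑ s ∈ Icc 2 (k - 1), ∑ j ∈ Icc (i + 1) n, α (j + k - i - s + 2) * a j s
            + ∑ j ∈ Icc (i + 2) n, α (j - i + 2) * a j k) • e n k
      + (∑ j ∈ Icc (i + 1) (n - 1), α j * a j 1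
            + ∑ s ∈ Icc 2 (i - 1), ∑ j ∈ Icc (i + 1) n, α (j - s + 2) * a j s
            + ∑ j ∈ Icc (i + 2) n, α (j - i + 2) * a j i) • e n i
      + (c 1 + c 2 + ((i : ℂ) - 1) * d 2 - ∑ j ∈ Icc 3 i, α (j + 1) * (a j 1 + a j 2)
            + ∑ s ∈ Icc 3 i, ∑ j ∈ Icc (i + 1) n, α (j - s + 3) * a j s
            + ∑ j ∈ Icc (i + 2) n, α (j - i + 2) * a j (i + 1)) • e n (i + 1)
      + ∑ k ∈ Icc (i + 2) n,
          (c (k + 1 - i) - ∑ j ∈ Icc 2 i, α (k - i + j) * a j 1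
            - ∑ s ∈ Icc 2 i, ∑ j ∈ Icc 2 (k - s), α (k + 4 - j - s) * a (i - s + 2) j
            + ∑ s ∈ Icc 2 i, ∑ j ∈ Icc (s + 2) n, α (j - s + 2) * a j (k - i + s)) • e n k
      + (α n * a i 1) • e n n
  x_e1 : φ (x n) (e n 1) = -d 2 • e n 1 + ∑ i ∈ Icc 2 n, d i • e n i
  x_ej : ∀ j ∈ Icc 2 n, φ (x n) (e n j) = 0
  x_x : φ (x n) (x n) =
    ∑ i ∈ Icc 2 (n - 1), (d (i + 1) + ∑ j ∈ Icc 4 i, α j * d (i + 3 - j)) • e n i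
      + (α n * d 2) • e n (n - 1) + β • e n n

/-! The cocycles whose classes span the cohomology -/

/-- `ρ(e₁,x) = e₁ - e₂`, `ρ(eᵢ,x) = (i-2) eᵢ` (`3 ≤ i ≤ n`), `ρ(x,e₁) = e₂ - e₁`,
`ρ(x,x) = αₙ e_{n-1}`. -/
def rho (n : ℕ) (α : ℕ → ℂ) : Bil ℂ (V n) :=
  ofTable n fun i j =>
    if j = 0 then
      if i = 0 then α n • e n (n - 1)
      else if i = 1 then e n 1 - e n 2
      else if 3 ≤ i ∧ i ≤ n then ((i : ℂ) - 2) • e n i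
      else 0
    else if i = 0 ∧ j = 1 then e n 2 - e n 1
    else 0

/-- For `4 ≤ k ≤ n-1`: `ψₖ(e₁,x) = eₖ`, `ψₖ(eᵢ,x) = e_{k+i-2}` (`2 ≤ i ≤ n-k+2`);
and `ψₙ(e₂,x) = eₙ`. -/
def psi (n k : ℕ) : Bil ℂ (V n) :=
  ofTable n fun i j =>
    if k = n then
      if i = 2 ∧ j = 0 then e n n else 0
    else if j = 0 then
      if i = 1 then e n k
      else if 2 ≤ i ∧ i ≤ n - k + 2 then e n (k + i - 2)
      else 0
    else 0

/-- `φ_{n,2}` for `k = 2`, and `φ_{n,k}` for `3 ≤ k ≤ n-1`. -/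
def phi (n : ℕ) (α : ℕ → ℂ) (k : ℕ) : Bil ℂ (V n) :=
  ofTable n fun i j =>
    if i = n ∧ j = 1 then e n k
    else if k = 2 then
      if i = 1 ∧ j = 1 then -α n • e n 2
      else if j = 0 then
        if i = 1 then -α n • ∑ l ∈ Icc 3 (n - 1), α (l + 1) • e n l
        else if 3 ≤ i ∧ i ≤ n - 1 then ∑ l ∈ Icc 2 (i - 1), α (n + l + 1 - i) • e n l
        else if i = n then ∑ l ∈ Icc 3 (n - 1), α (l + 1) • e n l
        else 0
      else 0
    else if j = 0 then
      if i = 1 then α n • e n (k - 1)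
      else if 3 ≤ i ∧ i ≤ n - 1 then
        if i ≤ n + 2 - k then ∑ l ∈ Icc k (i + k - 3), α (n + l + 3 - i - k) • e n l
        else ∑ l ∈ Icc k n, α (n + l + 3 - i - k) • e n l
      else if i = n then ∑ l ∈ Icc (k + 1) n, α (l + 3 - k) • e n l
      else 0
    else 0

/-- The family consisting of `ρ`, the `ψₖ` with `k ∈ K`, and the `φ_{n,k}` with
`2 ≤ k ≤ n-1`. -/
def cocycleFamily (n : ℕ) (α : ℕ → ℂ) (K : Finset ℕ) :
    Unit ⊕ (↥K ⊕ ↥(Icc 2 (n - 1))) → Bil ℂ (V n)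
  | .inl _ => rho n α
  | .inr (.inl k) => psi n k
  | .inr (.inr k) => phi n α k

end

end LeibnizR5

open LeibnizR5

/-!
Write `N` and `D` for the right multiplications of `R₅` by `e₁` and by `x` (`opN`, `opD`). They
commute, and the right multiplications by `e₂, …, eₙ` vanish, so that `[u, v]` is a combination of
`N u` and `D u` whose coefficients are the coordinates of `v` at `e₁` and `x`.

**Cocycles.** For a cocycle `φ` put `P = φ(·, e₁)` and `Q = φ(·, x)`. The part of the cocycle
identity that is symmetric in the last two arguments determines the maps `φ(·, eⱼ)`, `j ≥ 2`, as
combinations of `N` and `D`, and fixes a few coordinates of `P` and `Q` at `x` and `e₁`. The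
identity for `(u, x, e₁)` gives the operator equation `N Q - Q N = D P - P D + g D + h N`, where
`g`, `h` are the coordinates of `φ(x, e₁)` at `x` and `e₁`. Conversely these conditions
(`CocycleConditions`) suffice: see `CocycleConditions.mem_ZL2` and `cocycleConditions_of_mem_ZL2`.

**The general form.** On `e₂, …, eₙ` the operator equation is a recursion for `Q e_{i+1}` in terms
of `Q eᵢ` and of `P`. Its solution has the coefficients `lowCoeff`, `midCoeff` and `highCoeff`,
which are those of the general form, and `IsGeneralForm.mem_ZL2` follows by checking that they
obey the recursion. Every parameter is a coordinate of some value of `φ`, and a cocycle for which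
all these coordinates vanish is zero (`eq_zero_of_mem_ZL2`); here `g = 0` because `e_{n+1} = 0`
while the recursion multiplies `g` by a nonzero number. So every cocycle has the general form, and
the dimension of `ZL²` is the number of parameters (`finrank_ZL2`).

**The cohomology.** On the span of `e₂, …, eₙ` the operator `N` is a nilpotent shift, and `D =
f(N)` with `f(t) = 1 + ∑ αₖ t^{k-2}`. For the coboundary of a linear map `d` the operators `P` and
`Q` are commutators with `d` up to combinations of `N` and `D`. If `d N - N d = a N + b D` there,
then `b = 0` (`eq_zero_of_commutator_opN`), and hence `D d - d D = -a N f'(N)`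
(`coord_of_commutator_opD`). In a combination of the classes of `ρ`, `ψₖ`, `φ_{n,k}` the
coefficients can be read off from `Q e₃`, `Q e₂` and `P eₙ`. If the combination is a coboundary,
those of `ρ` and `φ_{n,k}` are zero, and those of `ψₖ` are `-a (k - 2) αₖ`, which vanish as well
if all `αₖ` are zero or if an index `m` with `αₘ ≠ 0` is left out. This is the linear independence
`eq_zero_of_sum_mem_BL2`. Applied to derivations, the same argument bounds their dimension by `n`,
respectively `n - 1` (`derivation_eq_zero`, `derivation_coord_one`), which bounds the dimension of
`HL²` from above by the number of the classes. Both assertions on `HL²` follow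
(`classesFormBasis_of_card`).
-/

namespace LeibnizR5

noncomputable section

/-! ### Coordinates and the two right multiplications -/

/-- The coordinate of a vector at the index `k`; it is zero for `k > n`, in accordance with the
convention `e n k = 0`. -/
def coord (n k : ℕ) : V n →ₗ[ℂ] ℂ :=
  if h : k < n + 1 then LinearMap.proj ⟨k, h⟩ else 0

theorem coord_of_le {n k : ℕ} (h : k ≤ n) (v : V n) : coord n k v = v ⟨k, by omega⟩ := by
  rw [coord, dif_pos (by omega)]; rfl

theorem coord_of_lt {n k : ℕ} (h : n < k) (v : V n) : coord n k v = 0 := by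
  rw [coord, dif_neg (by omega)]; rfl

theorem coord_e (n k i : ℕ) : coord n k (e n i) = if k = i ∧ k ≤ n then 1 else 0 := by
  by_cases h : k ≤ n
  · rw [coord_of_le h]
    simp [e, h]
  · rw [coord_of_lt (by omega), if_neg (by omega)]

theorem coord_e_self {n k : ℕ} (h : k ≤ n) : coord n k (e n k) = 1 := by
  rw [coord_e, if_pos ⟨rfl, h⟩]

theorem coord_e_ne {n k i : ℕ} (h : k ≠ i) : coord n k (e n i) = 0 := by
  rw [coord_e, if_neg (by omega)]

theorem coord_ext {n : ℕ} {v w : V n} (h : ∀ k ≤ n, coord n k v = coord n k w) : v = w := by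
  ext ⟨k, hk⟩
  have := h k (by omega)
  rwa [coord_of_le (by omega), coord_of_le (by omega)] at this

theorem coord_sum_e (n k : ℕ) (s : Finset ℕ) (t : ℕ → ℂ) :
    coord n k (∑ i ∈ s, t i • e n i) = if k ∈ s ∧ k ≤ n then t k else 0 := by
  rw [map_sum]
  simp only [map_smul, coord_e, smul_eq_mul, mul_ite, mul_one, mul_zero]
  by_cases h : k ≤ n
  · simp [h]
  · simp [h]

theorem e_of_lt {n i : ℕ} (h : n < i) : e n i = 0 := by
  refine coord_ext fun k hk => ?_
  rw [coord_e, if_neg (by omega), map_zero]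

theorem e_ne_zero {n i : ℕ} (h : i ≤ n) : e n i ≠ 0 := by
  intro h0
  have := congrArg (coord n i) h0
  rw [coord_e, if_pos ⟨rfl, h⟩, map_zero] at this
  exact one_ne_zero this

/-- Right multiplication by `e₁`. -/
def opN (n : ℕ) (α : ℕ → ℂ) : V n →ₗ[ℂ] V n := (R5 n α).flip (e n 1)

/-- Right multiplication by `x`. -/
def opD (n : ℕ) (α : ℕ → ℂ) : V n →ₗ[ℂ] V n := (R5 n α).flip (e n 0)

section
variable {n : ℕ} {α : ℕ → ℂ}

/-- The right multiplications of the algebra are the combinations of those by `e₁` and `x`. -/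
theorem R5_apply (u v : V n) :
    R5 n α u v = coord n 0 v • opD n α u + coord n 1 v • opN n α u := by
  have h : R5 n α u = (coord n 0).smulRight (opD n α u) + (coord n 1).smulRight (opN n α u) := by
    refine linearMap_ext fun j hj => ?_
    obtain rfl | rfl | h2 : j = 0 ∨ j = 1 ∨ 2 ≤ j := by omega
    · simp [coord_e, opD]
    · simp [coord_e, opN, show 1 ≤ n by omega]
    · have : (R5 n α).flip (e n j) = 0 :=
        linearMap_ext fun i hi => by simpa using R5_e_of_two_le hi hj h2
      have h3 := congrArg (fun f => f u) this
      simp only [LinearMap.flip_apply, LinearMap.zero_apply] at h3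
      rw [h3]
      simp [coord_e, show ¬ 0 = j by omega, show ¬ 1 = j by omega]
  rw [h]
  simp

theorem R5_e_right {j : ℕ} (h : 2 ≤ j) (u : V n) : R5 n α u (e n j) = 0 := by
  rw [R5_apply, coord_e, coord_e, if_neg (by omega), if_neg (by omega)]
  simp

theorem opN_zero : opN n α (e n 0) = 0 := by
  obtain rfl | hn : n = 0 ∨ 1 ≤ n := by omega
  · simp [opN, e_of_lt (show 0 < 1 by omega)]
  rw [opN, LinearMap.flip_apply, R5, ofTable_e n _ (by omega) hn]
  simp

theorem opN_one (hn : 3 ≤ n) : opN n α (e n 1) = e n 3 := by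
  rw [opN, LinearMap.flip_apply, R5, ofTable_e n _ (by omega) (by omega)]
  simp

theorem opN_e (hn : 3 ≤ n) {i : ℕ} (hi : 2 ≤ i) : opN n α (e n i) = e n (i + 1) := by
  by_cases h : n < i
  · rw [e_of_lt h, e_of_lt (by omega), map_zero]
  rw [opN, LinearMap.flip_apply, R5, ofTable_e n _ (by omega) (by omega), if_pos rfl,
    if_neg (by omega)]
  split_ifs with h'
  · rfl
  · rw [e_of_lt (by omega)]

theorem opD_zero : opD n α (e n 0) = 0 := by
  rw [opD, LinearMap.flip_apply, R5, ofTable_e n _ (by omega) (by omega)]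
  simp

theorem opD_one (hn : 3 ≤ n) :
    opD n α (e n 1) = e n 2 + ∑ k ∈ Icc 4 (n - 1), α k • e n k := by
  rw [opD, LinearMap.flip_apply, R5, ofTable_e n _ (by omega) (by omega)]
  simp

theorem opD_e (i : ℕ) (hi : 2 ≤ i) :
    opD n α (e n i) = e n i + ∑ k ∈ Icc (i + 2) n, α (k - i + 2) • e n k := by
  by_cases h : n < i
  · rw [e_of_lt h, map_zero, Icc_eq_empty (by omega)]
    simp
  rw [opD, LinearMap.flip_apply, R5, ofTable_e n _ (by omega) (by omega), if_neg (by omega),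
    if_pos rfl, if_neg (by omega), if_pos (by omega)]

/-- The two right multiplications commute: this is the Leibniz identity, as `[x, e₁] = 0`. -/
theorem opN_opD (hn : 3 ≤ n) (u : V n) : opN n α (opD n α u) = opD n α (opN n α u) := by
  have h := R5_isLeibniz hn α u (e n 0) (e n 1)
  have h1 : R5 n α (e n 0) (e n 1) = 0 := opN_zero
  rw [h1, map_zero] at h
  exact (sub_eq_zero.1 h.symm)

theorem coord_opN (hn : 3 ≤ n) {k : ℕ} (h4 : 4 ≤ k) (hk : k ≤ n) (u : V n) :
    coord n k (opN n α u) = coord n (k - 1) u := by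
  have : coord n k ∘ₗ opN n α = coord n (k - 1) := by
    refine linearMap_ext fun i hi => ?_
    obtain rfl | rfl | h2 : i = 0 ∨ i = 1 ∨ 2 ≤ i := by omega
    · simp [opN_zero, coord_e]; omega
    · rw [LinearMap.comp_apply, opN_one hn, coord_e_ne (by omega), coord_e_ne (by omega)]
    · rw [LinearMap.comp_apply, opN_e hn h2, coord_e, coord_e]
      congr 1; apply propext; omega
  exact congrArg (fun f => f u) this

theorem coord_three_opN (hn : 3 ≤ n) (u : V n) :
    coord n 3 (opN n α u) = coord n 1 u + coord n 2 u := by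
  have : coord n 3 ∘ₗ opN n α = coord n 1 + coord n 2 := by
    refine linearMap_ext fun i hi => ?_
    obtain rfl | rfl | rfl | h2 : i = 0 ∨ i = 1 ∨ i = 2 ∨ 3 ≤ i := by omega
    · simp [opN_zero, coord_e]
    · simp [opN_one hn, coord_e, show 3 ≤ n by omega]; omega
    · simp [opN_e hn, coord_e, show 3 ≤ n by omega]; omega
    · rw [LinearMap.comp_apply, opN_e hn (by omega), LinearMap.add_apply, coord_e, coord_e, coord_e,
        if_neg (by omega), if_neg (by omega), if_neg (by omega), add_zero]
  exact congrArg (fun f => f u) this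

theorem coord_opN_of_lt (hn : 3 ≤ n) {k : ℕ} (hk : k < 3) (u : V n) :
    coord n k (opN n α u) = 0 := by
  have : coord n k ∘ₗ opN n α = 0 := by
    refine linearMap_ext fun i hi => ?_
    obtain rfl | rfl | h2 : i = 0 ∨ i = 1 ∨ 2 ≤ i := by omega
    · simp [opN_zero]
    · simp [opN_one hn, coord_e]; omega
    · rw [LinearMap.comp_apply, opN_e hn (by omega), coord_e, if_neg (by omega)]; rfl
  exact congrArg (fun f => f u) this

theorem coord_opD_of_lt (hn : 3 ≤ n) {k : ℕ} (hk : k < 2) (u : V n) :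
    coord n k (opD n α u) = 0 := by
  have : coord n k ∘ₗ opD n α = 0 := by
    refine linearMap_ext fun i hi => ?_
    obtain rfl | rfl | h2 : i = 0 ∨ i = 1 ∨ 2 ≤ i := by omega
    · simp [opD_zero]
    · rw [LinearMap.comp_apply, opD_one hn, map_add, coord_sum_e, coord_e, if_neg (by omega),
        if_neg (by simp; omega)]; simp
    · rw [LinearMap.comp_apply, opD_e i h2, map_add, coord_e, if_neg (by omega), coord_sum_e,
        if_neg (by simp; omega)]; simp
  exact congrArg (fun f => f u) this

theorem coord_two_opD (hn : 3 ≤ n) (u : V n) :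
    coord n 2 (opD n α u) = coord n 1 u + coord n 2 u := by
  have : coord n 2 ∘ₗ opD n α = coord n 1 + coord n 2 := by
    refine linearMap_ext fun i hi => ?_
    obtain rfl | rfl | h2 : i = 0 ∨ i = 1 ∨ 2 ≤ i := by omega
    · simp [opD_zero, coord_e]
    · rw [LinearMap.comp_apply, opD_one hn, map_add, coord_sum_e, if_neg (by simp),
        coord_e_self (by omega), LinearMap.add_apply, coord_e_self hi, coord_e_ne (by omega)]
    · rw [LinearMap.comp_apply, opD_e i h2, map_add, coord_sum_e, if_neg (by simp; omega),
        LinearMap.add_apply, coord_e n 1, if_neg (by omega)]; simp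
  exact congrArg (fun f => f u) this

/-- The coordinates of `[u, x]` with index at least `3`. The case distinction reflects that
`[e₁, x]` lacks the summand `αₙ eₙ` that `[e₂, x]` has. -/
theorem coord_opD (hα : ∀ k, ¬ (4 ≤ k ∧ k ≤ n) → α k = 0) (hn : 3 ≤ n) {k : ℕ} (h3 : 3 ≤ k)
    (hk : k ≤ n) (u : V n) :
    coord n k (opD n α u) = coord n k u + (if k < n then α k * coord n 1 u else 0)
      + ∑ l ∈ Icc 2 (k - 2), α (k - l + 2) * coord n l u := by
  have : coord n k ∘ₗ opD n α = coord n k + (if k < n then α k else 0) • coord n 1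
      + ∑ l ∈ Icc 2 (k - 2), α (k - l + 2) • coord n l := by
    refine linearMap_ext fun i hi => ?_
    obtain rfl | rfl | h2 : i = 0 ∨ i = 1 ∨ 2 ≤ i := by omega
    · have : ∑ l ∈ Icc 2 (k - 2), α (k - l + 2) * coord n l (e n 0) = 0 :=
        sum_eq_zero fun l hl => by
          rw [mem_Icc] at hl
          rw [coord_e, if_neg (by omega), mul_zero]
      simp only [LinearMap.comp_apply, opD_zero, map_zero, LinearMap.add_apply,
        LinearMap.sum_apply, LinearMap.smul_apply, smul_eq_mul, this]
      rw [coord_e_ne (by omega), coord_e_ne (by omega)]; simp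
    · have : ∑ l ∈ Icc 2 (k - 2), α (k - l + 2) * coord n l (e n 1) = 0 :=
        sum_eq_zero fun l hl => by
          rw [mem_Icc] at hl
          rw [coord_e, if_neg (by omega), mul_zero]
      simp only [LinearMap.comp_apply, opD_one hn, map_add, coord_sum_e, LinearMap.add_apply,
        LinearMap.sum_apply, LinearMap.smul_apply, smul_eq_mul, this]
      rw [coord_e, coord_e_ne (by omega : k ≠ 1), coord_e_self hi,
        if_neg (by omega : ¬ (k = 2 ∧ k ≤ n))]
      by_cases h : k < n
      · rw [if_pos h]
        split_ifs with h4
        · simp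
        · rw [mem_Icc] at h4
          rw [hα k (by omega)]; simp
      · rw [if_neg h, if_neg (by rw [mem_Icc]; omega)]; simp
    · simp only [LinearMap.comp_apply, opD_e i h2, map_add, coord_sum_e, LinearMap.add_apply,
        LinearMap.sum_apply, LinearMap.smul_apply, smul_eq_mul]
      rw [coord_e_ne (by omega : 1 ≠ i), mul_zero, add_zero]
      congr 1
      have : ∀ l, coord n l (e n i) = if l = i then 1 else 0 := by
        intro l
        rw [coord_e]; congr 1; apply propext; omega
      simp only [this, mul_ite, mul_one, mul_zero, sum_ite_eq', mem_Icc]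
      congr 1; apply propext; omega
  have := congrArg (fun f => f u) this
  simp only [LinearMap.comp_apply, LinearMap.add_apply, LinearMap.sum_apply,
    LinearMap.smul_apply, smul_eq_mul] at this
  rw [this]
  simp only [ite_mul, zero_mul]

end

/-! ### The cocycle identity in terms of the two right multiplications -/

/-- The cocycle identity written out for `R₅`. As the right multiplications by `e₂, …, eₙ` vanish,
it forces the maps `φ(·, eⱼ)` with `j ≥ 2` into the span of the right multiplications by `x` and
`e₁`, fixes the coordinates with index `0` and `1` of several values, and leaves one equation
between the operators `φ(·, x)` and `φ(·, e₁)`. -/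
structure CocycleConditions (n : ℕ) (α : ℕ → ℂ) (φ : Bil ℂ (V n)) : Prop where
  right_two : ∀ u, φ u (e n 2) =
    (-coord n 0 (φ (e n 2) (e n 0))
      + ∑ j ∈ Icc 4 n, α j * coord n 0 (φ (e n (j - 1)) (e n 1))) • opD n α u
    + (-coord n 1 (φ (e n 2) (e n 0))
      + ∑ j ∈ Icc 4 n, α j * coord n 1 (φ (e n (j - 1)) (e n 1))) • opN n α u
  right : ∀ j ∈ Icc 3 n, ∀ u, φ u (e n j) =
    -coord n 0 (φ (e n (j - 1)) (e n 1)) • opD n α u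
      - coord n 1 (φ (e n (j - 1)) (e n 1)) • opN n α u
  one_one : ∀ r < 2, coord n r (φ (e n 1) (e n 1)) = coord n r (φ (e n 2) (e n 1))
  last_one : ∀ r < 2, coord n r (φ (e n n) (e n 1)) = 0
  succ_x : ∀ j ∈ Icc 2 (n - 1), ∀ r < 2, coord n r (φ (e n (j + 1)) (e n 0)) =
    coord n r (φ (e n j) (e n 1))
      + ∑ k ∈ Icc (j + 2) (n - 1), α (k - j + 2) * coord n r (φ (e n k) (e n 1))
  x_x : ∀ r < 2, coord n r (φ (e n 0) (e n 0)) = 0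
  one_x : ∀ r < 2, coord n r (φ (e n 1) (e n 0)) + coord n r (φ (e n 0) (e n 1)) =
    coord n r (φ (e n 2) (e n 0)) - α n * coord n r (φ (e n (n - 1)) (e n 1))
  comm : ∀ u, opN n α (φ u (e n 0)) - φ (opN n α u) (e n 0) =
    opD n α (φ u (e n 1)) - φ (opD n α u) (e n 1)
      + coord n 0 (φ (e n 0) (e n 1)) • opD n α u + coord n 1 (φ (e n 0) (e n 1)) • opN n α u

section
variable {n : ℕ} {α : ℕ → ℂ}

theorem R5_one (u : V n) : R5 n α u (e n 1) = opN n α u := rfl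

theorem R5_x (u : V n) : R5 n α u (e n 0) = opD n α u := rfl

theorem eq_zero_of_opD_opN (hn : 3 ≤ n) {p q : ℂ}
    (h : ∀ u, p • opD n α u + q • opN n α u = 0) : p = 0 ∧ q = 0 := by
  have h2 := h (e n 2)
  rw [opD_e 2 le_rfl, opN_e hn le_rfl] at h2
  have c2 := congrArg (coord n 2) h2
  have c3 := congrArg (coord n 3) h2
  simp only [map_add, map_smul, coord_sum_e, map_zero, smul_eq_mul] at c2 c3
  rw [coord_e_self (by omega), coord_e_ne (by omega), if_neg (by rw [mem_Icc]; omega)] at c2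
  rw [coord_e_self (by omega), coord_e_ne (by omega), if_neg (by rw [mem_Icc]; omega)] at c3
  exact ⟨by simpa using c2, by simpa using c3⟩

theorem eq_of_opD_opN (hn : 3 ≤ n) {p q p' q' : ℂ}
    (h : ∀ u, p • opD n α u + q • opN n α u = p' • opD n α u + q' • opN n α u) :
    p = p' ∧ q = q' := by
  have := eq_zero_of_opD_opN (α := α) hn (p := p - p') (q := q - q') fun u => by
    rw [sub_smul, sub_smul]
    linear_combination (norm := module) h u
  exact ⟨sub_eq_zero.1 this.1, sub_eq_zero.1 this.2⟩

theorem apply_sum_of_right {φ : Bil ℂ (V n)} {p q : ℕ → ℂ} {m r : ℕ}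
    (h : ∀ j ∈ Icc m r, ∀ u, φ u (e n j) = p j • opD n α u + q j • opN n α u)
    (t : ℕ → ℂ) (u : V n) :
    φ u (∑ k ∈ Icc m r, t k • e n k) =
      (∑ k ∈ Icc m r, t k * p k) • opD n α u + (∑ k ∈ Icc m r, t k * q k) • opN n α u := by
  rw [map_sum, sum_smul, sum_smul, ← sum_add_distrib]
  refine sum_congr rfl fun k hk => ?_
  rw [map_smul, h k hk, smul_add, smul_smul, smul_smul]

/-- Splitting off the last summand is correct even if `n = 3`, since then `αₙ = 0`. -/
theorem sum_Icc_top (hα : ∀ k, ¬ (4 ≤ k ∧ k ≤ n) → α k = 0) (t : ℕ → ℂ) :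
    ∑ k ∈ Icc 4 n, α k * t k = ∑ k ∈ Icc 4 (n - 1), α k * t k + α n * t n := by
  by_cases h : 4 ≤ n
  · obtain ⟨m, rfl⟩ : ∃ m, n = m + 1 := ⟨n - 1, by omega⟩
    rw [sum_Icc_succ_top (by omega)]
    rfl
  · rw [Icc_eq_empty (by omega), Icc_eq_empty (by omega), hα n (by omega)]
    simp

theorem sum_Icc_pred (j : ℕ) (hn : 1 ≤ n) (t : ℕ → ℂ) :
    ∑ k ∈ Icc (j + 3) n, α (k - (j + 1) + 2) * t (k - 1) =
      ∑ k ∈ Icc (j + 2) (n - 1), α (k - j + 2) * t k := by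
  obtain ⟨m, rfl⟩ : ∃ m, n = m + 1 := ⟨n - 1, by omega⟩
  rw [show j + 3 = j + 2 + 1 from rfl, ← Finset.map_add_right_Icc, Finset.sum_map]
  refine sum_congr rfl fun k hk => ?_
  simp only [addRightEmbedding_apply, Nat.add_sub_cancel, Nat.add_sub_add_right]

/-- The coordinates, with respect to the right multiplications by `x` (`r = 0`) and `e₁` (`r = 1`),
of `φ(·, eⱼ)` for a cocycle `φ` and `j ≥ 2`. -/
def rightCoeff (n : ℕ) (α : ℕ → ℂ) (φ : Bil ℂ (V n)) (r j : ℕ) : ℂ :=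
  if j = 2 then -coord n r (φ (e n 2) (e n 0))
      + ∑ j ∈ Icc 4 n, α j * coord n r (φ (e n (j - 1)) (e n 1))
  else -coord n r (φ (e n (j - 1)) (e n 1))

theorem rightCoeff_two (φ : Bil ℂ (V n)) (r : ℕ) :
    rightCoeff n α φ r 2 = -coord n r (φ (e n 2) (e n 0))
      + ∑ j ∈ Icc 4 n, α j * coord n r (φ (e n (j - 1)) (e n 1)) := if_pos rfl

theorem rightCoeff_of_ne (φ : Bil ℂ (V n)) (r : ℕ) {j : ℕ} (h : j ≠ 2) :
    rightCoeff n α φ r j = -coord n r (φ (e n (j - 1)) (e n 1)) := if_neg h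

theorem CocycleConditions.apply_right {φ : Bil ℂ (V n)} (h : CocycleConditions n α φ) {j : ℕ}
    (h2 : 2 ≤ j) (hj : j ≤ n) (u : V n) :
    φ u (e n j) = rightCoeff n α φ 0 j • opD n α u + rightCoeff n α φ 1 j • opN n α u := by
  obtain rfl | h3 : j = 2 ∨ j ≠ 2 := by omega
  · rw [h.right_two, rightCoeff_two, rightCoeff_two]
  · rw [h.right j (by rw [mem_Icc]; omega), rightCoeff_of_ne _ _ h3, rightCoeff_of_ne _ _ h3,
      neg_smul, neg_smul, sub_eq_add_neg]

theorem CocycleConditions.coord_x {φ : Bil ℂ (V n)} (h : CocycleConditions n α φ) (hn : 3 ≤ n)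
    {j r : ℕ} (h2 : 2 ≤ j) (hj : j ≤ n) (hr : r < 2) :
    coord n r (φ (e n j) (e n 0)) + (rightCoeff n α φ r j
      + ∑ k ∈ Icc (j + 2) n, α (k - j + 2) * rightCoeff n α φ r k) = 0 := by
  have hs : ∑ k ∈ Icc (j + 2) n, α (k - j + 2) * rightCoeff n α φ r k =
      - ∑ k ∈ Icc (j + 2) n, α (k - j + 2) * coord n r (φ (e n (k - 1)) (e n 1)) := by
    rw [← sum_neg_distrib]
    refine sum_congr rfl fun k hk => ?_
    rw [mem_Icc] at hk
    rw [rightCoeff_of_ne _ _ (by omega), mul_neg]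
  rw [hs]
  obtain rfl | h3 : j = 2 ∨ 3 ≤ j := by omega
  · rw [rightCoeff_two]
    have : ∑ k ∈ Icc (2 + 2) n, α (k - 2 + 2) * coord n r (φ (e n (k - 1)) (e n 1)) =
        ∑ k ∈ Icc 4 n, α k * coord n r (φ (e n (k - 1)) (e n 1)) := by
      refine sum_congr rfl fun k hk => ?_
      rw [mem_Icc] at hk
      rw [Nat.sub_add_cancel (by omega)]
    rw [this]
    ring
  · obtain ⟨i, rfl⟩ : ∃ i, j = i + 1 := ⟨j - 1, by omega⟩
    rw [rightCoeff_of_ne _ _ (by omega), h.succ_x i (by rw [mem_Icc]; omega) r hr,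
      sum_Icc_pred i (by omega) (fun k => coord n r (φ (e n k) (e n 1))), Nat.add_sub_cancel]
    ring

theorem CocycleConditions.coord_one_x {φ : Bil ℂ (V n)} (h : CocycleConditions n α φ)
    (hα : ∀ k, ¬ (4 ≤ k ∧ k ≤ n) → α k = 0) {r : ℕ} (hr : r < 2) :
    coord n r (φ (e n 1) (e n 0)) + coord n r (φ (e n 0) (e n 1)) + (rightCoeff n α φ r 2
      + ∑ k ∈ Icc 4 (n - 1), α k * rightCoeff n α φ r k) = 0 := by
  have hs : ∑ k ∈ Icc 4 (n - 1), α k * rightCoeff n α φ r k =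
      - ∑ k ∈ Icc 4 (n - 1), α k * coord n r (φ (e n (k - 1)) (e n 1)) := by
    rw [← sum_neg_distrib]
    refine sum_congr rfl fun k hk => ?_
    rw [mem_Icc] at hk
    rw [rightCoeff_of_ne _ _ (by omega), mul_neg]
  rw [hs, h.one_x r hr, rightCoeff_two, sum_Icc_top hα]
  ring

theorem CocycleConditions.mem_ZL2 {φ : Bil ℂ (V n)} (h : CocycleConditions n α φ)
    (hα : ∀ k, ¬ (4 ≤ k ∧ k ≤ n) → α k = 0) (hn : 3 ≤ n) : φ ∈ ZL2 (R5 n α) := by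
  have hW : ∀ j ∈ Icc 2 n, ∀ u, φ u (e n j) =
      rightCoeff n α φ 0 j • opD n α u + rightCoeff n α φ 1 j • opN n α u := fun j hj u => by
    rw [mem_Icc] at hj
    exact h.apply_right hj.1 hj.2 u
  -- the right multiplications by `φ(eᵢ, eⱼ)` vanish for `j ≥ 2`
  have hz : ∀ u v, ∀ j, 2 ≤ j → j ≤ n → R5 n α u (φ v (e n j)) = 0 := by
    intro u v j h2 hj
    rw [R5_apply, h.apply_right h2 hj, map_add, map_add, map_smul, map_smul, map_smul, map_smul,
      coord_opD_of_lt hn (by omega), coord_opD_of_lt hn (by omega),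
      coord_opN_of_lt hn (by omega), coord_opN_of_lt hn (by omega)]
    simp
  have hx1 : R5 n α (e n 0) (e n 1) = 0 := opN_zero
  have hxx : R5 n α (e n 0) (e n 0) = 0 := opD_zero
  have key : ∀ u, ∀ j ≤ n, ∀ k ≤ n,
      R5 n α u (φ (e n j) (e n k)) - R5 n α (φ u (e n j)) (e n k) + R5 n α (φ u (e n k)) (e n j)
      + φ u (R5 n α (e n j) (e n k)) - φ (R5 n α u (e n j)) (e n k)
      + φ (R5 n α u (e n k)) (e n j) = 0 := by
    intro u j hj k hk
    by_cases hk2 : 2 ≤ k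
    · rw [hz _ _ k hk2 hk, R5_e_right hk2, R5_e_right hk2, R5_e_right hk2,
        h.apply_right hk2 hk, h.apply_right hk2 hk]
      obtain rfl | rfl | h2 : j = 0 ∨ j = 1 ∨ 2 ≤ j := by omega
      · simp [R5_x, opN_opD hn]
      · simp [R5_one, opN_opD hn]
      · simp [R5_e_right h2]
    by_cases hj2 : 2 ≤ j
    · rw [R5_e_right hj2, R5_e_right hj2, h.apply_right hj2 hj u,
        h.apply_right hj2 hj (R5 n α u _)]
      obtain rfl | rfl : k = 0 ∨ k = 1 := by omega
      · rw [R5_x, R5_x, R5_x, opD_e _ hj2, map_add (φ u), h.apply_right hj2 hj,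
          apply_sum_of_right fun k hk => hW k (by rw [mem_Icc] at hk ⊢; omega), R5_apply]
        have e0 := h.coord_x hn hj2 hj (show 0 < 2 by omega)
        have e1 := h.coord_x hn hj2 hj (show 1 < 2 by omega)
        simp only [map_add, map_smul, opN_opD hn, map_zero, LinearMap.zero_apply]
        linear_combination (norm := module) e0 • opD n α u + e1 • opN n α u
      · rw [R5_one, R5_one, R5_one, opN_e hn hj2, R5_apply]
        simp only [map_add, map_smul, opN_opD hn, map_zero, LinearMap.zero_apply]
        by_cases hl : j = n
        · subst hl
          rw [e_of_lt (Nat.lt_succ_self j), map_zero, h.last_one 0 (by omega),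
            h.last_one 1 (by omega)]
          module
        · rw [h.apply_right (j := j + 1) (by omega) (by omega),
            rightCoeff_of_ne φ 0 (show j + 1 ≠ 2 by omega),
            rightCoeff_of_ne φ 1 (show j + 1 ≠ 2 by omega), Nat.add_sub_cancel]
          module
    obtain rfl | rfl : j = 0 ∨ j = 1 := by omega
    · obtain rfl | rfl : k = 0 ∨ k = 1 := by omega
      · rw [hxx, R5_apply, h.x_x 0 (by omega), h.x_x 1 (by omega)]
        simp
      · rw [hx1, R5_apply, R5_one, R5_one, R5_x, R5_x]
        have := h.comm u
        simp only [map_zero, add_zero]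
        linear_combination (norm := module) -this
    · obtain rfl | rfl : k = 0 ∨ k = 1 := by omega
      · rw [R5_x, R5_x, R5_x, R5_one, R5_one, opD_one hn, map_add, h.apply_right le_rfl (by omega),
          apply_sum_of_right fun k hk => hW k (by rw [mem_Icc] at hk ⊢; omega), R5_apply]
        have e0 := h.coord_one_x hα (show 0 < 2 by omega)
        have e1 := h.coord_one_x hα (show 1 < 2 by omega)
        have e2 := h.comm u
        linear_combination (norm := module) e0 • opD n α u + e1 • opN n α u + e2
      · rw [R5_one (e n 1), opN_one hn, R5_apply, h.apply_right (by omega) hn,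
          rightCoeff_of_ne _ _ (by omega), rightCoeff_of_ne _ _ (by omega),
          h.one_one 0 (by omega), h.one_one 1 (by omega)]
        module
  intro u
  have s1 : ∀ k ≤ n, ∀ v,
      R5 n α u (φ v (e n k)) - R5 n α (φ u v) (e n k) + R5 n α (φ u (e n k)) v
      + φ u (R5 n α v (e n k)) - φ (R5 n α u v) (e n k)
      + φ (R5 n α u (e n k)) v = 0 := by
    intro k hk v
    have : R5 n α u ∘ₗ φ.flip (e n k) - (R5 n α).flip (e n k) ∘ₗ φ u + R5 n α (φ u (e n k))
        + φ u ∘ₗ (R5 n α).flip (e n k) - φ.flip (e n k) ∘ₗ R5 n α u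
        + φ (R5 n α u (e n k)) = 0 :=
      linearMap_ext fun j hj => key u j hj k hk
    exact congrArg (fun f => f v) this
  intro v w
  have : R5 n α u ∘ₗ φ v - R5 n α (φ u v) + (R5 n α).flip v ∘ₗ φ u
      + φ u ∘ₗ R5 n α v - φ (R5 n α u v) + φ.flip v ∘ₗ R5 n α u = 0 :=
    linearMap_ext fun k hk => s1 k hk v
  exact congrArg (fun f => f w) this

/-- The symmetric part of the cocycle identity. -/
theorem symm_of_mem_ZL2 {φ : Bil ℂ (V n)} (h : φ ∈ ZL2 (R5 n α)) (u v w : V n) :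
    φ u (R5 n α v w + R5 n α w v) = -R5 n α u (φ v w + φ w v) := by
  have h1 := h u v w
  have h2 := h u w v
  rw [map_add, map_add]
  linear_combination (norm := module) h1 + h2

/-- The identity `symm_of_mem_ZL2` expresses `φ(·, eⱼ)`, `j ≥ 2`, by the right multiplications by
`x` and `e₁`; as these are linearly independent, comparing the expressions obtained in different
ways yields the conditions on the coordinates. -/
theorem cocycleConditions_of_mem_ZL2 {φ : Bil ℂ (V n)} (h : φ ∈ ZL2 (R5 n α))
    (hα : ∀ k, ¬ (4 ≤ k ∧ k ≤ n) → α k = 0) (hn : 3 ≤ n) : CocycleConditions n α φ := by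
  have succ : ∀ j, 2 ≤ j → ∀ u, φ u (e n (j + 1)) =
      -R5 n α u (φ (e n j) (e n 1) + φ (e n 1) (e n j)) := by
    intro j hj u
    have := symm_of_mem_ZL2 h u (e n j) (e n 1)
    rwa [R5_e_right hj, add_zero, R5_one, opN_e hn hj] at this
  -- `e₃, …, eₙ` and `[e₂, x]`, which is `e₂` plus a combination of `e₄, …, eₙ`, have the form
  -- `[v, w] + [w, v]`
  have ex3 : ∀ j, 3 ≤ j → ∃ p q : ℂ, ∀ u, φ u (e n j) = p • opD n α u + q • opN n α u := by
    intro j hj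
    obtain ⟨i, rfl⟩ : ∃ i, j = i + 1 := ⟨j - 1, by omega⟩
    refine ⟨-coord n 0 (φ (e n i) (e n 1) + φ (e n 1) (e n i)),
      -coord n 1 (φ (e n i) (e n 1) + φ (e n 1) (e n i)), fun u => ?_⟩
    rw [succ i (by omega), R5_apply]
    module
  choose! p q hpq using ex3
  have ex2 : ∀ j, 2 ≤ j → ∃ p q : ℂ, ∀ u, φ u (e n j) = p • opD n α u + q • opN n α u := by
    intro j hj
    obtain rfl | hj : j = 2 ∨ 3 ≤ j := by omega
    · refine ⟨-coord n 0 (φ (e n 2) (e n 0) + φ (e n 0) (e n 2)) -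
        ∑ k ∈ Icc (2 + 2) n, α (k - 2 + 2) * p k,
        -coord n 1 (φ (e n 2) (e n 0) + φ (e n 0) (e n 2)) -
        ∑ k ∈ Icc (2 + 2) n, α (k - 2 + 2) * q k, fun u => ?_⟩
      have h1 := symm_of_mem_ZL2 h u (e n 2) (e n 0)
      rw [R5_e_right le_rfl, add_zero, R5_x, opD_e 2 le_rfl, map_add, R5_apply,
        apply_sum_of_right fun k hk => hpq k (by rw [mem_Icc] at hk; omega)] at h1
      linear_combination (norm := module) h1
    · exact ⟨_, _, hpq j hj⟩
  -- the right multiplications by `φ(e₁, eⱼ)` and `φ(x, eⱼ)` vanish for `j ≥ 2`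
  have hz1 : ∀ j, 2 ≤ j → ∀ u, R5 n α u (φ (e n 1) (e n j)) = 0 := by
    intro j hj u
    obtain ⟨p, q, hp⟩ := ex2 j hj
    have := h u (e n 1) (e n j)
    rw [R5_e_right hj, R5_e_right hj, R5_e_right hj, hp u, hp (R5 n α u _), R5_one, R5_one] at this
    simp only [map_add, map_smul, opN_opD hn, map_zero, LinearMap.zero_apply] at this
    linear_combination (norm := module) this
  have hz0 : ∀ j, 2 ≤ j → ∀ u, R5 n α u (φ (e n 0) (e n j)) = 0 := by
    intro j hj u
    obtain ⟨p, q, hp⟩ := ex2 j hj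
    have := h u (e n 0) (e n j)
    rw [R5_e_right hj, R5_e_right hj, R5_e_right hj, hp u, hp (R5 n α u _), R5_x, R5_x] at this
    simp only [map_add, map_smul, opN_opD hn, map_zero, LinearMap.zero_apply] at this
    linear_combination (norm := module) this
  have hsucc : ∀ j, 2 ≤ j → ∀ u, φ u (e n (j + 1)) =
      -coord n 0 (φ (e n j) (e n 1)) • opD n α u - coord n 1 (φ (e n j) (e n 1)) • opN n α u := by
    intro j hj u
    rw [succ j hj, map_add, hz1 j hj, add_zero, R5_apply]
    module
  have hright : ∀ j ∈ Icc 3 n, ∀ u, φ u (e n j) =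
      -coord n 0 (φ (e n (j - 1)) (e n 1)) • opD n α u
      + -coord n 1 (φ (e n (j - 1)) (e n 1)) • opN n α u := by
    intro j hj u
    rw [mem_Icc] at hj
    have := hsucc (j - 1) (by omega) u
    rw [Nat.sub_add_cancel (by omega)] at this
    rw [this]
    module
  have hD : ∀ j, 2 ≤ j → ∀ u, φ u (opD n α (e n j)) =
      -coord n 0 (φ (e n j) (e n 0)) • opD n α u
      + -coord n 1 (φ (e n j) (e n 0)) • opN n α u := by
    intro j hj u
    have := symm_of_mem_ZL2 h u (e n j) (e n 0)
    rw [R5_e_right hj, add_zero, R5_x, map_add, hz0 j hj, add_zero, R5_apply] at this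
    rw [this]
    module
  have hDs : ∀ j, 2 ≤ j → ∀ u, φ u (opD n α (e n j)) = φ u (e n j)
      + ((- ∑ k ∈ Icc (j + 2) n, α (k - j + 2) * coord n 0 (φ (e n (k - 1)) (e n 1))) • opD n α u
      + (- ∑ k ∈ Icc (j + 2) n, α (k - j + 2) * coord n 1 (φ (e n (k - 1)) (e n 1)))
        • opN n α u) := by
    intro j hj u
    rw [opD_e j hj, map_add,
      apply_sum_of_right fun k hk => hright k (by rw [mem_Icc] at hk ⊢; omega)]
    simp only [mul_neg, sum_neg_distrib]
  have h4 : ∀ r, ∑ k ∈ Icc (2 + 2) n, α (k - 2 + 2) * coord n r (φ (e n (k - 1)) (e n 1)) =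
      ∑ k ∈ Icc 4 n, α k * coord n r (φ (e n (k - 1)) (e n 1)) := fun r => by
    refine sum_congr rfl fun k hk => ?_
    rw [mem_Icc] at hk
    rw [Nat.sub_add_cancel (by omega)]
  have h2 : ∀ u, φ u (e n 2) =
    (-coord n 0 (φ (e n 2) (e n 0))
      + ∑ j ∈ Icc 4 n, α j * coord n 0 (φ (e n (j - 1)) (e n 1))) • opD n α u
    + (-coord n 1 (φ (e n 2) (e n 0))
      + ∑ j ∈ Icc 4 n, α j * coord n 1 (φ (e n (j - 1)) (e n 1))) • opN n α u := by
    intro u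
    have e1 := hD 2 le_rfl u
    rw [hDs 2 le_rfl, h4, h4] at e1
    linear_combination (norm := module) e1
  constructor
  · exact h2
  · intro j hj u
    rw [hright j hj u]
    module
  · have h3 : ∀ u, -coord n 0 (φ (e n 1) (e n 1)) • opD n α u
        + -coord n 1 (φ (e n 1) (e n 1)) • opN n α u =
        -coord n 0 (φ (e n 2) (e n 1)) • opD n α u
        + -coord n 1 (φ (e n 2) (e n 1)) • opN n α u := by
      intro u
      have e1 := h u (e n 1) (e n 1)
      have e2 := hsucc 2 le_rfl u
      rw [R5_one (e n 1), opN_one hn, R5_apply] at e1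
      linear_combination (norm := module) e2 - e1
    have h4 := eq_of_opD_opN hn h3
    intro r hr
    obtain rfl | rfl : r = 0 ∨ r = 1 := by omega
    · exact neg_injective h4.1
    · exact neg_injective h4.2
  · have h3 : ∀ u, -coord n 0 (φ (e n n) (e n 1)) • opD n α u
        + -coord n 1 (φ (e n n) (e n 1)) • opN n α u = 0 := by
      intro u
      have e1 := hsucc n (by omega) u
      rw [e_of_lt (Nat.lt_succ_self n), map_zero] at e1
      linear_combination (norm := module) -e1
    have h4 := eq_zero_of_opD_opN hn h3
    intro r hr
    obtain rfl | rfl : r = 0 ∨ r = 1 := by omega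
    · exact neg_eq_zero.1 h4.1
    · exact neg_eq_zero.1 h4.2
  · intro j hj r hr
    rw [mem_Icc] at hj
    have h3 : ∀ u, coord n 0 (φ (e n (j + 1)) (e n 0)) • opD n α u
        + coord n 1 (φ (e n (j + 1)) (e n 0)) • opN n α u =
        (coord n 0 (φ (e n j) (e n 1))
          + ∑ k ∈ Icc (j + 2) (n - 1), α (k - j + 2) * coord n 0 (φ (e n k) (e n 1))) • opD n α u
        + (coord n 1 (φ (e n j) (e n 1))
          + ∑ k ∈ Icc (j + 2) (n - 1), α (k - j + 2) * coord n 1 (φ (e n k) (e n 1)))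
          • opN n α u := by
      intro u
      have e1 := hD (j + 1) (by omega) u
      rw [hDs (j + 1) (by omega), hsucc j hj.1,
        sum_Icc_pred j (by omega) (fun k => coord n 0 (φ (e n k) (e n 1))),
        sum_Icc_pred j (by omega) (fun k => coord n 1 (φ (e n k) (e n 1)))] at e1
      linear_combination (norm := module) e1
    have h4 := eq_of_opD_opN hn h3
    obtain rfl | rfl : r = 0 ∨ r = 1 := by omega
    · exact h4.1
    · exact h4.2
  · have h3 : ∀ u, coord n 0 (φ (e n 0) (e n 0)) • opD n α u
        + coord n 1 (φ (e n 0) (e n 0)) • opN n α u = 0 := by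
      intro u
      have e1 := h u (e n 0) (e n 0)
      rw [R5_x (e n 0), opD_zero, R5_apply, map_zero] at e1
      linear_combination (norm := module) e1
    have h4 := eq_zero_of_opD_opN hn h3
    intro r hr
    obtain rfl | rfl : r = 0 ∨ r = 1 := by omega
    · exact h4.1
    · exact h4.2
  · have h3 : ∀ u, (coord n 0 (φ (e n 1) (e n 0)) + coord n 0 (φ (e n 0) (e n 1))) • opD n α u
        + (coord n 1 (φ (e n 1) (e n 0)) + coord n 1 (φ (e n 0) (e n 1))) • opN n α u =
        (coord n 0 (φ (e n 2) (e n 0)) - α n * coord n 0 (φ (e n (n - 1)) (e n 1))) • opD n α u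
        + (coord n 1 (φ (e n 2) (e n 0)) - α n * coord n 1 (φ (e n (n - 1)) (e n 1)))
          • opN n α u := by
      intro u
      have e1 := symm_of_mem_ZL2 h u (e n 1) (e n 0)
      rw [R5_one, opN_zero, add_zero, R5_x, opD_one hn, map_add, h2 u,
        apply_sum_of_right fun k hk => hright k (by rw [mem_Icc] at hk ⊢; omega), R5_apply,
        sum_Icc_top hα, sum_Icc_top hα] at e1
      simp only [mul_neg, sum_neg_distrib, map_add] at e1
      linear_combination (norm := module) e1
    have h4 := eq_of_opD_opN hn h3
    intro r hr
    obtain rfl | rfl : r = 0 ∨ r = 1 := by omega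
    · exact h4.1
    · exact h4.2
  · intro u
    have e1 := h u (e n 0) (e n 1)
    rw [R5_one (e n 0), opN_zero, map_zero, R5_apply, R5_one, R5_x, R5_x, R5_one] at e1
    linear_combination (norm := module) -e1

end

/-! ### The coefficients of the general form -/

theorem coord_sum_Icc {n k m r : ℕ} (t : ℕ → ℂ) (h1 : m ≤ k) (h2 : k ≤ r) (h3 : k ≤ n) :
    coord n k (∑ i ∈ Icc m r, t i • e n i) = t k := by
  rw [coord_sum_e, if_pos ⟨mem_Icc.2 ⟨h1, h2⟩, h3⟩]

theorem coord_sum_Icc_eq_zero {n k m r : ℕ} (t : ℕ → ℂ) (h : ¬ (m ≤ k ∧ k ≤ r)) :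
    coord n k (∑ i ∈ Icc m r, t i • e n i) = 0 := by
  rw [coord_sum_e, if_neg fun h' => h (mem_Icc.1 h'.1)]

theorem sum_Icc_eq_bot_add {M : Type*} [AddCommMonoid M] {m r : ℕ} (h : m ≤ r) (t : ℕ → M) :
    ∑ k ∈ Icc m r, t k = t m + ∑ k ∈ Icc (m + 1) r, t k := by
  rw [← insert_Icc_add_one_left_eq_Icc h, sum_insert (by simp)]

theorem sum_Icc_eq_add_top {m r : ℕ} (hr : 1 ≤ r) (h : m ≤ r) (t : ℕ → ℂ) :
    ∑ k ∈ Icc m r, t k = ∑ k ∈ Icc m (r - 1), t k + t r := by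
  obtain ⟨s, rfl⟩ : ∃ s, r = s + 1 := ⟨r - 1, by omega⟩
  rw [sum_Icc_succ_top (by omega)]
  rfl

section
variable {n : ℕ} {α : ℕ → ℂ} {a : ℕ → ℕ → ℂ} {c d : ℕ → ℂ} {β : ℂ} {φ : Bil ℂ (V n)}

/-- The coefficient of `e_k` in `φ(e_{i+1}, x)` for `3 ≤ k ≤ i`. -/
def lowCoeff (n : ℕ) (α : ℕ → ℂ) (a : ℕ → ℕ → ℂ) (i k : ℕ) : ℂ :=
  ∑ j ∈ Icc (i + 1) (n - 1), α (j - i + k) * a j 1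
    + ∑ s ∈ Icc 2 (k - 1), ∑ j ∈ Icc (i + 1) n, α (j + k - i - s + 2) * a j s
    + ∑ j ∈ Icc (i + 2) n, α (j - i + 2) * a j k

/-- The coefficient of `e_{i+1}` in `φ(e_{i+1}, x)`, apart from `αₙ a_{i,1}` if `i + 1 = n`. -/
def midCoeff (n : ℕ) (α : ℕ → ℂ) (a : ℕ → ℕ → ℂ) (c d : ℕ → ℂ) (i : ℕ) : ℂ :=
  c 1 + c 2 + ((i : ℂ) - 1) * d 2 - ∑ j ∈ Icc 3 i, α (j + 1) * (a j 1 + a j 2)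
    + ∑ s ∈ Icc 3 i, ∑ j ∈ Icc (i + 1) n, α (j - s + 3) * a j s
    + ∑ j ∈ Icc (i + 2) n, α (j - i + 2) * a j (i + 1)

/-- The coefficient of `e_k` in `φ(e_{i+1}, x)` for `k ≥ i + 2`, apart from `αₙ a_{i,1}` if
`k = n`. -/
def highCoeff (n : ℕ) (α : ℕ → ℂ) (a : ℕ → ℕ → ℂ) (c : ℕ → ℂ) (i k : ℕ) : ℂ :=
  c (k + 1 - i) - ∑ j ∈ Icc 2 i, α (k - i + j) * a j 1
    - ∑ s ∈ Icc 2 i, ∑ j ∈ Icc 2 (k - s), α (k + 4 - j - s) * a (i - s + 2) j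
    + ∑ s ∈ Icc 2 i, ∑ j ∈ Icc (s + 2) n, α (j - s + 2) * a j (k - i + s)

/-- The recursion for `lowCoeff` that the operator equation on `e_{i+1}` imposes; similarly for
`midCoeff_succ` and `highCoeff_succ`. -/
theorem lowCoeff_succ {i k : ℕ} (hk : 3 ≤ k) (hi : i + 2 ≤ n) :
    lowCoeff n α a (i + 1) (k + 1) = lowCoeff n α a i k - α (k + 1) * a (i + 1) 1
      - ∑ l ∈ Icc 2 (k - 1), α (k + 1 - l + 2) * a (i + 1) l
      + ∑ j ∈ Icc (i + 3) n, α (j - (i + 1) + 2) * a j (k + 1) := by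
  have e1 : ∑ j ∈ Icc (i + 1) (n - 1), α (j - i + k) * a j 1 = α (k + 1) * a (i + 1) 1
      + ∑ j ∈ Icc (i + 2) (n - 1), α (j - (i + 1) + (k + 1)) * a j 1 := by
    rw [sum_Icc_eq_bot_add (by omega), show i + 1 - i + k = k + 1 by omega]
    congr 1
    refine sum_congr rfl fun j hj => ?_
    rw [mem_Icc] at hj
    rw [show j - (i + 1) + (k + 1) = j - i + k by omega]
  have e2 : ∑ s ∈ Icc 2 (k - 1), ∑ j ∈ Icc (i + 1) n, α (j + k - i - s + 2) * a j s =
      ∑ l ∈ Icc 2 (k - 1), α (k + 1 - l + 2) * a (i + 1) l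
      + ∑ s ∈ Icc 2 (k - 1), ∑ j ∈ Icc (i + 2) n,
          α (j + (k + 1) - (i + 1) - s + 2) * a j s := by
    rw [← sum_add_distrib]
    refine sum_congr rfl fun s hs => ?_
    rw [mem_Icc] at hs
    rw [sum_Icc_eq_bot_add (by omega), show i + 1 + k - i - s + 2 = k + 1 - s + 2 by omega]
    congr 1
    refine sum_congr rfl fun j hj => ?_
    rw [show j + (k + 1) - (i + 1) - s + 2 = j + k - i - s + 2 by omega]
  have e3 : ∑ s ∈ Icc 2 k, ∑ j ∈ Icc (i + 2) n, α (j + (k + 1) - (i + 1) - s + 2) * a j s =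
      ∑ s ∈ Icc 2 (k - 1), ∑ j ∈ Icc (i + 2) n, α (j + (k + 1) - (i + 1) - s + 2) * a j s
      + ∑ j ∈ Icc (i + 2) n, α (j - i + 2) * a j k := by
    rw [sum_Icc_eq_add_top (by omega) (by omega)]
    congr 1
    refine sum_congr rfl fun j hj => ?_
    rw [show j + (k + 1) - (i + 1) - k + 2 = j - i + 2 by omega]
  simp only [lowCoeff, Nat.add_sub_cancel]
  rw [e1, e2, show i + 1 + 1 = i + 2 from rfl, e3, show i + 1 + 2 = i + 3 from rfl]
  ring

theorem lowCoeff_three {i : ℕ} :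
    lowCoeff n α a (i + 1) 3 = ∑ j ∈ Icc (i + 2) (n - 1), α (j - i + 2) * a j 1
      + ∑ j ∈ Icc (i + 2) n, α (j - i + 2) * a j 2
      + ∑ j ∈ Icc (i + 3) n, α (j - (i + 1) + 2) * a j 3 := by
  rw [lowCoeff]
  congr 2
  · refine sum_congr rfl fun j hj => ?_
    rw [mem_Icc] at hj
    rw [show j - (i + 1) + 3 = j - i + 2 by omega]
  · rw [show 3 - 1 = 2 from rfl, Icc_self, sum_singleton]
    refine sum_congr rfl fun j hj => ?_
    rw [mem_Icc] at hj
    rw [show j + 3 - (i + 1) - 2 + 2 = j - i + 2 by omega]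

/-- The coefficients of `φ(eₙ, x)` required by the operator equation on `eₙ`. -/
theorem lowCoeff_last {k : ℕ} (hn : 3 ≤ n) :
    lowCoeff n α a (n - 1) k = ∑ l ∈ Icc 2 (k - 1), α (k + 1 - l + 2) * a n l := by
  rw [lowCoeff, Icc_eq_empty (by omega), Icc_eq_empty (by omega : ¬ n - 1 + 2 ≤ n), sum_empty,
    sum_empty, add_zero, zero_add]
  refine sum_congr rfl fun s hs => ?_
  rw [mem_Icc] at hs
  rw [show n - 1 + 1 = n by omega, Icc_self, sum_singleton]
  congr 2
  omega

theorem midCoeff_two :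
    midCoeff n α a c d 2 = c 1 + c 2 + d 2 + ∑ j ∈ Icc 4 n, α (j - 2 + 2) * a j 3 := by
  rw [midCoeff, Icc_eq_empty (by omega)]
  norm_num

theorem midCoeff_succ {i : ℕ} (h2 : 2 ≤ i) (hi : i + 2 ≤ n) :
    midCoeff n α a c d (i + 1) = midCoeff n α a c d i + d 2 - α (i + 2) * a (i + 1) 1
      - ∑ l ∈ Icc 2 i, α (i + 2 - l + 2) * a (i + 1) l
      + ∑ j ∈ Icc (i + 3) n, α (j - (i + 1) + 2) * a j (i + 2) := by
  have e1 : ∑ j ∈ Icc 3 (i + 1), α (j + 1) * (a j 1 + a j 2) =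
      ∑ j ∈ Icc 3 i, α (j + 1) * (a j 1 + a j 2)
        + α (i + 2) * (a (i + 1) 1 + a (i + 1) 2) := by
    rw [sum_Icc_succ_top (by omega)]
  have e2 : ∑ s ∈ Icc 3 (i + 1), ∑ j ∈ Icc (i + 2) n, α (j - s + 3) * a j s =
      ∑ s ∈ Icc 3 i, ∑ j ∈ Icc (i + 2) n, α (j - s + 3) * a j s
        + ∑ j ∈ Icc (i + 2) n, α (j - i + 2) * a j (i + 1) := by
    rw [sum_Icc_succ_top (by omega)]
    congr 1
    refine sum_congr rfl fun j hj => ?_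
    rw [mem_Icc] at hj
    rw [show j - (i + 1) + 3 = j - i + 2 by omega]
  have e3 : ∑ s ∈ Icc 3 i, ∑ j ∈ Icc (i + 1) n, α (j - s + 3) * a j s =
      ∑ l ∈ Icc 3 i, α (i + 2 - l + 2) * a (i + 1) l
        + ∑ s ∈ Icc 3 i, ∑ j ∈ Icc (i + 2) n, α (j - s + 3) * a j s := by
    rw [← sum_add_distrib]
    refine sum_congr rfl fun s hs => ?_
    rw [mem_Icc] at hs
    rw [sum_Icc_eq_bot_add (by omega), show i + 1 - s + 3 = i + 2 - s + 2 by omega]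
  have e4 : ∑ l ∈ Icc 2 i, α (i + 2 - l + 2) * a (i + 1) l = α (i + 2) * a (i + 1) 2
      + ∑ l ∈ Icc 3 i, α (i + 2 - l + 2) * a (i + 1) l := by
    rw [sum_Icc_eq_bot_add h2, show i + 2 - 2 + 2 = i + 2 by omega]
  simp only [midCoeff]
  rw [e1, show i + 1 + 1 = i + 2 from rfl, e2, e3, e4, show i + 1 + 2 = i + 3 from rfl]
  push_cast
  ring

theorem highCoeff_two {k : ℕ} (hk : 4 ≤ k) :
    highCoeff n α a c 2 k = c (k - 1) - α k * a 2 1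
      - ∑ j ∈ Icc 2 (k - 2), α (k - j + 2) * a 2 j
      + ∑ j ∈ Icc 4 n, α (j - 2 + 2) * a j k := by
  rw [highCoeff]
  simp only [Icc_self, sum_singleton]
  rw [show k + 1 - 2 = k - 1 by omega, show k - 2 + 2 = k by omega]
  congr 2
  refine sum_congr rfl fun j hj => ?_
  rw [mem_Icc] at hj
  rw [show k + 4 - j - 2 = k - j + 2 by omega]

theorem highCoeff_succ {i k : ℕ} (h2 : 2 ≤ i) (hk : i + 2 ≤ k) :
    highCoeff n α a c (i + 1) (k + 1) = highCoeff n α a c i k - α (k + 1) * a (i + 1) 1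
      - ∑ l ∈ Icc 2 (k - 1), α (k + 1 - l + 2) * a (i + 1) l
      + ∑ j ∈ Icc (i + 3) n, α (j - (i + 1) + 2) * a j (k + 1) := by
  have e1 : ∑ j ∈ Icc 2 (i + 1), α (k + 1 - (i + 1) + j) * a j 1 =
      ∑ j ∈ Icc 2 i, α (k - i + j) * a j 1 + α (k + 1) * a (i + 1) 1 := by
    rw [sum_Icc_succ_top (by omega), show k + 1 - (i + 1) = k - i by omega,
      show k - i + (i + 1) = k + 1 by omega]
  have e2 : ∑ s ∈ Icc 2 (i + 1), ∑ j ∈ Icc 2 (k + 1 - s),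
        α (k + 1 + 4 - j - s) * a (i + 1 - s + 2) j =
      ∑ l ∈ Icc 2 (k - 1), α (k + 1 - l + 2) * a (i + 1) l
        + ∑ s ∈ Icc 2 i, ∑ j ∈ Icc 2 (k - s), α (k + 4 - j - s) * a (i - s + 2) j := by
    rw [sum_Icc_eq_bot_add (by omega), ← Finset.map_add_right_Icc, Finset.sum_map]
    congr 1
    · rw [show k + 1 - 2 = k - 1 by omega, show i + 1 - 2 + 2 = i + 1 by omega]
      refine sum_congr rfl fun j hj => ?_
      rw [mem_Icc] at hj
      rw [show k + 1 + 4 - j - 2 = k + 1 - j + 2 by omega]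
    · refine sum_congr rfl fun s hs => ?_
      rw [mem_Icc] at hs
      rw [addRightEmbedding_apply, show k + 1 - (s + 1) = k - s by omega,
        show i + 1 - (s + 1) + 2 = i - s + 2 by omega]
      refine sum_congr rfl fun j hj => ?_
      rw [show k + 1 + 4 - j - (s + 1) = k + 4 - j - s by omega]
  have e3 : ∑ s ∈ Icc 2 (i + 1), ∑ j ∈ Icc (s + 2) n,
        α (j - s + 2) * a j (k + 1 - (i + 1) + s) =
      ∑ s ∈ Icc 2 i, ∑ j ∈ Icc (s + 2) n, α (j - s + 2) * a j (k - i + s)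
        + ∑ j ∈ Icc (i + 3) n, α (j - (i + 1) + 2) * a j (k + 1) := by
    rw [sum_Icc_succ_top (by omega), show k + 1 - (i + 1) = k - i by omega,
      show k - i + (i + 1) = k + 1 by omega]
  simp only [highCoeff]
  rw [e1, e2, e3, show k + 1 + 1 - (i + 1) = k + 1 - i by omega]
  ring

namespace IsGeneralForm

/-- The coordinates of `φ(eᵢ, e₁)` for `i ≥ 2`, at the indices at least `2`. -/
theorem coord_e1 (h : IsGeneralForm n α a c d β φ) {i k : ℕ} (hi : 2 ≤ i) (hin : i ≤ n)
    (hk : 2 ≤ k) (hkn : k ≤ n) : coord n k (φ (e n i) (e n 1)) = a i k := by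
  obtain rfl | hlt : i = n ∨ i < n := by omega
  · rw [h.en_e1, coord_sum_Icc _ hk hkn hkn]
  · rw [h.ei_e1 i (mem_Icc.2 (by omega))]
    simp (disch := omega) only [map_add, map_smul, coord_e_ne, coord_sum_Icc, smul_zero, zero_add]

theorem coord_e1_of_lt (h : IsGeneralForm n α a c d β φ) {i k : ℕ} (hi : 2 ≤ i) (hin : i < n)
    (hkn : k ≤ n) : coord n k (φ (e n i) (e n 1)) = a i k := by
  rw [h.ei_e1 i (mem_Icc.2 (by omega))]
  obtain rfl | hk : k = 0 ∨ 1 ≤ k := by omega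
  · simp (disch := omega) only [map_add, map_smul, coord_e_self, coord_sum_Icc_eq_zero, smul_eq_mul,
      mul_one, add_zero]
  · simp (disch := omega) only [map_add, map_smul, coord_e_ne, coord_sum_Icc, smul_zero, zero_add]

theorem coord_last_e1 (h : IsGeneralForm n α a c d β φ) {k : ℕ} (hk : k < 2) :
    coord n k (φ (e n n) (e n 1)) = 0 := by
  rw [h.en_e1, coord_sum_Icc_eq_zero _ (by omega)]

theorem coord_two_x (h : IsGeneralForm n α a c d β φ) {k : ℕ} (hk : k ≤ n) :
    coord n k (φ (e n 2) (e n 0)) = c k := by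
  rw [h.e2_x]
  obtain rfl | hk : k = 0 ∨ 1 ≤ k := by omega
  · simp (disch := omega) only [map_add, map_smul, coord_e_self, coord_sum_Icc_eq_zero, smul_eq_mul,
      mul_one, add_zero]
  · simp (disch := omega) only [map_add, map_smul, coord_e_ne, coord_sum_Icc, smul_zero, zero_add]

theorem coord_succ_x_of_lt (h : IsGeneralForm n α a c d β φ) (hn : 3 ≤ n) {i k : ℕ} (hi : 2 ≤ i)
    (hin : i < n) (hk : k < 2) : coord n k (φ (e n (i + 1)) (e n 0)) =
      a i k + ∑ j ∈ Icc (i + 2) (n - 1), α (j - i + 2) * a j k := by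
  obtain rfl | hi : i = 2 ∨ 3 ≤ i := by omega
  · rw [h.e3_x]
    have : ∑ j ∈ Icc (2 + 2) (n - 1), α (j - 2 + 2) * a j k =
        ∑ j ∈ Icc 4 (n - 1), α j * a j k :=
      sum_congr rfl fun j hj => by
        rw [mem_Icc] at hj
        rw [Nat.sub_add_cancel (by omega)]
    rw [this]
    obtain rfl | rfl : k = 0 ∨ k = 1 := by omega
    all_goals
      simp (disch := omega) only [map_add, map_smul, coord_e_ne, coord_e_self,
        coord_sum_Icc_eq_zero, smul_eq_mul, mul_one, mul_zero, add_zero, zero_add]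
  · rw [h.ei_x i (mem_Icc.2 (by omega))]
    obtain rfl | rfl : k = 0 ∨ k = 1 := by omega
    all_goals
      simp (disch := omega) only [map_add, map_smul, coord_e_ne, coord_e_self,
        coord_sum_Icc_eq_zero, smul_eq_mul, mul_one, mul_zero, add_zero, zero_add]

theorem coord_succ_x_two (h : IsGeneralForm n α a c d β φ) (hn : 3 ≤ n) {i : ℕ} (hi : 2 ≤ i)
    (hin : i < n) : coord n 2 (φ (e n (i + 1)) (e n 0)) =
      -a i 1 + ∑ j ∈ Icc (i + 2) n, α (j - i + 2) * a j 2 := by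
  obtain rfl | hi : i = 2 ∨ 3 ≤ i := by omega
  · rw [h.e3_x]
    have : ∑ j ∈ Icc (2 + 2) n, α (j - 2 + 2) * a j 2 = ∑ j ∈ Icc 4 n, α j * a j 2 :=
      sum_congr rfl fun j hj => by
        rw [mem_Icc] at hj
        rw [Nat.sub_add_cancel (by omega)]
    rw [this]
    simp (disch := omega) only [map_add, map_smul, coord_e_ne, coord_e_self,
        coord_sum_Icc_eq_zero, smul_eq_mul, mul_one, mul_zero, add_zero, zero_add]
  · rw [h.ei_x i (mem_Icc.2 (by omega))]
    simp (disch := omega) only [map_add, map_smul, coord_e_ne, coord_e_self,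
        coord_sum_Icc_eq_zero, smul_eq_mul, mul_one, mul_zero, add_zero, zero_add]

theorem coord_succ_x_low (h : IsGeneralForm n α a c d β φ) {i k : ℕ} (hk : 3 ≤ k) (hki : k ≤ i)
    (hin : i < n) : coord n k (φ (e n (i + 1)) (e n 0)) = lowCoeff n α a i k := by
  rw [h.ei_x i (mem_Icc.2 (by omega)), lowCoeff]
  obtain rfl | hlt : k = i ∨ k < i := by omega
  · simp (disch := omega) only [map_add, map_smul, coord_e_ne, coord_e_self,
      coord_sum_Icc_eq_zero, smul_eq_mul, mul_one, mul_zero, add_zero, zero_add]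
    congr 2
    · refine sum_congr rfl fun j hj => ?_
      rw [mem_Icc] at hj
      rw [Nat.sub_add_cancel (by omega)]
    · refine sum_congr rfl fun s hs => sum_congr rfl fun j hj => ?_
      rw [show j + k - k = j by omega]
  · simp (disch := omega) only [map_add, map_smul, coord_e_ne, coord_sum_Icc,
      coord_sum_Icc_eq_zero, smul_eq_mul, mul_zero, add_zero, zero_add]

theorem coord_succ_x_mid (h : IsGeneralForm n α a c d β φ) {i : ℕ} (hi : 2 ≤ i)
    (hin : i < n) : coord n (i + 1) (φ (e n (i + 1)) (e n 0)) =
      midCoeff n α a c d i + if i + 1 = n then α n * a i 1 else 0 := by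
  have hlast : (α n * a i 1) * coord n (i + 1) (e n n) =
      if i + 1 = n then α n * a i 1 else 0 := by
    rw [coord_e]
    by_cases hh : i + 1 = n
    · rw [if_pos hh, if_pos ⟨hh, by omega⟩, mul_one]
    · rw [if_neg hh, if_neg (by omega), mul_zero]
  obtain rfl | hi : i = 2 ∨ 3 ≤ i := by omega
  · rw [h.e3_x, midCoeff_two]
    have : ∑ j ∈ Icc 4 n, α (j - 2 + 2) * a j 3 = ∑ j ∈ Icc 4 n, α j * a j 3 :=
      sum_congr rfl fun j hj => by
        rw [mem_Icc] at hj
        rw [Nat.sub_add_cancel (by omega)]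
    rw [this, ← hlast]
    simp (disch := omega) only [map_add, map_smul, coord_e_ne (i := 0), coord_e_ne (i := 1),
      coord_e_ne (i := 2), coord_e_self,
      coord_sum_Icc_eq_zero, smul_eq_mul, mul_one, mul_zero, add_zero, zero_add]
    ring
  · rw [h.ei_x i (mem_Icc.2 (by omega)), ← hlast]
    simp (disch := omega) only [map_add, map_smul, coord_e_ne (i := 0), coord_e_ne (i := 1),
      coord_e_ne (i := 2), coord_e_ne (i := i), coord_e_self,
      coord_sum_Icc_eq_zero, smul_eq_mul, mul_one, mul_zero, add_zero, zero_add]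
    rw [midCoeff]

theorem coord_succ_x_high (h : IsGeneralForm n α a c d β φ) {i k : ℕ} (hi : 2 ≤ i)
    (hk : i + 2 ≤ k) (hkn : k ≤ n) : coord n k (φ (e n (i + 1)) (e n 0)) =
      highCoeff n α a c i k + if k = n then α n * a i 1 else 0 := by
  have hlast : (α n * a i 1) * coord n k (e n n) = if k = n then α n * a i 1 else 0 := by
    rw [coord_e]
    by_cases hh : k = n
    · rw [if_pos hh, if_pos ⟨hh, by omega⟩, mul_one]
    · rw [if_neg hh, if_neg (by omega), mul_zero]
  obtain rfl | hi : i = 2 ∨ 3 ≤ i := by omega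
  · rw [h.e3_x, highCoeff_two hk]
    have : ∑ j ∈ Icc 4 n, α (j - 2 + 2) * a j k = ∑ j ∈ Icc 4 n, α j * a j k :=
      sum_congr rfl fun j hj => by
        rw [mem_Icc] at hj
        rw [Nat.sub_add_cancel (by omega)]
    rw [this, ← hlast]
    simp (disch := omega) only [map_add, map_smul, coord_e_ne (i := 0), coord_e_ne (i := 1),
      coord_e_ne (i := 2), coord_e_ne (i := 3), coord_sum_Icc,
      smul_eq_mul, mul_zero, add_zero, zero_add]
    ring
  · rw [h.ei_x i (mem_Icc.2 (by omega)), ← hlast]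
    simp (disch := omega) only [map_add, map_smul, coord_e_ne (i := 0), coord_e_ne (i := 1),
      coord_e_ne (i := 2), coord_e_ne (i := i), coord_e_ne (i := i + 1), coord_sum_Icc,
      coord_sum_Icc_eq_zero, smul_eq_mul, mul_zero, add_zero, zero_add]
    rw [highCoeff]

end IsGeneralForm

end

/-! ### The general form satisfies the cocycle conditions -/

section
variable {n : ℕ} {α : ℕ → ℂ} {a : ℕ → ℕ → ℂ} {c d : ℕ → ℂ} {β : ℂ} {φ : Bil ℂ (V n)}

theorem coord_apply_opD (φ : Bil ℂ (V n)) (v : V n) {i : ℕ} (k : ℕ) (hi : 2 ≤ i) :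
    coord n k (φ (opD n α (e n i)) v) = coord n k (φ (e n i) v)
      + ∑ j ∈ Icc (i + 2) n, α (j - i + 2) * coord n k (φ (e n j) v) := by
  rw [opD_e i hi, map_add, map_sum, LinearMap.add_apply, LinearMap.sum_apply, map_add, map_sum]
  simp only [map_smul, LinearMap.smul_apply, smul_eq_mul]

theorem opD_one_eq (hα : ∀ k, ¬ (4 ≤ k ∧ k ≤ n) → α k = 0) (hn : 3 ≤ n) :
    opD n α (e n 1) = opD n α (e n 2) - α n • e n n := by
  have hs : ∑ k ∈ Icc (2 + 2) n, α (k - 2 + 2) • e n k = ∑ k ∈ Icc 4 n, α k • e n k :=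
    sum_congr rfl fun k hk => by
      rw [mem_Icc] at hk
      rw [Nat.sub_add_cancel (by omega)]
  rw [opD_one hn, opD_e 2 le_rfl, hs]
  by_cases h4 : 4 ≤ n
  · rw [show Icc 4 n = insert n (Icc 4 (n - 1)) by ext; simp; omega,
      sum_insert (by simp; omega)]
    abel
  · rw [Icc_eq_empty (by omega), Icc_eq_empty (by omega), hα n (by omega)]
    simp

/-- Reversal of the summation in a convolution with `α`. -/
theorem sum_Icc_reflect (t : ℕ → ℂ) (k : ℕ) :
    ∑ j ∈ Icc 4 (k - 1), α j * t (k + 2 - j) = ∑ l ∈ Icc 3 (k - 2), α (k - l + 2) * t l := by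
  refine sum_nbij' (fun j => k + 2 - j) (fun l => k + 2 - l) ?_ ?_ ?_ ?_ ?_
  · intro j hj
    rw [mem_Icc] at hj ⊢
    omega
  · intro j hj
    rw [mem_Icc] at hj ⊢
    omega
  · intro j hj
    rw [mem_Icc] at hj
    omega
  · intro j hj
    rw [mem_Icc] at hj
    omega
  · intro j hj
    rw [mem_Icc] at hj
    rw [show k - (k + 2 - j) + 2 = j by omega]

namespace IsGeneralForm

theorem coord_opD_e1 (h : IsGeneralForm n α a c d β φ) (hα : ∀ k, ¬ (4 ≤ k ∧ k ≤ n) → α k = 0)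
    (hn : 3 ≤ n) {i k : ℕ} (hi : 2 ≤ i) (hin : i < n) (hk : 3 ≤ k) (hkn : k ≤ n) :
    coord n k (opD n α (φ (e n i) (e n 1))) = a i k + (if k < n then α k * a i 1 else 0)
      + ∑ l ∈ Icc 2 (k - 2), α (k - l + 2) * a i l := by
  rw [coord_opD hα hn hk hkn, h.coord_e1 hi hin.le (by omega) hkn,
    h.coord_e1_of_lt hi hin (by omega)]
  congr 1
  refine sum_congr rfl fun l hl => ?_
  rw [mem_Icc] at hl
  rw [h.coord_e1 hi hin.le (by omega) (by omega)]

theorem coord_apply_opD_e1 (h : IsGeneralForm n α a c d β φ) {i k : ℕ} (hi : 2 ≤ i) (hin : i ≤ n)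
    (hk : 2 ≤ k) (hkn : k ≤ n) : coord n k (φ (opD n α (e n i)) (e n 1)) =
      a i k + ∑ j ∈ Icc (i + 2) n, α (j - i + 2) * a j k := by
  rw [coord_apply_opD φ _ k hi, h.coord_e1 hi hin hk hkn]
  congr 1
  refine sum_congr rfl fun j hj => ?_
  rw [mem_Icc] at hj
  rw [h.coord_e1 (by omega) (by omega) hk hkn]

theorem coord_apply_opD_e1_of_lt (h : IsGeneralForm n α a c d β φ) {i k : ℕ} (hi : 2 ≤ i)
    (hin : i < n) (hk : k < 2) : coord n k (φ (opD n α (e n i)) (e n 1)) =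
      a i k + ∑ j ∈ Icc (i + 2) (n - 1), α (j - i + 2) * a j k := by
  have hs : ∑ j ∈ Icc (i + 2) (n - 1), α (j - i + 2) * a j k =
      ∑ j ∈ Icc (i + 2) (n - 1), α (j - i + 2) * coord n k (φ (e n j) (e n 1)) :=
    sum_congr rfl fun j hj => by
      rw [mem_Icc] at hj
      rw [h.coord_e1_of_lt (by omega) (by omega) (by omega)]
  rw [coord_apply_opD φ _ k hi, h.coord_e1_of_lt hi hin (by omega), hs]
  by_cases hn : i + 2 ≤ n
  · rw [sum_Icc_eq_add_top (by omega) hn, h.coord_last_e1 hk, mul_zero, add_zero]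
  · rw [Icc_eq_empty hn, Icc_eq_empty (by omega)]

theorem coord_e1_x (h : IsGeneralForm n α a c d β φ) {k : ℕ} (hk : 3 ≤ k) (hkn : k < n) :
    coord n k (φ (e n 1) (e n 0)) =
      c k + a 1 (k + 1) - a 2 (k + 1) + α n * (a n (k + 1) - α (k + 1) * a n 2)
        + ∑ j ∈ Icc 4 k, α j * (a 1 (k - j + 3) - a 2 (k - j + 3)) := by
  rw [h.e1_x]
  simp (disch := omega) only [map_add, map_smul, coord_e_ne, coord_sum_Icc, smul_eq_mul, mul_zero,
    add_zero, zero_add]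

theorem coord_e1_x_one (h : IsGeneralForm n α a c d β φ) (hn : 3 ≤ n) :
    coord n 1 (φ (e n 1) (e n 0)) = c 1 + d 2 - α n * a (n - 1) 1 := by
  rw [h.e1_x]
  simp (disch := omega) only [map_add, map_smul, coord_e_ne, coord_e_self, coord_sum_Icc_eq_zero,
    smul_eq_mul, mul_zero, mul_one, add_zero, zero_add]

theorem coord_e1_x_zero (h : IsGeneralForm n α a c d β φ) (hn : 3 ≤ n) :
    coord n 0 (φ (e n 1) (e n 0)) = c 0 - α n * a (n - 1) 0 := by
  rw [h.e1_x]
  simp (disch := omega) only [map_add, map_smul, coord_e_ne, coord_e_self, coord_sum_Icc_eq_zero,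
    smul_eq_mul, mul_zero, mul_one, add_zero]

theorem coord_e1_x_two (h : IsGeneralForm n α a c d β φ) (hn : 3 ≤ n) :
    coord n 2 (φ (e n 1) (e n 0)) =
      c 2 + a 1 3 - a 2 3 - d 2 + α n * a (n - 1) 1 + α n * a n 3 := by
  rw [h.e1_x]
  simp (disch := omega) only [map_add, map_smul, coord_e_ne, coord_e_self, coord_sum_Icc_eq_zero,
    smul_eq_mul, mul_zero, mul_one, add_zero, zero_add]

theorem coord_e1_e1 (h : IsGeneralForm n α a c d β φ) {k : ℕ} (hk : 3 ≤ k) (hkn : k ≤ n) :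
    coord n k (φ (e n 1) (e n 1)) = a 1 k := by
  rw [h.e1_e1]
  simp (disch := omega) only [map_add, map_smul, coord_e_ne, coord_sum_Icc,
    smul_eq_mul, mul_zero, add_zero, zero_add]

theorem coord_e1_e1_of_lt (h : IsGeneralForm n α a c d β φ) (hn : 3 ≤ n) {k : ℕ} (hk : k < 2) :
    coord n k (φ (e n 1) (e n 1)) = a 2 k := by
  rw [h.e1_e1]
  obtain rfl | rfl : k = 0 ∨ k = 1 := by omega
  all_goals
    simp (disch := omega) only [map_add, map_smul, coord_e_ne, coord_e_self, coord_sum_Icc_eq_zero,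
      smul_eq_mul, mul_zero, mul_one, add_zero, zero_add]

theorem coord_e1_e1_two (h : IsGeneralForm n α a c d β φ) (hn : 3 ≤ n) :
    coord n 2 (φ (e n 1) (e n 1)) = a 2 2 - α n * a n 2 := by
  rw [h.e1_e1]
  simp (disch := omega) only [map_add, map_smul, coord_e_ne, coord_e_self, coord_sum_Icc_eq_zero,
    smul_eq_mul, mul_zero, mul_one, add_zero, zero_add]

theorem coord_x_e1 (h : IsGeneralForm n α a c d β φ) {k : ℕ} (hk : 2 ≤ k) (hkn : k ≤ n) :
    coord n k (φ (e n 0) (e n 1)) = d k := by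
  rw [h.x_e1]
  simp (disch := omega) only [map_add, map_smul, coord_e_ne, coord_sum_Icc,
    smul_eq_mul, mul_zero, zero_add]

theorem coord_x_e1_one (h : IsGeneralForm n α a c d β φ) (hn : 3 ≤ n) :
    coord n 1 (φ (e n 0) (e n 1)) = -d 2 := by
  rw [h.x_e1]
  simp (disch := omega) only [map_add, map_smul, coord_e_self, coord_sum_Icc_eq_zero,
    smul_eq_mul, mul_one, add_zero]

theorem coord_x_e1_zero (h : IsGeneralForm n α a c d β φ) :
    coord n 0 (φ (e n 0) (e n 1)) = 0 := by
  rw [h.x_e1]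
  simp (disch := omega) only [map_add, map_smul, coord_e_ne, coord_sum_Icc_eq_zero,
    smul_eq_mul, mul_zero, add_zero]

theorem coord_x_x (h : IsGeneralForm n α a c d β φ) {k : ℕ} (hk : 2 ≤ k) (hkn : k < n) :
    coord n k (φ (e n 0) (e n 0)) =
      d (k + 1) + ∑ j ∈ Icc 4 k, α j * d (k + 3 - j) + if k + 1 = n then α n * d 2 else 0 := by
  have : (α n * d 2) * coord n k (e n (n - 1)) = if k + 1 = n then α n * d 2 else 0 := by
    rw [coord_e]
    by_cases hh : k + 1 = n
    · rw [if_pos hh, if_pos (by omega), mul_one]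
    · rw [if_neg hh, if_neg (by omega), mul_zero]
  rw [h.x_x, ← this]
  simp (disch := omega) only [map_add, map_smul, coord_e_ne (i := n), coord_sum_Icc,
    smul_eq_mul, mul_zero, add_zero]

theorem coord_x_x_of_lt (h : IsGeneralForm n α a c d β φ) (hn : 3 ≤ n) {k : ℕ} (hk : k < 2) :
    coord n k (φ (e n 0) (e n 0)) = 0 := by
  rw [h.x_x]
  simp (disch := omega) only [map_add, map_smul, coord_e_ne, coord_sum_Icc_eq_zero,
    smul_eq_mul, mul_zero, add_zero]

/-- The operator equation of a cocycle on `eᵢ` with `2 ≤ i < n`: the coefficients of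
`φ(e_{i+1}, x)` arise recursively from those of `φ(eᵢ, x)`. -/
theorem comm_e (h : IsGeneralForm n α a c d β φ) (hα : ∀ k, ¬ (4 ≤ k ∧ k ≤ n) → α k = 0)
    (hn : 3 ≤ n) {i : ℕ} (hi : 2 ≤ i) (hin : i < n) :
    opN n α (φ (e n i) (e n 0)) - φ (e n (i + 1)) (e n 0) =
      opD n α (φ (e n i) (e n 1)) - φ (opD n α (e n i)) (e n 1) - d 2 • e n (i + 1) := by
  refine coord_ext fun k hkn => ?_
  simp only [map_sub, map_smul, smul_eq_mul]
  obtain hk | rfl | rfl | hk : k < 2 ∨ k = 2 ∨ k = 3 ∨ 4 ≤ k := by omega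
  · rw [coord_opN_of_lt hn (by omega), coord_opD_of_lt hn hk, coord_e_ne (by omega),
      h.coord_succ_x_of_lt hn hi hin hk, h.coord_apply_opD_e1_of_lt hi hin hk]
    ring
  · rw [coord_opN_of_lt hn (by omega), coord_two_opD hn, coord_e_ne (by omega),
      h.coord_succ_x_two hn hi hin, h.coord_apply_opD_e1 hi hin.le le_rfl hkn,
      h.coord_e1 hi hin.le le_rfl hkn, h.coord_e1_of_lt hi hin (by omega)]
    ring
  · rw [coord_three_opN hn, h.coord_opD_e1 hα hn hi hin le_rfl hkn,
      h.coord_apply_opD_e1 hi hin.le (by omega) hkn, hα 3 (by omega), Icc_eq_empty (by omega),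
      sum_empty, zero_mul, ite_self]
    obtain rfl | hi3 : i = 2 ∨ 3 ≤ i := by omega
    · rw [h.coord_two_x (by omega), h.coord_two_x (by omega), coord_e_self (by omega)]
      have := h.coord_succ_x_mid le_rfl hin
      rw [midCoeff_two] at this
      rw [this]
      split_ifs with h3
      · rw [hα n (by omega)]
        ring
      · ring
    · obtain ⟨m, rfl⟩ : ∃ m, i = m + 1 := ⟨i - 1, by omega⟩
      rw [h.coord_succ_x_of_lt hn (by omega) (by omega) (by omega),
        h.coord_succ_x_two hn (by omega) (by omega), h.coord_succ_x_low le_rfl hi3 hin,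
        lowCoeff_three, coord_e_ne (by omega)]
      ring
  · rw [coord_opN hn hk hkn, h.coord_opD_e1 hα hn hi hin (by omega) hkn,
      h.coord_apply_opD_e1 hi hin.le (by omega) hkn]
    obtain ⟨k, rfl⟩ : ∃ m, k = m + 1 := ⟨k - 1, by omega⟩
    rw [Nat.add_sub_cancel]
    obtain rfl | hi3 : i = 2 ∨ 3 ≤ i := by omega
    · rw [h.coord_two_x (by omega), h.coord_succ_x_high le_rfl hk hkn, highCoeff_two hk,
        coord_e_ne (by omega), Nat.add_sub_cancel]
      split_ifs with h1 h2 h2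
      · omega
      · rw [h1]
        ring
      · ring
      · omega
    · obtain ⟨i, rfl⟩ : ∃ m, i = m + 1 := ⟨i - 1, by omega⟩
      have hs : k + 1 - 2 = k - 1 := by omega
      obtain hlt | rfl | hlt : k ≤ i ∨ k = i + 1 ∨ i + 2 ≤ k := by omega
      · rw [h.coord_succ_x_low (by omega) (by omega) (by omega),
          h.coord_succ_x_low (by omega) (by omega) hin, coord_e_ne (by omega),
          lowCoeff_succ (by omega) (by omega), if_pos (by omega), hs]
        ring
      · rw [h.coord_succ_x_mid (by omega) (by omega), h.coord_succ_x_mid hi hin,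
          coord_e_self hkn, midCoeff_succ (by omega) (by omega), hs, if_neg (by omega),
          Nat.add_sub_cancel]
        split_ifs with h1 h2 h2
        · omega
        · rw [← h1]
          ring
        · ring
        · omega
      · rw [h.coord_succ_x_high (by omega) (by omega) (by omega),
          h.coord_succ_x_high hi (by omega) hkn, coord_e_ne (by omega),
          highCoeff_succ (by omega) (by omega), hs, if_neg (by omega)]
        split_ifs with h1 h2 h2
        · omega
        · rw [h1]
          ring
        · ring
        · omega

/-- The operator equation of a cocycle on `eₙ`. The recursion has to end with
`φ(e_{n+1}, x) = 0`, which the form of the coefficients of `φ(eₙ, x)` ensures. -/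
theorem comm_last (h : IsGeneralForm n α a c d β φ) (hα : ∀ k, ¬ (4 ≤ k ∧ k ≤ n) → α k = 0)
    (hn : 3 ≤ n) :
    opN n α (φ (e n n) (e n 0)) =
      opD n α (φ (e n n) (e n 1)) - φ (opD n α (e n n)) (e n 1) := by
  have hD : opD n α (e n n) = e n n := by
    rw [opD_e n (by omega), Icc_eq_empty (by omega), sum_empty, add_zero]
  rw [hD]
  refine coord_ext fun k hkn => ?_
  rw [map_sub]
  obtain hk | rfl | rfl | hk : k < 2 ∨ k = 2 ∨ k = 3 ∨ 4 ≤ k := by omega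
  · rw [coord_opN_of_lt hn (by omega), coord_opD_of_lt hn hk, h.coord_last_e1 hk, sub_zero]
  · rw [coord_opN_of_lt hn (by omega), coord_two_opD hn, h.coord_last_e1 (by omega)]
    ring
  · rw [coord_three_opN hn, coord_opD hα hn le_rfl hkn, Icc_eq_empty (by omega), sum_empty,
      h.coord_last_e1 (k := 1) (by omega), mul_zero, ite_self]
    obtain ⟨m, rfl⟩ : ∃ m, n = m + 1 := ⟨n - 1, by omega⟩
    rw [h.coord_succ_x_of_lt hn (by omega) (by omega) (by omega),
      h.coord_succ_x_two hn (by omega) (by omega), Icc_eq_empty (by omega),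
      Icc_eq_empty (by omega), sum_empty, sum_empty]
    ring
  · have hl := lowCoeff_last (k := k - 1) (α := α) (a := a) hn
    have hx := h.coord_succ_x_low (i := n - 1) (k := k - 1) (by omega) (by omega) (by omega)
    rw [Nat.sub_add_cancel (by omega)] at hl hx
    rw [coord_opN hn hk hkn, coord_opD hα hn (by omega) hkn, h.coord_last_e1 (k := 1) (by omega),
      hx, hl, mul_zero, ite_self, show k - 1 - 1 = k - 2 by omega]
    have : ∑ l ∈ Icc 2 (k - 2), α (k - l + 2) * coord n l (φ (e n n) (e n 1)) =
        ∑ l ∈ Icc 2 (k - 2), α (k - l + 2) * a n l :=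
      sum_congr rfl fun l hl => by
        rw [mem_Icc] at hl
        rw [h.coord_e1 (by omega) le_rfl (by omega) (by omega)]
    rw [this]
    ring

/-- The operator equation of a cocycle on `e₁ - e₂`, an element of the kernel of the right
multiplication by `e₁`. -/
theorem comm_sub (h : IsGeneralForm n α a c d β φ) (hα : ∀ k, ¬ (4 ≤ k ∧ k ≤ n) → α k = 0)
    (hn : 3 ≤ n) :
    opN n α (φ (e n 1) (e n 0) - φ (e n 2) (e n 0)) =
      opD n α (φ (e n 1) (e n 1) - φ (e n 2) (e n 1)) + α n • φ (e n n) (e n 1) := by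
  refine coord_ext fun k hkn => ?_
  rw [map_add, map_smul, smul_eq_mul]
  obtain hk | rfl | rfl | hk : k < 2 ∨ k = 2 ∨ k = 3 ∨ 4 ≤ k := by omega
  · rw [coord_opN_of_lt hn (by omega), coord_opD_of_lt hn hk, h.coord_last_e1 hk]
    ring
  · rw [coord_opN_of_lt hn (by omega), coord_two_opD hn, map_sub, map_sub, h.coord_e1_e1_two hn,
      h.coord_e1_e1_of_lt hn (by omega), h.coord_e1 (by omega) le_rfl le_rfl hkn,
      h.coord_e1_of_lt le_rfl (by omega) (by omega), h.coord_e1 le_rfl (by omega) le_rfl hkn]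
    ring
  · rw [coord_three_opN hn, coord_opD hα hn le_rfl hkn, Icc_eq_empty (by omega), sum_empty,
      hα 3 (by omega)]
    simp only [map_sub]
    rw [h.coord_e1_x_one hn, h.coord_e1_x_two hn, h.coord_two_x (by omega),
      h.coord_two_x (by omega), h.coord_e1_e1 le_rfl hkn,
      h.coord_e1 le_rfl (by omega) (by omega) hkn, h.coord_e1 (by omega) le_rfl (by omega) hkn,
      zero_mul, ite_self]
    ring
  · have hs : ∑ l ∈ Icc 2 (k - 2), α (k - l + 2) *
          coord n l (φ (e n 1) (e n 1) - φ (e n 2) (e n 1)) =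
        -(α k * α n * a n 2) + ∑ j ∈ Icc 4 (k - 1), α j * (a 1 (k + 2 - j) - a 2 (k + 2 - j)) := by
      rw [sum_Icc_eq_bot_add (by omega), sum_Icc_reflect (fun l => a 1 l - a 2 l), map_sub,
        h.coord_e1_e1_two hn, h.coord_e1 le_rfl (by omega) le_rfl (by omega),
        Nat.sub_add_cancel (by omega)]
      congr 1
      · ring
      · refine sum_congr rfl fun l hl => ?_
        rw [mem_Icc] at hl
        rw [map_sub, h.coord_e1_e1 (by omega) (by omega),
          h.coord_e1 le_rfl (by omega) (by omega) (by omega)]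
    rw [coord_opN hn hk hkn, coord_opD hα hn (by omega) hkn, hs]
    simp only [map_sub]
    rw [h.coord_two_x (by omega), h.coord_e1_e1_of_lt (k := 1) hn (by omega),
      h.coord_e1_e1 (by omega) hkn,
      h.coord_e1 le_rfl (by omega) (by omega) hkn, h.coord_e1 (by omega) le_rfl (by omega) hkn,
      h.coord_e1_of_lt le_rfl (by omega) (by omega), sub_self, mul_zero, ite_self,
      h.coord_e1_x (by omega) (by omega), Nat.sub_add_cancel (by omega)]
    have : ∑ j ∈ Icc 4 (k - 1), α j * (a 1 (k - 1 - j + 3) - a 2 (k - 1 - j + 3)) =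
        ∑ j ∈ Icc 4 (k - 1), α j * (a 1 (k + 2 - j) - a 2 (k + 2 - j)) :=
      sum_congr rfl fun j hj => by
        rw [mem_Icc] at hj
        rw [show k - 1 - j + 3 = k + 2 - j by omega]
    rw [this]
    ring

theorem comm_x (h : IsGeneralForm n α a c d β φ) (hα : ∀ k, ¬ (4 ≤ k ∧ k ≤ n) → α k = 0)
    (hn : 3 ≤ n) : opN n α (φ (e n 0) (e n 0)) = opD n α (φ (e n 0) (e n 1)) := by
  refine coord_ext fun k hkn => ?_
  obtain hk | rfl | rfl | hk : k < 2 ∨ k = 2 ∨ k = 3 ∨ 4 ≤ k := by omega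
  · rw [coord_opN_of_lt hn (by omega), coord_opD_of_lt hn hk]
  · rw [coord_opN_of_lt hn (by omega), coord_two_opD hn, h.coord_x_e1_one hn,
      h.coord_x_e1 le_rfl hkn]
    ring
  · rw [coord_three_opN hn, coord_opD hα hn le_rfl hkn, Icc_eq_empty (by omega), sum_empty,
      hα 3 (by omega), h.coord_x_x_of_lt hn (by omega), h.coord_x_x le_rfl (by omega),
      Icc_eq_empty (by omega), sum_empty, h.coord_x_e1 (by omega) hkn, zero_mul, ite_self]
    split_ifs with h3
    · rw [hα n (by omega)]
      ring
    · ring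
  · have hs : ∑ l ∈ Icc 2 (k - 2), α (k - l + 2) * coord n l (φ (e n 0) (e n 1)) =
        α k * d 2 + ∑ j ∈ Icc 4 (k - 1), α j * d (k + 2 - j) := by
      rw [sum_Icc_eq_bot_add (by omega), sum_Icc_reflect d, h.coord_x_e1 le_rfl (by omega),
        Nat.sub_add_cancel (by omega)]
      congr 1
      refine sum_congr rfl fun l hl => ?_
      rw [mem_Icc] at hl
      rw [h.coord_x_e1 (by omega) (by omega)]
    rw [coord_opN hn hk hkn, coord_opD hα hn (by omega) hkn, hs, h.coord_x_x (by omega) (by omega),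
      h.coord_x_e1 (by omega) hkn, h.coord_x_e1_one hn, Nat.sub_add_cancel (by omega),
      show k - 1 + 3 = k + 2 by omega]
    split_ifs with h1 h2 h2
    · omega
    · rw [h1]
      ring
    · ring
    · omega

theorem cocycleConditions (h : IsGeneralForm n α a c d β φ)
    (hα : ∀ k, ¬ (4 ≤ k ∧ k ≤ n) → α k = 0) (hn : 3 ≤ n) : CocycleConditions n α φ := by
  constructor
  · have hs : ∀ r < 2, -coord n r (φ (e n 2) (e n 0))
          + ∑ j ∈ Icc 4 n, α j * coord n r (φ (e n (j - 1)) (e n 1)) =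
        -c r + ∑ j ∈ Icc 4 n, α j * a (j - 1) r := by
      intro r hr
      rw [h.coord_two_x (by omega)]
      congr 1
      refine sum_congr rfl fun j hj => ?_
      rw [mem_Icc] at hj
      rw [h.coord_e1_of_lt (by omega) (by omega) (by omega)]
    rw [hs 0 (by omega), hs 1 (by omega)]
    intro u
    set p := -c 0 + ∑ j ∈ Icc 4 n, α j * a (j - 1) 0 with hp
    set q := -c 1 + ∑ j ∈ Icc 4 n, α j * a (j - 1) 1 with hq
    have : φ.flip (e n 2) = p • opD n α + q • opN n α := by
      refine linearMap_ext fun i hi => ?_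
      rw [LinearMap.flip_apply, LinearMap.add_apply, LinearMap.smul_apply, LinearMap.smul_apply]
      obtain rfl | rfl | h2 : i = 0 ∨ i = 1 ∨ 2 ≤ i := by omega
      · rw [h.x_ej 2 (mem_Icc.2 (by omega)), opD_zero, opN_zero]
        simp
      · rw [h.e1_e2, opD_one hn, opN_one hn, ← hp, ← hq, smul_add, smul_sum]
        simp only [smul_smul, mul_comm p]
        abel
      · rw [h.ei_e2 i (mem_Icc.2 (by omega)), opD_e i h2, opN_e hn h2, ← hp, ← hq, smul_add,
          smul_sum]
        simp only [smul_smul, mul_comm p]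
        abel
    exact congrArg (fun f => f u) this
  · intro j hj u
    have hj' := mem_Icc.1 hj
    rw [h.coord_e1_of_lt (by omega) (by omega) (by omega),
      h.coord_e1_of_lt (by omega) (by omega) (by omega)]
    have : φ.flip (e n j) = -a (j - 1) 0 • opD n α - a (j - 1) 1 • opN n α := by
      refine linearMap_ext fun i hi => ?_
      rw [LinearMap.flip_apply, LinearMap.sub_apply, LinearMap.smul_apply, LinearMap.smul_apply]
      obtain rfl | rfl | h2 : i = 0 ∨ i = 1 ∨ 2 ≤ i := by omega
      · rw [h.x_ej j (mem_Icc.2 (by omega)), opD_zero, opN_zero]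
        simp
      · rw [h.e1_ej j hj, opD_one hn, opN_one hn]
        module
      · rw [h.ei_ej i (mem_Icc.2 (by omega)) j hj, opD_e i h2, opN_e hn h2]
        module
    exact congrArg (fun f => f u) this
  · intro r hr
    rw [h.coord_e1_e1_of_lt hn hr, h.coord_e1_of_lt le_rfl (by omega) (by omega)]
  · intro r hr
    exact h.coord_last_e1 hr
  · intro j hj r hr
    rw [mem_Icc] at hj
    rw [h.coord_succ_x_of_lt hn hj.1 (by omega) hr, h.coord_e1_of_lt hj.1 (by omega) (by omega)]
    congr 1
    refine sum_congr rfl fun k hk => ?_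
    rw [mem_Icc] at hk
    rw [h.coord_e1_of_lt (by omega) (by omega) (by omega)]
  · intro r hr
    exact h.coord_x_x_of_lt hn hr
  · intro r hr
    rw [h.coord_two_x (by omega),
      h.coord_e1_of_lt (i := n - 1) (by omega) (by omega) (by omega)]
    obtain rfl | rfl : r = 0 ∨ r = 1 := by omega
    · rw [h.coord_e1_x_zero hn, h.coord_x_e1_zero, add_zero]
    · rw [h.coord_e1_x_one hn, h.coord_x_e1_one hn]
      ring
  · intro u
    rw [h.coord_x_e1_zero, h.coord_x_e1_one hn]
    have : opN n α ∘ₗ φ.flip (e n 0) - φ.flip (e n 0) ∘ₗ opN n α =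
        opD n α ∘ₗ φ.flip (e n 1) - φ.flip (e n 1) ∘ₗ opD n α + (0 : ℂ) • opD n α
          + -d 2 • opN n α := by
      refine linearMap_ext fun i hi => ?_
      simp only [LinearMap.sub_apply, LinearMap.add_apply, LinearMap.comp_apply,
        LinearMap.smul_apply, LinearMap.flip_apply]
      obtain rfl | rfl | h2 : i = 0 ∨ i = 1 ∨ 2 ≤ i := by omega
      · rw [opD_zero, opN_zero, h.comm_x hα hn]
        simp
      · have e1 := h.comm_sub hα hn
        have e2 := h.comm_e hα hn le_rfl hn
        have hD := opD_one_eq hα hn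
        rw [opN_one hn, hD]
        simp only [map_sub, map_smul, LinearMap.sub_apply, LinearMap.smul_apply] at e1 ⊢
        rw [hD] at *
        linear_combination (norm := module) e1 + e2
      · obtain rfl | hlt : i = n ∨ i < n := by omega
        · rw [opN_e hn h2, e_of_lt (Nat.lt_succ_self i), h.comm_last hα hn]
          simp
        · have := h.comm_e hα hn h2 hlt
          rw [opN_e hn h2, this]
          module
    exact congrArg (fun f => f u) this

theorem mem_ZL2 (h : IsGeneralForm n α a c d β φ)
    (hα : ∀ k, ¬ (4 ≤ k ∧ k ≤ n) → α k = 0) (hn : 3 ≤ n) : φ ∈ ZL2 (R5 n α) :=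
  (h.cocycleConditions hα hn).mem_ZL2 hα hn

end IsGeneralForm

end

/-! ### The parameters of a cocycle -/

section
variable {n : ℕ} {α : ℕ → ℂ} {a : ℕ → ℕ → ℂ} {c d : ℕ → ℂ} {β : ℂ} {φ : Bil ℂ (V n)}

/-- The values on basis vectors of the bilinear map with the general form with given parameters. -/
def generalTable (n : ℕ) (α : ℕ → ℂ) (a : ℕ → ℕ → ℂ) (c d : ℕ → ℂ) (β : ℂ) (i j : ℕ) : V n :=
  if j = 0 then
    if i = 0 then
      ∑ i ∈ Icc 2 (n - 1), (d (i + 1) + ∑ j ∈ Icc 4 i, α j * d (i + 3 - j)) • e n i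
        + (α n * d 2) • e n (n - 1) + β • e n n
    else if i = 1 then
      (c 0 - α n * a (n - 1) 0) • x n + (c 1 + d 2 - α n * a (n - 1) 1) • e n 1
        + (c 2 + a 1 3 - a 2 3 - d 2 + α n * a (n - 1) 1 + α n * a n 3) • e n 2
        + ∑ i ∈ Icc 3 (n - 1),
            (c i + a 1 (i + 1) - a 2 (i + 1) + α n * (a n (i + 1) - α (i + 1) * a n 2)
              + ∑ j ∈ Icc 4 i, α j * (a 1 (i - j + 3) - a 2 (i - j + 3))) • e n i
        + c (n + 1) • e n n
    else if i = 2 then c 0 • x n + ∑ i ∈ Icc 1 n, c i • e n i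
    else if i = 3 then
      (a 2 0 + ∑ j ∈ Icc 4 (n - 1), α j * a j 0) • x n
        + (a 2 1 + ∑ j ∈ Icc 4 (n - 1), α j * a j 1) • e n 1
        + (-a 2 1 + ∑ j ∈ Icc 4 n, α j * a j 2) • e n 2
        + (c 1 + c 2 + d 2 + ∑ j ∈ Icc 4 n, α j * a j 3) • e n 3
        + ∑ k ∈ Icc 4 n,
            (c (k - 1) - a 2 1 * α k - ∑ j ∈ Icc 2 (k - 2), α (k - j + 2) * a 2 j
              + ∑ j ∈ Icc 4 n, α j * a j k) • e n k
        + (a 2 1 * α n) • e n n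
    else
      (fun i : ℕ => (a i 0 + ∑ j ∈ Icc (i + 2) (n - 1), α (j - i + 2) * a j 0) • x n
      + (a i 1 + ∑ j ∈ Icc (i + 2) (n - 1), α (j - i + 2) * a j 1) • e n 1
      + (-a i 1 + ∑ j ∈ Icc (i + 2) n, α (j - i + 2) * a j 2) • e n 2
      + ∑ k ∈ Icc 3 (i - 1),
          (∑ j ∈ Icc (i + 1) (n - 1), α (j - i + k) * a j 1
            + ∑ s ∈ Icc 2 (k - 1), ∑ j ∈ Icc (i + 1) n, α (j + k - i - s + 2) * a j s
            + ∑ j ∈ Icc (i + 2) n, α (j - i + 2) * a j k) • e n k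
      + (∑ j ∈ Icc (i + 1) (n - 1), α j * a j 1
            + ∑ s ∈ Icc 2 (i - 1), ∑ j ∈ Icc (i + 1) n, α (j - s + 2) * a j s
            + ∑ j ∈ Icc (i + 2) n, α (j - i + 2) * a j i) • e n i
      + (c 1 + c 2 + ((i : ℂ) - 1) * d 2 - ∑ j ∈ Icc 3 i, α (j + 1) * (a j 1 + a j 2)
            + ∑ s ∈ Icc 3 i, ∑ j ∈ Icc (i + 1) n, α (j - s + 3) * a j s
            + ∑ j ∈ Icc (i + 2) n, α (j - i + 2) * a j (i + 1)) • e n (i + 1)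
      + ∑ k ∈ Icc (i + 2) n,
          (c (k + 1 - i) - ∑ j ∈ Icc 2 i, α (k - i + j) * a j 1
            - ∑ s ∈ Icc 2 i, ∑ j ∈ Icc 2 (k - s), α (k + 4 - j - s) * a (i - s + 2) j
            + ∑ s ∈ Icc 2 i, ∑ j ∈ Icc (s + 2) n, α (j - s + 2) * a j (k - i + s)) • e n k
      + (α n * a i 1) • e n n) (i - 1)
  else if j = 1 then
    if i = 0 then -d 2 • e n 1 + ∑ i ∈ Icc 2 n, d i • e n i
    else if i = 1 then
      a 2 0 • x n + a 2 1 • e n 1 + (a 2 2 - α n * a n 2) • e n 2 + ∑ i ∈ Icc 3 n, a 1 i • e n i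
    else if i = n then ∑ i ∈ Icc 2 n, a n i • e n i
    else a i 0 • x n + ∑ s ∈ Icc 1 n, a i s • e n s
  else if i = 0 then 0
  else if j = 2 then
    if i = 1 then
      (-c 0 + ∑ j ∈ Icc 4 n, α j * a (j - 1) 0) • e n 2
        + (-c 1 + ∑ j ∈ Icc 4 n, α j * a (j - 1) 1) • e n 3
        + ∑ i ∈ Icc 4 (n - 1), (α i * (-c 0 + ∑ j ∈ Icc 4 n, α j * a (j - 1) 0)) • e n i
    else
      (-c 0 + ∑ j ∈ Icc 4 n, α j * a (j - 1) 0) • e n i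
        + (-c 1 + ∑ j ∈ Icc 4 n, α j * a (j - 1) 1) • e n (i + 1)
        + ∑ k ∈ Icc (i + 2) n,
            (α (k - i + 2) * (-c 0 + ∑ j ∈ Icc 4 n, α j * a (j - 1) 0)) • e n k
  else if i = 1 then
    -a (j - 1) 0 • e n 2 - a (j - 1) 1 • e n 3 - a (j - 1) 0 • ∑ k ∈ Icc 4 (n - 1), α k • e n k
  else
    -a (j - 1) 0 • e n i - a (j - 1) 1 • e n (i + 1)
      - a (j - 1) 0 • ∑ k ∈ Icc (i + 2) n, α (k - i + 2) • e n k

theorem isGeneralForm_ofTable (hn : 3 ≤ n) (α : ℕ → ℂ) (a : ℕ → ℕ → ℂ) (c d : ℕ → ℂ) (β : ℂ) :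
    IsGeneralForm n α a c d β (ofTable n (generalTable n α a c d β)) := by
  constructor
  case ei_e1 =>
    intro i hi
    rw [mem_Icc] at hi
    rw [ofTable_e n _ (by omega) (by omega), generalTable, if_neg (by omega), if_pos rfl,
      if_neg (by omega), if_neg (by omega), if_neg (by omega)]
  case ei_e2 =>
    intro i hi
    rw [mem_Icc] at hi
    rw [ofTable_e n _ (by omega) (by omega), generalTable, if_neg (by omega), if_neg (by omega),
      if_neg (by omega), if_pos rfl, if_neg (by omega)]
  case e1_ej =>
    intro j hj
    rw [mem_Icc] at hj
    rw [ofTable_e n _ (by omega) (by omega), generalTable, if_neg (by omega), if_neg (by omega),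
      if_neg (by omega), if_neg (by omega), if_pos rfl]
  case ei_ej =>
    intro i hi j hj
    rw [mem_Icc] at hi hj
    rw [ofTable_e n _ (by omega) (by omega), generalTable, if_neg (by omega), if_neg (by omega),
      if_neg (by omega), if_neg (by omega), if_neg (by omega)]
  case ei_x =>
    intro i hi
    rw [mem_Icc] at hi
    rw [ofTable_e n _ (by omega) (by omega), generalTable, if_pos rfl, if_neg (by omega),
      if_neg (by omega), if_neg (by omega), if_neg (by omega), Nat.add_sub_cancel]
  case x_ej =>
    intro j hj
    rw [mem_Icc] at hj
    rw [ofTable_e n _ (by omega) (by omega), generalTable, if_neg (by omega), if_neg (by omega),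
      if_pos rfl]
  case en_e1 =>
    rw [ofTable_e n _ (by omega) (by omega), generalTable, if_neg (by omega), if_pos rfl,
      if_neg (by omega), if_neg (by omega), if_pos rfl]
  all_goals
    rw [ofTable_e n _ (by omega) (by omega), generalTable]
    simp only [one_ne_zero, ↓reduceIte, OfNat.ofNat_ne_zero, OfNat.ofNat_ne_one, Nat.reduceEqDiff]

theorem IsGeneralForm.coord_last_e1_x (h : IsGeneralForm n α a c d β φ) (hn : 3 ≤ n) :
    coord n n (φ (e n 1) (e n 0)) = c (n + 1) := by
  rw [h.e1_x]
  simp (disch := omega) only [map_add, map_smul, coord_e_ne, coord_e_self, coord_sum_Icc_eq_zero,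
    smul_eq_mul, mul_zero, mul_one, zero_add]

theorem IsGeneralForm.coord_last_x_x (h : IsGeneralForm n α a c d β φ) (hn : 3 ≤ n) :
    coord n n (φ (e n 0) (e n 0)) = β := by
  rw [h.x_x]
  simp (disch := omega) only [map_add, map_smul, coord_e_ne, coord_e_self, coord_sum_Icc_eq_zero,
    smul_eq_mul, mul_zero, mul_one, zero_add]

/-- A cocycle is determined by the coordinates that enter its general form as parameters: if they
vanish, then the operator equation, applied to `x`, `e₂`, …, `eₙ` and `e₁`, annihilates the
remaining values in turn. -/
theorem eq_zero_of_mem_ZL2 (hα : ∀ k, ¬ (4 ≤ k ∧ k ≤ n) → α k = 0) (hn : 3 ≤ n)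
    (hφ : φ ∈ ZL2 (R5 n α))
    (h11 : ∀ k, 3 ≤ k → k ≤ n → coord n k (φ (e n 1) (e n 1)) = 0)
    (hi1 : ∀ i, 2 ≤ i → i < n → ∀ k ≤ n, coord n k (φ (e n i) (e n 1)) = 0)
    (hn1 : ∀ k, 2 ≤ k → k ≤ n → coord n k (φ (e n n) (e n 1)) = 0)
    (h2x : ∀ k ≤ n, coord n k (φ (e n 2) (e n 0)) = 0)
    (h1x : coord n n (φ (e n 1) (e n 0)) = 0)
    (hx1 : ∀ k, 2 ≤ k → k ≤ n → coord n k (φ (e n 0) (e n 1)) = 0)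
    (hxx : coord n n (φ (e n 0) (e n 0)) = 0) : φ = 0 := by
  have h := cocycleConditions_of_mem_ZL2 hφ hα hn
  have pe : ∀ i, 2 ≤ i → φ (e n i) (e n 1) = 0 := by
    intro i hi
    obtain hlt | rfl | hlt : i < n ∨ i = n ∨ n < i := by omega
    · exact coord_ext fun k hk => by rw [hi1 i hi hlt k hk, map_zero]
    · refine coord_ext fun k hk => ?_
      rw [map_zero]
      obtain hk2 | hk2 : k < 2 ∨ 2 ≤ k := by omega
      · exact h.last_one k hk2
      · exact hn1 k hk2 hk
    · rw [e_of_lt hlt, map_zero, LinearMap.zero_apply]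
  have pD : ∀ i, 2 ≤ i → φ (opD n α (e n i)) (e n 1) = 0 := by
    intro i hi
    rw [opD_e i hi, map_add, map_sum, LinearMap.add_apply, LinearMap.sum_apply, pe i hi, zero_add]
    refine sum_eq_zero fun k hk => ?_
    rw [mem_Icc] at hk
    rw [map_smul, LinearMap.smul_apply, pe k (by omega), smul_zero]
  have q2 : φ (e n 2) (e n 0) = 0 := coord_ext fun k hk => by rw [h2x k hk, map_zero]
  -- the coordinate of `φ(x, e₁)` at `e₁` is read off the operator equation on `x`
  have hx1' : coord n 1 (φ (e n 0) (e n 1)) = 0 := by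
    have h0 := congrArg (coord n 2) (h.comm (e n 0))
    rw [opN_zero, opD_zero, map_zero, LinearMap.zero_apply, LinearMap.zero_apply, sub_zero,
      sub_zero, smul_zero, smul_zero, add_zero, add_zero, coord_opN_of_lt hn (by omega),
      coord_two_opD hn, hx1 2 le_rfl (by omega), add_zero] at h0
    exact h0.symm
  set g := coord n 0 (φ (e n 0) (e n 1)) with hg
  have rec_e : ∀ i, 2 ≤ i → φ (e n (i + 1)) (e n 0) =
      opN n α (φ (e n i) (e n 0)) - g • opD n α (e n i) := by
    intro i hi
    have h0 := h.comm (e n i)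
    rw [opN_e hn hi, pe i hi, pD i hi, hx1', ← hg, map_zero] at h0
    linear_combination (norm := module) -h0
  -- solving the recursion, a nonzero `g` would give a nonzero value for `e_{n+1} = 0`
  have q : ∀ i, φ (e n (i + 3)) (e n 0) = (-((i : ℂ) + 1) * g) • opD n α (e n (i + 2)) := by
    intro i
    induction i with
    | zero =>
      rw [rec_e 2 le_rfl, q2, map_zero]
      push_cast
      module
    | succ i ih =>
      rw [rec_e (i + 3) (by omega), ih, map_smul, opN_opD hn, opN_e hn (by omega)]
      push_cast
      module
  have g0 : g = 0 := by
    have h0 := q (n - 2)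
    rw [e_of_lt (by omega), map_zero, LinearMap.zero_apply, Nat.sub_add_cancel (by omega)] at h0
    have h1 := congrArg (coord n n) h0
    rw [map_zero, map_smul, coord_opD hα hn hn le_rfl, coord_e_self le_rfl, if_neg (by omega),
      add_zero, sum_eq_zero, add_zero, smul_eq_mul, mul_one] at h1
    · have : -(((n - 2 : ℕ) : ℂ) + 1) ≠ 0 := by
        rw [neg_ne_zero]
        exact Nat.cast_add_one_ne_zero _
      exact (mul_eq_zero.1 h1.symm).resolve_left this
    · intro l hl
      rw [mem_Icc] at hl
      rw [coord_e_ne (by omega), mul_zero]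
  have qe : ∀ i, 2 ≤ i → φ (e n i) (e n 0) = 0 := by
    intro i hi
    obtain rfl | hi : i = 2 ∨ 3 ≤ i := by omega
    · exact q2
    · obtain ⟨m, rfl⟩ : ∃ m, i = m + 3 := ⟨i - 3, by omega⟩
      rw [q, g0, mul_zero, zero_smul]
  have px : φ (e n 0) (e n 1) = 0 := by
    refine coord_ext fun k hk => ?_
    rw [map_zero]
    obtain rfl | rfl | hk2 : k = 0 ∨ k = 1 ∨ 2 ≤ k := by omega
    · exact g0
    · exact hx1'
    · exact hx1 k hk2 hk
  -- the kernel of the right multiplication by `e₁` is spanned by `x`, `e₁ - e₂` and `eₙ`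
  have hker : ∀ v, opN n α v = 0 → (∀ r < 2, coord n r v = 0) → coord n n v = 0 → v = 0 := by
    intro v hv h01 hvn
    refine coord_ext fun k hk => ?_
    rw [map_zero]
    obtain hk2 | rfl | rfl | ⟨hk3, hlt⟩ : k < 2 ∨ k = 2 ∨ k = n ∨ 3 ≤ k ∧ k < n := by omega
    · exact h01 k hk2
    · have := coord_three_opN (α := α) hn v
      rwa [hv, map_zero, h01 1 (by omega), zero_add, eq_comm] at this
    · exact hvn
    · have := coord_opN (α := α) hn (show 4 ≤ k + 1 by omega) (by omega) v
      rwa [hv, map_zero, Nat.add_sub_cancel, eq_comm] at this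
  have qx : φ (e n 0) (e n 0) = 0 := by
    refine hker _ ?_ h.x_x hxx
    have h0 := h.comm (e n 0)
    rw [opN_zero, opD_zero, px] at h0
    simpa using h0
  have hD1 : φ (opD n α (e n 1)) (e n 1) = 0 := by
    rw [opD_one hn, map_add, map_sum, LinearMap.add_apply, LinearMap.sum_apply, pe 2 le_rfl,
      zero_add]
    refine sum_eq_zero fun k hk => ?_
    rw [mem_Icc] at hk
    rw [map_smul, LinearMap.smul_apply, pe k (by omega), smul_zero]
  have comm1 := h.comm (e n 1)
  rw [opN_one hn, qe 3 (by omega), hD1, px, map_zero, map_zero, sub_zero, sub_zero, zero_smul,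
    zero_smul, add_zero, add_zero] at comm1
  have p1 : φ (e n 1) (e n 1) = 0 := by
    refine coord_ext fun k hk => ?_
    rw [map_zero]
    have h01 : ∀ r < 2, coord n r (φ (e n 1) (e n 1)) = 0 := fun r hr => by
      rw [h.one_one r hr, pe 2 le_rfl, map_zero]
    obtain hk2 | rfl | hk3 : k < 2 ∨ k = 2 ∨ 3 ≤ k := by omega
    · exact h01 k hk2
    · have h0 := congrArg (coord n 2) comm1
      rwa [coord_opN_of_lt hn (by omega), coord_two_opD hn, h01 1 (by omega), zero_add,
        eq_comm] at h0
    · exact h11 k hk3 hk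
  have q1 : φ (e n 1) (e n 0) = 0 := by
    refine hker _ (by rw [comm1, p1, map_zero]) (fun r hr => ?_) h1x
    have := h.one_x r hr
    rwa [px, qe 2 le_rfl, pe (n - 1) (by omega), map_zero, mul_zero, sub_zero, add_zero] at this
  refine linearMap_ext fun i hi => linearMap_ext fun j hj => ?_
  rw [LinearMap.zero_apply, LinearMap.zero_apply]
  obtain rfl | rfl | hj2 : j = 0 ∨ j = 1 ∨ 2 ≤ j := by omega
  · obtain rfl | rfl | hi2 : i = 0 ∨ i = 1 ∨ 2 ≤ i := by omega
    · exact qx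
    · exact q1
    · exact qe i hi2
  · obtain rfl | rfl | hi2 : i = 0 ∨ i = 1 ∨ 2 ≤ i := by omega
    · exact px
    · exact p1
    · exact pe i hi2
  · obtain rfl | hj3 : j = 2 ∨ 3 ≤ j := by omega
    · have hs : ∀ r, ∑ j ∈ Icc 4 n, α j * coord n r (φ (e n (j - 1)) (e n 1)) = 0 := by
        intro r
        refine sum_eq_zero fun j hj => ?_
        rw [mem_Icc] at hj
        rw [pe (j - 1) (by omega), map_zero, mul_zero]
      rw [h.right_two, hs, hs, q2]
      simp
    · rw [h.right j (mem_Icc.2 (by omega)), pe (j - 1) (by omega)]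
      simp

/-- Every 2-cocycle has the general form: it agrees with the bilinear map of the general form whose
parameters are read off from it, by `eq_zero_of_mem_ZL2`. -/
theorem exists_isGeneralForm (hα : ∀ k, ¬ (4 ≤ k ∧ k ≤ n) → α k = 0) (hn : 3 ≤ n)
    (hφ : φ ∈ ZL2 (R5 n α)) :
    ∃ (a : ℕ → ℕ → ℂ) (c d : ℕ → ℂ) (β : ℂ), IsGeneralForm n α a c d β φ := by
  refine ⟨fun i k => coord n k (φ (e n i) (e n 1)),
    fun k => if k = n + 1 then coord n n (φ (e n 1) (e n 0)) else coord n k (φ (e n 2) (e n 0)),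
    fun k => coord n k (φ (e n 0) (e n 1)), coord n n (φ (e n 0) (e n 0)), ?_⟩
  set a : ℕ → ℕ → ℂ := fun i k => coord n k (φ (e n i) (e n 1)) with ha
  set c : ℕ → ℂ := fun k =>
    if k = n + 1 then coord n n (φ (e n 1) (e n 0)) else coord n k (φ (e n 2) (e n 0)) with hc
  set d : ℕ → ℂ := fun k => coord n k (φ (e n 0) (e n 1)) with hd
  set β := coord n n (φ (e n 0) (e n 0)) with hβ
  have h := isGeneralForm_ofTable hn α a c d β
  set ψ := ofTable n (generalTable n α a c d β) with hψ
  have h0 : ψ - φ = 0 := by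
    refine eq_zero_of_mem_ZL2 hα hn (Submodule.sub_mem _ (h.mem_ZL2 hα hn) hφ) ?_ ?_ ?_ ?_ ?_ ?_ ?_
    all_goals simp only [LinearMap.sub_apply, map_sub, sub_eq_zero]
    · intro k h3 hk
      rw [h.coord_e1_e1 h3 hk]
    · intro i h2 hi k hk
      rw [h.coord_e1_of_lt h2 hi hk]
    · intro k h2 hk
      rw [h.coord_e1 (by omega) le_rfl h2 hk]
    · intro k hk
      rw [h.coord_two_x hk, hc]
      simp only
      rw [if_neg (by omega)]
    · rw [h.coord_last_e1_x hn, hc]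
      simp only [if_true]
    · intro k h2 hk
      rw [h.coord_x_e1 h2 hk]
    · rw [h.coord_last_x_x hn]
  rw [← sub_eq_zero.1 h0]
  exact h

/-- The index set of the parameters of the general form; its summands belong to `a_{1,i}`,
`a_{i,s}` with `i < n`, `a_{n,i}`, `cᵢ` with `i ≤ n`, `c_{n+1}`, `dᵢ` and `β`. -/
abbrev ParamIndex (n : ℕ) : Type :=
  ↥(Icc 3 n) ⊕ (↥(Icc 2 (n - 1)) × ↥(Icc 0 n)) ⊕ ↥(Icc 2 n) ⊕ ↥(Icc 0 n) ⊕ Unit ⊕ ↥(Icc 2 n) ⊕ Unit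

/-- The indices `(i, j, k)` such that the parameter is the coordinate at `e_k` of `φ(eᵢ, eⱼ)`. -/
def paramPosition (n : ℕ) : ParamIndex n → ℕ × ℕ × ℕ
  | .inl k => (1, 1, k)
  | .inr (.inl (i, k)) => (i, 1, k)
  | .inr (.inr (.inl k)) => (n, 1, k)
  | .inr (.inr (.inr (.inl k))) => (2, 0, k)
  | .inr (.inr (.inr (.inr (.inl _)))) => (1, 0, n)
  | .inr (.inr (.inr (.inr (.inr (.inl k))))) => (0, 1, k)
  | .inr (.inr (.inr (.inr (.inr (.inr _))))) => (0, 0, n)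

/-- The linear map sending a bilinear map to the values of the parameters of the general form. -/
def params (n : ℕ) : Bil ℂ (V n) →ₗ[ℂ] (ParamIndex n → ℂ) :=
  LinearMap.pi fun p => coord n (paramPosition n p).2.2 ∘ₗ
    LinearMap.applyₗ (e n (paramPosition n p).2.1) ∘ₗ
      LinearMap.applyₗ (e n (paramPosition n p).1)

theorem params_apply (φ : Bil ℂ (V n)) (p : ParamIndex n) :
    params n φ p = coord n (paramPosition n p).2.2
      (φ (e n (paramPosition n p).1) (e n (paramPosition n p).2.1)) := rfl

theorem card_paramIndex (hn : 3 ≤ n) : Fintype.card (ParamIndex n) = n ^ 2 + 3 * n - 3 := by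
  obtain ⟨m, rfl⟩ : ∃ m, n = m + 3 := ⟨n - 3, by omega⟩
  simp only [Fintype.card_sum, Fintype.card_prod, Fintype.card_coe, Nat.card_Icc, Fintype.card_unit]
  have h1 : m + 3 + 1 - 3 = m + 1 := by omega
  have h2 : m + 3 - 1 + 1 - 2 = m + 1 := by omega
  have h3 : m + 3 + 1 - 0 = m + 4 := by omega
  have h4 : m + 3 + 1 - 2 = m + 2 := by omega
  rw [h1, h2, h3, h4]
  have : (m + 3) ^ 2 + 3 * (m + 3) =
    m + 1 + ((m + 1) * (m + 4) + (m + 2 + (m + 4 + (1 + (m + 2 + 1))))) + 3 := by ring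
  omega

theorem finrank_ZL2 (hα : ∀ k, ¬ (4 ≤ k ∧ k ≤ n) → α k = 0) (hn : 3 ≤ n) :
    Module.finrank ℂ (ZL2 (R5 n α)) = n ^ 2 + 3 * n - 3 := by
  set T : ZL2 (R5 n α) →ₗ[ℂ] (ParamIndex n → ℂ) := params n ∘ₗ (ZL2 (R5 n α)).subtype with hT
  have hinj : Function.Injective T := by
    rw [← LinearMap.ker_eq_bot, LinearMap.ker_eq_bot']
    rintro ⟨φ, hφ⟩ h0
    have h1 : ∀ p, params n φ p = 0 := fun p => congrFun h0 p
    simp only [params_apply] at h1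
    refine Subtype.ext (eq_zero_of_mem_ZL2 hα hn hφ ?_ ?_ ?_ ?_ ?_ ?_ ?_)
    · intro k h3 hk
      exact h1 (.inl ⟨k, mem_Icc.2 ⟨h3, hk⟩⟩)
    · intro i h2 hi k hk
      exact h1 (.inr (.inl (⟨i, mem_Icc.2 (by omega)⟩, ⟨k, mem_Icc.2 (by omega)⟩)))
    · intro k h2 hk
      exact h1 (.inr (.inr (.inl ⟨k, mem_Icc.2 ⟨h2, hk⟩⟩)))
    · intro k hk
      exact h1 (.inr (.inr (.inr (.inl ⟨k, mem_Icc.2 (by omega)⟩))))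
    · exact h1 (.inr (.inr (.inr (.inr (.inl ())))))
    · intro k h2 hk
      exact h1 (.inr (.inr (.inr (.inr (.inr (.inl ⟨k, mem_Icc.2 ⟨h2, hk⟩⟩))))))
    · exact h1 (.inr (.inr (.inr (.inr (.inr (.inr ()))))))
  have hsurj : Function.Surjective T := by
    intro t
    set a : ℕ → ℕ → ℂ := fun i k =>
      if h : i = 1 ∧ k ∈ Icc 3 n then t (.inl ⟨k, h.2⟩)
      else if h : i ∈ Icc 2 (n - 1) ∧ k ∈ Icc 0 n then t (.inr (.inl (⟨i, h.1⟩, ⟨k, h.2⟩)))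
      else if h : i = n ∧ k ∈ Icc 2 n then t (.inr (.inr (.inl ⟨k, h.2⟩))) else 0 with ha
    set c : ℕ → ℂ := fun k =>
      if h : k ∈ Icc 0 n then t (.inr (.inr (.inr (.inl ⟨k, h⟩))))
      else t (.inr (.inr (.inr (.inr (.inl ()))))) with hc
    set d : ℕ → ℂ := fun k =>
      if h : k ∈ Icc 2 n then t (.inr (.inr (.inr (.inr (.inr (.inl ⟨k, h⟩)))))) else 0 with hd
    have h := isGeneralForm_ofTable hn α a c d (t (.inr (.inr (.inr (.inr (.inr (.inr ())))))))
    refine ⟨⟨_, h.mem_ZL2 hα hn⟩, funext fun p => ?_⟩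
    rw [hT, LinearMap.comp_apply, Submodule.subtype_apply, params_apply]
    rcases p with ⟨k, hk⟩ | ⟨⟨i, hi⟩, ⟨k, hk⟩⟩ | ⟨k, hk⟩ | ⟨k, hk⟩ | u | ⟨k, hk⟩ | u
    · have hk' := mem_Icc.1 hk
      simp only [paramPosition]
      rw [h.coord_e1_e1 hk'.1 hk'.2, ha]
      beta_reduce
      rw [dif_pos ⟨rfl, hk⟩]
    · have hk' := mem_Icc.1 hk
      have hi' := mem_Icc.1 hi
      simp only [paramPosition]
      rw [h.coord_e1_of_lt hi'.1 (by omega) hk'.2, ha]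
      simp only
      rw [dif_neg (by omega), dif_pos ⟨hi, hk⟩]
    · have hk' := mem_Icc.1 hk
      simp only [paramPosition]
      rw [h.coord_e1 (by omega) le_rfl hk'.1 hk'.2, ha]
      beta_reduce
      rw [dif_neg (by omega), dif_neg (by rw [mem_Icc]; omega), dif_pos ⟨rfl, hk⟩]
    · have hk' := mem_Icc.1 hk
      simp only [paramPosition]
      rw [h.coord_two_x hk'.2, hc]
      simp only
      rw [dif_pos hk]
    · simp only [paramPosition]
      rw [h.coord_last_e1_x hn, hc]
      simp only
      rw [dif_neg (by rw [mem_Icc]; omega)]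
    · have hk' := mem_Icc.1 hk
      simp only [paramPosition]
      rw [h.coord_x_e1 hk'.1 hk'.2, hd]
      simp only
      rw [dif_pos hk]
    · simp only [paramPosition]
      rw [h.coord_last_x_x hn]
  rw [(LinearEquiv.ofBijective T ⟨hinj, hsurj⟩).finrank_eq, Module.finrank_fintype_fun_eq_card,
    card_paramIndex hn]

end

/-! ### The explicit cocycles -/

section
variable {n : ℕ} {α : ℕ → ℂ}

theorem apply_opD_eq_zero {φ : Bil ℂ (V n)} {v : V n} (hn : 3 ≤ n)
    (h : ∀ i, 2 ≤ i → φ (e n i) v = 0) (u : V n) : φ (opD n α u) v = 0 := by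
  have : φ.flip v ∘ₗ opD n α = 0 := by
    refine linearMap_ext fun i hi => ?_
    rw [LinearMap.comp_apply, LinearMap.flip_apply, LinearMap.zero_apply]
    have hs : ∀ m r (t : ℕ → ℂ), 2 ≤ m → φ (∑ k ∈ Icc m r, t k • e n k) v = 0 := by
      intro m r t hm
      rw [map_sum, LinearMap.sum_apply]
      refine sum_eq_zero fun k hk => ?_
      rw [mem_Icc] at hk
      rw [map_smul, LinearMap.smul_apply, h k (by omega), smul_zero]
    obtain rfl | rfl | h2 : i = 0 ∨ i = 1 ∨ 2 ≤ i := by omega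
    · rw [opD_zero, map_zero, LinearMap.zero_apply]
    · rw [opD_one hn, map_add, LinearMap.add_apply, h 2 le_rfl, hs _ _ _ (by omega), add_zero]
    · rw [opD_e i h2, map_add, LinearMap.add_apply, h i h2, hs _ _ _ (by omega), add_zero]
  exact congrArg (fun f => f u) this

/-- A criterion for bilinear maps that vanish if the second argument is in the span of
`e₂, …, eₙ`. -/
theorem mem_ZL2_of_comm {φ : Bil ℂ (V n)} (hα : ∀ k, ¬ (4 ≤ k ∧ k ≤ n) → α k = 0) (hn : 3 ≤ n)
    (hW : ∀ i ≤ n, ∀ j, 2 ≤ j → j ≤ n → φ (e n i) (e n j) = 0)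
    (hP : ∀ i, 1 ≤ i → i ≤ n → ∀ r < 2, coord n r (φ (e n i) (e n 1)) = 0)
    (hQ : ∀ i, 2 ≤ i → i ≤ n → ∀ r < 2, coord n r (φ (e n i) (e n 0)) = 0)
    (hxx : ∀ r < 2, coord n r (φ (e n 0) (e n 0)) = 0)
    (hx1 : coord n 0 (φ (e n 0) (e n 1)) = 0)
    (h1x : ∀ r < 2, coord n r (φ (e n 1) (e n 0)) + coord n r (φ (e n 0) (e n 1)) = 0)
    (comm : ∀ i ≤ n, opN n α (φ (e n i) (e n 0)) - φ (opN n α (e n i)) (e n 0) =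
      opD n α (φ (e n i) (e n 1)) - φ (opD n α (e n i)) (e n 1)
        + coord n 1 (φ (e n 0) (e n 1)) • opN n α (e n i)) :
    φ ∈ ZL2 (R5 n α) := by
  have hW' : ∀ j, 2 ≤ j → j ≤ n → ∀ u, φ u (e n j) = 0 := by
    intro j h2 hj u
    have : φ.flip (e n j) = 0 := linearMap_ext fun i hi => hW i hi j h2 hj
    exact congrArg (fun f => f u) this
  have hs : ∀ r < 2, ∑ j ∈ Icc 4 n, α j * coord n r (φ (e n (j - 1)) (e n 1)) = 0 := by
    intro r hr
    refine sum_eq_zero fun j hj => ?_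
    rw [mem_Icc] at hj
    rw [hP (j - 1) (by omega) (by omega) r hr, mul_zero]
  refine CocycleConditions.mem_ZL2 ?_ hα hn
  constructor
  · intro u
    rw [hs 0 (by omega), hs 1 (by omega), hQ 2 le_rfl (by omega) 0 (by omega),
      hQ 2 le_rfl (by omega) 1 (by omega), hW' 2 le_rfl (by omega)]
    simp
  · intro j hj u
    rw [mem_Icc] at hj
    rw [hP (j - 1) (by omega) (by omega) 0 (by omega),
      hP (j - 1) (by omega) (by omega) 1 (by omega), hW' j (by omega) hj.2]
    simp
  · intro r hr
    rw [hP 1 le_rfl (by omega) r hr, hP 2 (by omega) (by omega) r hr]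
  · intro r hr
    exact hP n (by omega) le_rfl r hr
  · intro j hj r hr
    rw [mem_Icc] at hj
    rw [hQ (j + 1) (by omega) (by omega) r hr, hP j (by omega) (by omega) r hr, sum_eq_zero,
      add_zero]
    intro k hk
    rw [mem_Icc] at hk
    rw [hP k (by omega) (by omega) r hr, mul_zero]
  · exact hxx
  · intro r hr
    rw [h1x r hr, hQ 2 le_rfl (by omega) r hr, hP (n - 1) (by omega) (by omega) r hr]
    simp
  · intro u
    have : opN n α ∘ₗ φ.flip (e n 0) - φ.flip (e n 0) ∘ₗ opN n α =
        opD n α ∘ₗ φ.flip (e n 1) - φ.flip (e n 1) ∘ₗ opD n α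
          + coord n 1 (φ (e n 0) (e n 1)) • opN n α :=
      linearMap_ext fun i hi => by
        simpa only [LinearMap.sub_apply, LinearMap.add_apply, LinearMap.comp_apply,
          LinearMap.smul_apply, LinearMap.flip_apply] using comm i hi
    have := congrArg (fun f => f u) this
    simp only [LinearMap.sub_apply, LinearMap.add_apply, LinearMap.comp_apply,
      LinearMap.smul_apply, LinearMap.flip_apply] at this
    rw [this, hx1, zero_smul, add_zero]

theorem rho_right {i j : ℕ} (hi : i ≤ n) (h2 : 2 ≤ j) (hj : j ≤ n) :
    rho n α (e n i) (e n j) = 0 := by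
  rw [rho, ofTable_e n _ hi hj, if_neg (by omega), if_neg (by omega)]

theorem rho_e_one (hn : 3 ≤ n) {i : ℕ} (h1 : 1 ≤ i) : rho n α (e n i) (e n 1) = 0 := by
  by_cases hi : i ≤ n
  · rw [rho, ofTable_e n _ hi (by omega), if_neg (by omega), if_neg (by omega)]
  · rw [e_of_lt (by omega), map_zero, LinearMap.zero_apply]

theorem rho_x_one (hn : 3 ≤ n) : rho n α (e n 0) (e n 1) = e n 2 - e n 1 := by
  rw [rho, ofTable_e n _ (by omega) (by omega), if_neg (by omega), if_pos (by omega)]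

theorem rho_x_x : rho n α (e n 0) (e n 0) = α n • e n (n - 1) := by
  rw [rho, ofTable_e n _ (by omega) (by omega), if_pos rfl, if_pos rfl]

theorem rho_one_x (hn : 3 ≤ n) : rho n α (e n 1) (e n 0) = e n 1 - e n 2 := by
  rw [rho, ofTable_e n _ (by omega) (by omega), if_pos rfl, if_neg (by omega), if_pos rfl]

theorem rho_e_x {i : ℕ} (h2 : 2 ≤ i) :
    rho n α (e n i) (e n 0) = ((i : ℂ) - 2) • e n i := by
  by_cases hi : i ≤ n
  · rw [rho, ofTable_e n _ hi (by omega), if_pos rfl, if_neg (by omega), if_neg (by omega)]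
    split_ifs with h3
    · rfl
    · obtain rfl : i = 2 := by omega
      norm_num
  · rw [e_of_lt (by omega), map_zero, LinearMap.zero_apply, smul_zero]

theorem rho_mem_ZL2 (hα : ∀ k, ¬ (4 ≤ k ∧ k ≤ n) → α k = 0) (hn : 3 ≤ n) :
    rho n α ∈ ZL2 (R5 n α) := by
  refine mem_ZL2_of_comm hα hn (fun i hi j h2 hj => rho_right hi h2 hj) ?_ ?_ ?_ ?_ ?_ ?_
  · intro i h1 hi r hr
    rw [rho_e_one hn h1, map_zero]
  · intro i h2 hi r hr
    rw [rho_e_x h2, map_smul, coord_e_ne (by omega), smul_zero]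
  · intro r hr
    rw [rho_x_x, map_smul, coord_e_ne (by omega), smul_zero]
  · rw [rho_x_one hn, map_sub, coord_e_ne (by omega), coord_e_ne (by omega), sub_zero]
  · intro r hr
    rw [rho_x_one hn, rho_one_x hn, map_sub, map_sub]
    ring
  · intro i hi
    have h1 : coord n 1 (rho n α (e n 0) (e n 1)) = -1 := by
      rw [rho_x_one hn, map_sub, coord_e_ne (by omega), coord_e_self (by omega), zero_sub]
    rw [h1, apply_opD_eq_zero hn fun i hi => rho_e_one hn (by omega)]
    obtain rfl | rfl | h2 : i = 0 ∨ i = 1 ∨ 2 ≤ i := by omega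
    · rw [rho_x_x, rho_x_one hn, opN_zero, map_smul, opN_e hn (by omega),
        Nat.sub_add_cancel (by omega), map_sub, opD_one_eq hα hn, map_zero, LinearMap.zero_apply]
      module
    · rw [rho_one_x hn, rho_e_one hn le_rfl, map_sub, opN_one hn, opN_e hn le_rfl,
        rho_e_x (by omega), map_zero]
      norm_num
    · rw [rho_e_x h2, rho_e_one hn (by omega), map_smul, opN_e hn h2, rho_e_x (by omega), map_zero]
      push_cast
      module

theorem psi_right {k i j : ℕ} (hi : i ≤ n) (h1 : 1 ≤ j) (hj : j ≤ n) :
    psi n k (e n i) (e n j) = 0 := by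
  rw [psi, ofTable_e n _ hi hj]
  split_ifs <;> first | rfl | omega

theorem psi_x_x {k : ℕ} : psi n k (e n 0) (e n 0) = 0 := by
  rw [psi, ofTable_e n _ (by omega) (by omega)]
  split_ifs <;> first | rfl | omega | simp_all

theorem psi_one_x {k : ℕ} (hn : 3 ≤ n) :
    psi n k (e n 1) (e n 0) = if k = n then 0 else e n k := by
  rw [psi, ofTable_e n _ (by omega) (by omega)]
  split_ifs <;> first | rfl | omega

theorem psi_e_x {k i : ℕ} (h4 : 4 ≤ k) (hkn : k ≤ n) (h2 : 2 ≤ i) :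
    psi n k (e n i) (e n 0) = e n (k + i - 2) := by
  by_cases hi : i ≤ n
  · rw [psi, ofTable_e n _ hi (by omega)]
    split_ifs with h1 h3 h4 h5 h6
    · congr 1
      omega
    · rw [e_of_lt (by omega)]
    · omega
    · rfl
    · rw [e_of_lt (by omega)]
    · omega
  · rw [e_of_lt (by omega : n < i), e_of_lt (by omega : n < k + i - 2), map_zero,
      LinearMap.zero_apply]

theorem psi_mem_ZL2 (hα : ∀ k, ¬ (4 ≤ k ∧ k ≤ n) → α k = 0) {k : ℕ} (h4 : 4 ≤ k)
    (hk : k ≤ n) : psi n k ∈ ZL2 (R5 n α) := by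
  have hn : 3 ≤ n := by omega
  have p1 : ∀ i, psi n k (e n i) (e n 1) = 0 := by
    intro i
    by_cases hi : i ≤ n
    · exact psi_right hi le_rfl (by omega)
    · rw [e_of_lt (by omega), map_zero, LinearMap.zero_apply]
  refine mem_ZL2_of_comm hα hn (fun i hi j h2 hj => psi_right hi (by omega) hj) ?_ ?_ ?_ ?_ ?_ ?_
  · intro i h1 hi r hr
    rw [p1, map_zero]
  · intro i h2 hi r hr
    rw [psi_e_x h4 hk h2, coord_e_ne (by omega)]
  · intro r hr
    rw [psi_x_x, map_zero]
  · rw [p1, map_zero]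
  · intro r hr
    rw [p1, psi_one_x hn, map_zero, add_zero]
    split_ifs
    · rw [map_zero]
    · rw [coord_e_ne (by omega)]
  · intro i hi
    rw [apply_opD_eq_zero hn fun i hi => p1 i, p1, p1]
    obtain rfl | rfl | h2 : i = 0 ∨ i = 1 ∨ 2 ≤ i := by omega
    · rw [psi_x_x, opN_zero]
      simp
    · rw [psi_one_x hn, opN_one hn, psi_e_x h4 hk (by omega)]
      split_ifs with h
      · rw [e_of_lt (by omega)]
        simp
      · rw [opN_e hn (by omega)]
        simp
    · rw [psi_e_x h4 hk h2, opN_e hn (by omega), opN_e hn h2, psi_e_x h4 hk (by omega),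
        show k + i - 2 + 1 = k + (i + 1) - 2 by omega]
      simp

theorem opN_sum (hn : 3 ≤ n) {m r : ℕ} (hm : 2 ≤ m) (t : ℕ → ℂ) :
    opN n α (∑ l ∈ Icc m r, t l • e n l) = ∑ l ∈ Icc (m + 1) (r + 1), t (l - 1) • e n l := by
  rw [map_sum, ← Finset.map_add_right_Icc, Finset.sum_map]
  refine sum_congr rfl fun l hl => ?_
  rw [mem_Icc] at hl
  rw [map_smul, opN_e hn (by omega)]
  simp

theorem sum_Icc_succ_e (m : ℕ) (t : ℕ → ℂ) :
    ∑ l ∈ Icc m (n + 1), t l • e n l = ∑ l ∈ Icc m n, t l • e n l := by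
  symm
  refine sum_subset (Icc_subset_Icc le_rfl (by omega)) fun l hl hl' => ?_
  rw [mem_Icc] at hl hl'
  rw [e_of_lt (by omega), smul_zero]

theorem phi_right {k i j : ℕ} (hi : i ≤ n) (h2 : 2 ≤ j) (hj : j ≤ n) :
    phi n α k (e n i) (e n j) = 0 := by
  rw [phi, ofTable_e n _ hi hj]
  split_ifs <;> first | rfl | omega

theorem phi_last_one {k : ℕ} (hn : 3 ≤ n) : phi n α k (e n n) (e n 1) = e n k := by
  rw [phi, ofTable_e n _ le_rfl (by omega), if_pos ⟨rfl, rfl⟩]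

theorem phi_one_one {k : ℕ} (hn : 3 ≤ n) :
    phi n α k (e n 1) (e n 1) = if k = 2 then -α n • e n 2 else 0 := by
  rw [phi, ofTable_e n _ (by omega) (by omega), if_neg (by omega)]
  split_ifs <;> first | rfl | omega | simp_all

theorem phi_e_one {k i : ℕ} (hn : 3 ≤ n) (hi : i ≠ 1) (hin : i ≠ n) :
    phi n α k (e n i) (e n 1) = 0 := by
  by_cases h : i ≤ n
  · rw [phi, ofTable_e n _ h (by omega), if_neg (by omega)]
    split_ifs <;> first | rfl | omega | simp_all
  · rw [e_of_lt (by omega), map_zero, LinearMap.zero_apply]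

theorem phi_x_x {k : ℕ} (hn : 3 ≤ n) : phi n α k (e n 0) (e n 0) = 0 := by
  rw [phi, ofTable_e n _ (by omega) (by omega), if_neg (by omega)]
  split_ifs <;> first | rfl | omega | simp_all

theorem phi_one_x {k : ℕ} (hn : 3 ≤ n) : phi n α k (e n 1) (e n 0) =
    if k = 2 then -α n • ∑ l ∈ Icc 3 (n - 1), α (l + 1) • e n l else α n • e n (k - 1) := by
  rw [phi, ofTable_e n _ (by omega) (by omega), if_neg (by omega)]
  split_ifs <;> first | rfl | omega | simp_all

/-- The values `φ_{n,k}(eᵢ, x)` with `2 ≤ i ≤ n` are given by a single formula, as `α₃ = 0` and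
`αⱼ = 0` for `j > n`. -/
theorem phi_e_x {k i : ℕ} (hα : ∀ k, ¬ (4 ≤ k ∧ k ≤ n) → α k = 0) (hn : 3 ≤ n) (hk : 2 ≤ k)
    (hkn : k ≤ n) (h2 : 2 ≤ i) (hi : i ≤ n) :
    phi n α k (e n i) (e n 0) = ∑ l ∈ Icc k n, α (n + l + 3 - i - k) • e n l := by
  have hsub : ∀ (m r : ℕ), k ≤ m → r ≤ n →
      (∀ l, k ≤ l → l ≤ n → ¬ (m ≤ l ∧ l ≤ r) → ¬ (4 ≤ n + l + 3 - i - k ∧ n + l + 3 - i - k ≤ n)) →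
      ∑ l ∈ Icc m r, α (n + l + 3 - i - k) • e n l =
        ∑ l ∈ Icc k n, α (n + l + 3 - i - k) • e n l := by
    intro m r hm hr h
    refine sum_subset (Icc_subset_Icc hm hr) fun l hl hl' => ?_
    rw [mem_Icc] at hl hl'
    rw [hα _ (h l hl.1 hl.2 hl'), zero_smul]
  have hcongr : ∀ (m r : ℕ) (f g : ℕ → ℕ), (∀ l, m ≤ l → l ≤ r → f l = g l) →
      ∑ l ∈ Icc m r, α (f l) • e n l = ∑ l ∈ Icc m r, α (g l) • e n l := by
    intro m r f g h
    refine sum_congr rfl fun l hl => ?_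
    rw [mem_Icc] at hl
    rw [h l hl.1 hl.2]
  rw [phi, ofTable_e n _ hi (by omega), if_neg (by omega)]
  split_ifs with h1 h3 h4 h5 h6 h7 h8 h9 h10
  any_goals omega
  · subst h1
    rw [← hsub 2 (i - 1) (by omega) (by omega) (by omega)]
    exact hcongr _ _ _ _ (by omega)
  · subst h1
    rw [← hsub 3 (n - 1) (by omega) (by omega) (by omega)]
    exact hcongr _ _ _ _ (by omega)
  · rw [← hsub n 0 (by omega) (by omega) (by omega), Icc_eq_empty (by omega), sum_empty]
  · exact hsub k (i + k - 3) le_rfl (by omega) (by omega)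
  · rfl
  · rw [← hsub (k + 1) n (by omega) (by omega) (by omega)]
    exact hcongr _ _ _ _ (by omega)
  · rw [← hsub n 0 (by omega) (by omega) (by omega), Icc_eq_empty (by omega), sum_empty]

theorem phi_opD {k i : ℕ} (hα : ∀ k, ¬ (4 ≤ k ∧ k ≤ n) → α k = 0) (hn : 3 ≤ n) (h2 : 2 ≤ i)
    (hi : i < n) : phi n α k (opD n α (e n i)) (e n 1) = α (n - i + 2) • e n k := by
  rw [opD_e i h2, map_add, map_sum, LinearMap.add_apply, LinearMap.sum_apply,
    phi_e_one hn (by omega) (by omega), zero_add]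
  by_cases h : i + 2 ≤ n
  · rw [sum_eq_single_of_mem n (mem_Icc.2 ⟨h, le_rfl⟩), map_smul, LinearMap.smul_apply,
      phi_last_one hn]
    intro j hj hjn
    rw [mem_Icc] at hj
    rw [map_smul, LinearMap.smul_apply, phi_e_one hn (by omega) hjn, smul_zero]
  · rw [Icc_eq_empty h, sum_empty, hα _ (by omega), zero_smul]

theorem phi_mem_ZL2 (hα : ∀ k, ¬ (4 ≤ k ∧ k ≤ n) → α k = 0) {k : ℕ} (hn : 3 ≤ n) (hk : 2 ≤ k)
    (hkn : k < n) : phi n α k ∈ ZL2 (R5 n α) := by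
  have px : phi n α k (e n 0) (e n 1) = 0 := phi_e_one hn (by omega) (by omega)
  refine mem_ZL2_of_comm hα hn (fun i hi j h2 hj => phi_right hi h2 hj) ?_ ?_ ?_ ?_ ?_ ?_
  · intro i h1 hi r hr
    obtain rfl | rfl | h : i = 1 ∨ i = n ∨ i ≠ 1 ∧ i ≠ n := by omega
    · rw [phi_one_one hn]
      split_ifs
      · rw [map_smul, coord_e_ne (by omega), smul_zero]
      · rw [map_zero]
    · rw [phi_last_one hn, coord_e_ne (by omega)]
    · rw [phi_e_one hn h.1 h.2, map_zero]
  · intro i h2 hi r hr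
    rw [phi_e_x hα hn hk hkn.le h2 hi, coord_sum_Icc_eq_zero _ (by omega)]
  · intro r hr
    rw [phi_x_x hn, map_zero]
  · rw [px, map_zero]
  · intro r hr
    rw [px, phi_one_x hn, map_zero, add_zero]
    split_ifs
    · rw [map_smul, coord_sum_Icc_eq_zero _ (by omega), smul_zero]
    · rw [map_smul, coord_e_ne (by omega), smul_zero]
  · intro i hi
    rw [px, map_zero, zero_smul, add_zero]
    obtain rfl | rfl | h2 : i = 0 ∨ i = 1 ∨ 2 ≤ i := by omega
    · rw [px, phi_x_x hn, opN_zero, opD_zero]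
      simp
    · have hD : phi n α k (opD n α (e n 1)) (e n 1) = 0 := by
        rw [opD_one hn, map_add, map_sum, LinearMap.add_apply, LinearMap.sum_apply,
          phi_e_one hn (by omega) (by omega), zero_add]
        refine sum_eq_zero fun j hj => ?_
        rw [mem_Icc] at hj
        rw [map_smul, LinearMap.smul_apply, phi_e_one hn (by omega) (by omega), smul_zero]
      have h3 : phi n α k (e n 3) (e n 0) = α n • e n k := by
        rw [phi_e_x hα hn hk hkn.le (by omega) hn,
          sum_eq_single_of_mem k (mem_Icc.2 ⟨le_rfl, hkn.le⟩),
          show n + k + 3 - 3 - k = n by omega]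
        intro l hl hlk
        rw [mem_Icc] at hl
        rw [hα _ (by omega), zero_smul]
      rw [hD, opN_one hn, h3, phi_one_one hn, phi_one_x hn, sub_zero]
      split_ifs with h
      · rw [h, map_smul, opN_sum hn (by omega), Nat.sub_add_cancel (by omega), map_smul,
          opD_e 2 le_rfl]
        have : ∑ l ∈ Icc (3 + 1) n, α (l - 1 + 1) • e n l =
            ∑ l ∈ Icc (2 + 2) n, α (l - 2 + 2) • e n l :=
          sum_congr rfl fun l hl => by
            rw [mem_Icc] at hl
            rw [show l - 1 + 1 = l - 2 + 2 by omega]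
        rw [this]
        module
      · rw [map_smul, opN_e hn (by omega), Nat.sub_add_cancel (by omega), sub_self, map_zero]
    · rw [phi_e_x hα hn hk hkn.le h2 hi, opN_sum hn hk, sum_Icc_succ_e]
      obtain rfl | hlt : i = n ∨ i < n := by omega
      · have hD : opD i α (e i i) = e i i := by
          rw [opD_e i (by omega), Icc_eq_empty (by omega), sum_empty, add_zero]
        rw [opN_e hn h2, e_of_lt (Nat.lt_succ_self i), map_zero, LinearMap.zero_apply, sub_zero,
          hD, phi_last_one hn, opD_e k hk, add_sub_cancel_left]
        rw [sum_Icc_eq_bot_add (show k + 1 ≤ i by omega),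
          hα (i + (k + 1 - 1) + 3 - i - k) (by omega), zero_smul, zero_add]
        refine sum_congr rfl fun l hl => ?_
        rw [mem_Icc] at hl
        rw [show i + (l - 1) + 3 - i - k = l - k + 2 by omega]
      · rw [opN_e hn h2, phi_e_x (i := i + 1) hα hn hk hkn.le (by omega) hlt, phi_opD hα hn h2 hlt,
          phi_e_one hn (by omega) (by omega), map_zero, zero_sub, sum_Icc_eq_bot_add hkn.le,
          show n + k + 3 - (i + 1) - k = n - i + 2 by omega]
        have : ∑ l ∈ Icc (k + 1) n, α (n + (l - 1) + 3 - i - k) • e n l =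
            ∑ l ∈ Icc (k + 1) n, α (n + l + 3 - (i + 1) - k) • e n l :=
          sum_congr rfl fun l hl => by
            rw [mem_Icc] at hl
            rw [show n + (l - 1) + 3 - i - k = n + l + 3 - (i + 1) - k by omega]
        rw [this]
        module

theorem cocycleFamily_mem_ZL2 (hα : ∀ k, ¬ (4 ≤ k ∧ k ≤ n) → α k = 0) (hn : 3 ≤ n)
    {K : Finset ℕ} (hK : K ⊆ Icc 4 n) (p : Unit ⊕ (↥K ⊕ ↥(Icc 2 (n - 1)))) :
    cocycleFamily n α K p ∈ ZL2 (R5 n α) := by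
  rcases p with _ | ⟨k, hk⟩ | ⟨k, hk⟩
  · exact rho_mem_ZL2 hα hn
  · have := mem_Icc.1 (hK hk)
    exact psi_mem_ZL2 hα this.1 this.2
  · have := mem_Icc.1 hk
    exact phi_mem_ZL2 hα hn this.1 (show k < n by omega)

end

/-! ### Coboundaries and derivations -/

section
variable {n : ℕ} {α : ℕ → ℂ}

theorem opN_pow_e (hn : 3 ≤ n) (m : ℕ) {i : ℕ} (hi : 2 ≤ i) :
    (opN n α ^ m) (e n i) = e n (i + m) := by
  induction m with
  | zero => rfl
  | succ m ih => rw [pow_succ', Module.End.mul_apply, ih, opN_e hn (by omega)]; rfl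

/-- An element of the span of `e₂, …, eₙ` in terms of its coordinates. -/
theorem eq_sum_of_coord {v : V n} (hv : ∀ r < 2, coord n r v = 0) :
    v = ∑ l ∈ Icc 2 n, coord n l v • e n l := by
  refine coord_ext fun k hk => ?_
  by_cases h2 : k < 2
  · rw [coord_sum_Icc_eq_zero _ (by omega), hv k h2]
  · rw [coord_sum_Icc _ (by omega) hk hk]

theorem opN_pow_eq_zero (hn : 3 ≤ n) {v : V n} (hv : ∀ r < 2, coord n r v = 0) :
    (opN n α ^ (n - 1)) v = 0 := by
  rw [eq_sum_of_coord hv, map_sum]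
  refine sum_eq_zero fun l hl => ?_
  rw [mem_Icc] at hl
  rw [map_smul, opN_pow_e hn _ hl.1, e_of_lt (by omega), smul_zero]

/-- On the span of `e₂, …, eₙ`, the right multiplication by `x` is a polynomial in that by `e₁`. -/
theorem opD_eq_sum_pow (hn : 3 ≤ n) {v : V n} (hv : ∀ r < 2, coord n r v = 0) :
    opD n α v = v + ∑ k ∈ Icc 4 n, α k • (opN n α ^ (k - 2)) v := by
  have he : ∀ i, 2 ≤ i → opD n α (e n i) = e n i + ∑ k ∈ Icc 4 n, α k • (opN n α ^ (k - 2)) (e n i)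
      := by
    intro i hi
    rw [opD_e i hi]
    congr 1
    have h1 : ∑ k ∈ Icc 4 n, α k • (opN n α ^ (k - 2)) (e n i) =
        ∑ k ∈ Icc (i + 2) (n + (i - 2)), α (k - i + 2) • e n k := by
      rw [show i + 2 = 4 + (i - 2) by omega, ← Finset.map_add_right_Icc, Finset.sum_map]
      refine sum_congr rfl fun k hk => ?_
      rw [mem_Icc] at hk
      rw [opN_pow_e hn _ hi, addRightEmbedding_apply, show k + (i - 2) - i + 2 = k by omega,
        show i + (k - 2) = k + (i - 2) by omega]
    rw [h1]
    refine sum_subset (Icc_subset_Icc le_rfl (by omega)) fun l hl hl' => ?_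
    rw [mem_Icc] at hl hl'
    rw [e_of_lt (by omega), smul_zero]
  have h := eq_sum_of_coord hv
  conv_lhs => rw [h]
  have h2 : ∀ f : V n →ₗ[ℂ] V n, f v = ∑ l ∈ Icc 2 n, coord n l v • f (e n l) := by
    intro f
    conv_lhs => rw [h]
    simp only [map_sum, map_smul]
  have h3 : ∑ k ∈ Icc 4 n, α k • (opN n α ^ (k - 2)) v =
      ∑ l ∈ Icc 2 n, coord n l v • ∑ k ∈ Icc 4 n, α k • (opN n α ^ (k - 2)) (e n l) := by
    simp only [h2 (opN n α ^ (_ - 2)), smul_sum]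
    rw [sum_comm]
    refine sum_congr rfl fun l hl => sum_congr rfl fun k hk => ?_
    rw [smul_comm]
  rw [h3]
  conv_rhs => rw [h]
  rw [← sum_add_distrib, map_sum]
  refine sum_congr rfl fun l hl => ?_
  rw [mem_Icc] at hl
  rw [map_smul, he l hl.1, smul_add, ← h]

/-- On the span of `e₂, …, eₙ`, the right multiplication by `x` is unitriangular. -/
theorem eq_zero_of_opD_eq_zero (hα : ∀ k, ¬ (4 ≤ k ∧ k ≤ n) → α k = 0) (hn : 3 ≤ n) {v : V n}
    (hv : ∀ r < 2, coord n r v = 0) (h : opD n α v = 0) : v = 0 := by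
  have key : ∀ k, k ≤ n → coord n k v = 0 := by
    intro k
    induction k using Nat.strong_induction_on with
    | _ k ih =>
      intro hk
      obtain hk2 | rfl | hk3 : k < 2 ∨ k = 2 ∨ 3 ≤ k := by omega
      · exact hv k hk2
      · have := coord_two_opD (α := α) hn v
        rwa [h, map_zero, hv 1 (by omega), zero_add, eq_comm] at this
      · have := coord_opD hα hn hk3 hk v
        rw [h, map_zero, hv 1 (by omega), mul_zero, ite_self, add_zero, sum_eq_zero,
          add_zero] at this
        · exact this.symm
        · intro l hl
          rw [mem_Icc] at hl
          rw [ih l (by omega) (by omega), mul_zero]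
  exact coord_ext fun k hk => by rw [key k hk, map_zero]

theorem apply_e_of_recursion (hn : 3 ≤ n) {d : V n →ₗ[ℂ] V n} {a b : ℂ}
    (h1 : ∀ i, 2 ≤ i → i < n →
      d (e n (i + 1)) = opN n α (d (e n i)) + b • opD n α (e n i) + a • e n (i + 1))
    (m : ℕ) (hm : m + 2 ≤ n) : d (e n (m + 2)) =
      (opN n α ^ m) (d (e n 2)) + (m : ℂ) • (b • opD n α (e n (m + 1)) + a • e n (m + 2)) := by
  induction m with
  | zero => simp
  | succ m ih =>
    have h := h1 (m + 2) (by omega) (by omega)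
    rw [ih (by omega), map_add, map_smul, map_add, map_smul, map_smul, opN_opD hn,
      opN_e hn (by omega : 2 ≤ m + 2)] at h
    rw [show m + 1 + 2 = m + 2 + 1 by omega, h, pow_succ', Module.End.mul_apply]
    obtain rfl | hm0 : m = 0 ∨ 1 ≤ m := by omega
    · simp only [Nat.cast_zero, zero_smul, zero_add]
      push_cast
      module
    · rw [opN_e hn (by omega : 2 ≤ m + 1)]
      push_cast
      module

/-- The commutator of a linear map with the right multiplication by `e₁` on the span of
`e₂, …, eₙ`. As the latter is nilpotent there, a component along the right multiplication by `x`
would contribute the nonzero multiple `(n - 1) b eₙ` to the value at `eₙ`. -/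
theorem eq_zero_of_commutator_opN (hn : 3 ≤ n)
    {d : V n →ₗ[ℂ] V n} {a b : ℂ} {w : V n} (hd : ∀ r < 2, coord n r (d (e n 2)) = 0)
    (h1 : ∀ i, 2 ≤ i → i < n →
      d (e n (i + 1)) = opN n α (d (e n i)) + b • opD n α (e n i) + a • e n (i + 1))
    (hw : opN n α (d (e n n)) + b • opD n α (e n n) = w) (hwn : coord n n w = 0) :
    b = 0 ∧ w = 0 := by
  have h := apply_e_of_recursion hn h1 (n - 2) (by omega)
  have hD : opD n α (e n n) = e n n := by
    rw [opD_e n (by omega), Icc_eq_empty (by omega), sum_empty, add_zero]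
  rw [Nat.sub_add_cancel (by omega), show n - 2 + 1 = n - 1 by omega] at h
  have hN : opN n α ((opN n α ^ (n - 2)) (d (e n 2))) = 0 := by
    rw [← Module.End.mul_apply, ← pow_succ', show n - 2 + 1 = n - 1 by omega,
      opN_pow_eq_zero hn hd]
  have hb : w = (((n - 2 : ℕ) : ℂ) + 1) • b • e n n := by
    rw [← hw, h, map_add, map_smul, map_add, map_smul, map_smul, opN_opD hn, hN,
      opN_e hn (by omega), opN_e hn (by omega), e_of_lt (Nat.lt_succ_self n),
      Nat.sub_add_cancel (by omega), hD]
    module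
  have h0 := hwn
  rw [hb, map_smul, map_smul, coord_e_self le_rfl, smul_eq_mul, smul_eq_mul, mul_one] at h0
  have b0 : b = 0 := (mul_eq_zero.1 h0).resolve_left (Nat.cast_add_one_ne_zero _)
  exact ⟨b0, by rw [hb, b0, zero_smul, smul_zero]⟩

/-- The commutator of a linear map `d` satisfying `[d, e₁-multiplication] = a · e₁-multiplication`
with the right multiplication by `x`, on the span of `e₂, …, eₙ`: it is `-a t f'(t)` evaluated at
the right multiplication by `e₁`, where `f` expresses the one by `x` as a polynomial. -/
theorem coord_of_commutator_opD (hn : 3 ≤ n)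
    {d : V n →ₗ[ℂ] V n} {a p q r : ℂ} {y : V n} (hd : ∀ r < 2, coord n r (d (e n 2)) = 0)
    (h1 : ∀ i, 2 ≤ i → d (e n (i + 1)) = opN n α (d (e n i)) + a • e n (i + 1))
    (h2 : opD n α (d (e n 2)) + p • opD n α (e n 2) + q • e n 3 - d (opD n α (e n 2)) = y)
    (h3 : opD n α (d (e n 3)) + p • opD n α (e n 3) + q • e n 4 - d (opD n α (e n 3)) =
      r • e n 3 + opN n α y)
    (hy2 : coord n 2 y = 0) (hy3 : coord n 3 y = 0) :
    p = 0 ∧ q = 0 ∧ r = 0 ∧ ∀ k, 4 ≤ k → k ≤ n → coord n k y = -(a * ((k : ℂ) - 2) * α k) := by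
  have hrec : ∀ m, m + 2 ≤ n → d (e n (m + 2)) =
      (opN n α ^ m) (d (e n 2)) + ((m : ℂ) * a) • e n (m + 2) := by
    intro m hm
    have := apply_e_of_recursion (b := 0) hn
      (fun i hi _ => by rw [h1 i hi, zero_smul, add_zero]) m hm
    rw [this]
    module
  have hs : ∑ k ∈ Icc (2 + 2) n, α (k - 2 + 2) • e n k = ∑ k ∈ Icc 4 n, α k • e n k :=
    sum_congr rfl fun k hk => by
      rw [mem_Icc] at hk
      rw [Nat.sub_add_cancel (by omega)]
  have hdD : d (opD n α (e n 2)) =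
      opD n α (d (e n 2)) + ∑ k ∈ Icc 4 n, (a * ((k : ℂ) - 2) * α k) • e n k := by
    rw [opD_eq_sum_pow hn hd, opD_e 2 le_rfl, hs, map_add, map_sum, add_assoc, ← sum_add_distrib]
    congr 1
    refine sum_congr rfl fun k hk => ?_
    rw [mem_Icc] at hk
    have := hrec (k - 2) (by omega)
    rw [Nat.sub_add_cancel (by omega)] at this
    rw [map_smul, this, Nat.cast_sub (by omega)]
    push_cast
    module
  have hy : y = p • opD n α (e n 2) + q • e n 3
      - ∑ k ∈ Icc 4 n, (a * ((k : ℂ) - 2) * α k) • e n k := by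
    rw [← h2, hdD]
    module
  have p0 : p = 0 := by
    rw [hy, map_sub, map_add, map_smul, map_smul, coord_two_opD hn, coord_e_ne (by omega),
      coord_e_self (by omega), coord_e_ne (by omega), coord_sum_Icc_eq_zero _ (by omega)] at hy2
    simpa using hy2
  have q0 : q = 0 := by
    rw [hy, p0, map_sub, map_add, map_smul, map_smul, coord_e_self (by omega),
      coord_sum_Icc_eq_zero _ (by omega)] at hy3
    simpa using hy3
  have hy' : y = - ∑ k ∈ Icc 4 n, (a * ((k : ℂ) - 2) * α k) • e n k := by
    rw [hy, p0, q0]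
    module
  refine ⟨p0, q0, ?_, fun k h4 hk => ?_⟩
  · -- `d` commutes with the right multiplication by `e₁` up to `a`, hence so does the commutator
    have hdN : ∀ v, (∀ r < 2, coord n r v = 0) →
        d (opN n α v) = opN n α (d v) + a • opN n α v := by
      intro v hv
      rw [eq_sum_of_coord hv]
      simp only [map_sum, map_smul, smul_sum]
      rw [← sum_add_distrib]
      refine sum_congr rfl fun l hl => ?_
      rw [mem_Icc] at hl
      rw [opN_e hn hl.1, h1 l hl.1]
      module
    have h4 := h3
    have e3 : e n 3 = opN n α (e n 2) := (opN_e hn le_rfl).symm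
    rw [p0, q0, e3, ← opN_opD hn, hdN _ fun r hr => coord_opD_of_lt hn hr _, ← e3, h1 2 le_rfl,
      map_add, map_smul, ← opN_opD hn, e3, ← opN_opD hn, hdD, hy', ← e3, map_add, map_neg] at h4
    have h5 : r • e n 3 = 0 := by
      linear_combination (norm := module) -h4
    exact (smul_eq_zero.1 h5).resolve_right (e_ne_zero hn)
  · rw [hy', map_neg, coord_sum_Icc _ h4 hk hk]

/-- The coboundary `(u, v) ↦ [d u, v] + [u, d v] - d [u, v]` of a linear map `d`. -/
def coboundary (n : ℕ) (α : ℕ → ℂ) : (V n →ₗ[ℂ] V n) →ₗ[ℂ] Bil ℂ (V n) where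
  toFun d := R5 n α ∘ₗ d + (R5 n α).compl₂ d - (R5 n α).compr₂ d
  map_add' d d' := by
    refine LinearMap.ext fun u => LinearMap.ext fun v => ?_
    simp only [LinearMap.add_apply, LinearMap.sub_apply, LinearMap.comp_apply,
      LinearMap.compl₂_apply, LinearMap.compr₂_apply, map_add]
    abel
  map_smul' t d := by
    refine LinearMap.ext fun u => LinearMap.ext fun v => ?_
    simp only [LinearMap.add_apply, LinearMap.sub_apply, LinearMap.comp_apply,
      LinearMap.compl₂_apply, LinearMap.compr₂_apply, LinearMap.smul_apply, map_smul, smul_add,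
      smul_sub, RingHom.id_apply]

theorem coboundary_apply (d : V n →ₗ[ℂ] V n) (u v : V n) :
    coboundary n α d u v = R5 n α (d u) v + R5 n α u (d v) - d (R5 n α u v) := rfl

theorem BL2_eq_range : BL2 (R5 n α) = LinearMap.range (coboundary n α) := by
  ext f
  constructor
  · rintro ⟨d, hd⟩
    exact ⟨d, LinearMap.ext fun u => LinearMap.ext fun v => (hd u v).symm⟩
  · rintro ⟨d, rfl⟩
    exact ⟨d, fun u v => rfl⟩

theorem coboundary_apply_one (d : V n →ₗ[ℂ] V n) (u : V n) :
    coboundary n α d u (e n 1) = opN n α (d u) + coord n 0 (d (e n 1)) • opD n α u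
      + coord n 1 (d (e n 1)) • opN n α u - d (opN n α u) := by
  rw [coboundary_apply, R5_one, R5_one, R5_apply]
  module

theorem coboundary_apply_x (d : V n →ₗ[ℂ] V n) (u : V n) :
    coboundary n α d u (e n 0) = opD n α (d u) + coord n 0 (d (e n 0)) • opD n α u
      + coord n 1 (d (e n 0)) • opN n α u - d (opD n α u) := by
  rw [coboundary_apply, R5_x, R5_x, R5_apply]
  module

theorem coord_eq_zero_of_coboundary (hn : 3 ≤ n) {d : V n →ₗ[ℂ] V n} {j : ℕ} (hj : 2 ≤ j)
    (h : ∀ u, coboundary n α d u (e n j) = 0) {r : ℕ} (hr : r < 2) :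
    coord n r (d (e n j)) = 0 := by
  have h0 := eq_zero_of_opD_opN (α := α) (p := coord n 0 (d (e n j)))
    (q := coord n 1 (d (e n j))) hn fun u => by
      have := h u
      rw [coboundary_apply, R5_e_right hj, R5_e_right hj, map_zero, R5_apply, zero_add,
        sub_zero] at this
      exact this
  obtain rfl | rfl : r = 0 ∨ r = 1 := by omega
  · exact h0.1
  · exact h0.2

/-- The consequences of `δd = f` for a bilinear map `f` with values like those of a combination of
the explicit cocycles: `w = f(eₙ, e₁)`, `y = f(e₂, x)` and `f(e₃, x) = r e₃ + [y, e₁]`; here the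
last value is known only after `w` is seen to vanish. -/
theorem coboundary_consequences (hα : ∀ k, ¬ (4 ≤ k ∧ k ≤ n) → α k = 0) (hn : 3 ≤ n)
    {d : V n →ₗ[ℂ] V n} {r : ℂ} (hR : ∀ u, coboundary n α d u (e n 2) = 0)
    (h1 : ∀ i, 2 ≤ i → i < n → coboundary n α d (e n i) (e n 1) = 0)
    (hwn : coord n n (coboundary n α d (e n n) (e n 1)) = 0)
    (hy2 : coord n 2 (coboundary n α d (e n 2) (e n 0)) = 0)
    (hy3 : coord n 3 (coboundary n α d (e n 2) (e n 0)) = 0)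
    (h3 : coboundary n α d (e n n) (e n 1) = 0 → coboundary n α d (e n 3) (e n 0) =
      r • e n 3 + opN n α (coboundary n α d (e n 2) (e n 0))) :
    coboundary n α d (e n n) (e n 1) = 0 ∧ r = 0 ∧ coord n 0 (d (e n 1)) = 0 ∧
      coord n 0 (d (e n 0)) = 0 ∧ coord n 1 (d (e n 0)) = 0 ∧
      (∀ i, 2 ≤ i → d (e n (i + 1)) = opN n α (d (e n i)) + coord n 1 (d (e n 1)) • e n (i + 1)) ∧
      ∀ k, 4 ≤ k → k ≤ n → coord n k (coboundary n α d (e n 2) (e n 0)) =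
        -(coord n 1 (d (e n 1)) * ((k : ℂ) - 2) * α k) := by
  have hd : ∀ r < 2, coord n r (d (e n 2)) = 0 :=
    fun r hr => coord_eq_zero_of_coboundary hn le_rfl hR hr
  have h1' : ∀ i, 2 ≤ i → i < n → d (e n (i + 1)) = opN n α (d (e n i))
      + coord n 0 (d (e n 1)) • opD n α (e n i) + coord n 1 (d (e n 1)) • e n (i + 1) := by
    intro i h2 hi
    have := h1 i h2 hi
    rw [coboundary_apply_one, opN_e hn h2] at this
    linear_combination (norm := module) -this
  have hw : opN n α (d (e n n)) + coord n 0 (d (e n 1)) • opD n α (e n n) =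
      coboundary n α d (e n n) (e n 1) := by
    rw [coboundary_apply_one, opN_e hn (by omega), e_of_lt (Nat.lt_succ_self n), map_zero]
    module
  obtain ⟨b0, w0⟩ := eq_zero_of_commutator_opN hn hd h1' hw hwn
  have h1'' : ∀ i, 2 ≤ i →
      d (e n (i + 1)) = opN n α (d (e n i)) + coord n 1 (d (e n 1)) • e n (i + 1) := by
    intro i h2
    obtain hi | rfl | hi : i < n ∨ i = n ∨ n < i := by omega
    · rw [h1' i h2 hi, b0, zero_smul, add_zero]
    · rw [b0, zero_smul, add_zero] at hw
      rw [hw, w0, e_of_lt (Nat.lt_succ_self i), map_zero, smul_zero, add_zero]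
    · rw [e_of_lt hi, e_of_lt (by omega : n < i + 1)]
      simp
  obtain ⟨p0, q0, r0, hk⟩ := coord_of_commutator_opD (r := r)
    (p := coord n 0 (d (e n 0))) (q := coord n 1 (d (e n 0))) hn hd h1''
    (by rw [coboundary_apply_x, opN_e hn le_rfl])
    (by rw [← h3 w0, coboundary_apply_x, opN_e hn (by omega)]) hy2 hy3
  exact ⟨w0, r0, b0, p0, q0, h1'', hk⟩

/-- A derivation is determined by its value at `e₁`, whose coordinate at `x` is zero by
`coboundary_consequences`. -/
theorem derivation_eq_zero (hα : ∀ k, ¬ (4 ≤ k ∧ k ≤ n) → α k = 0) (hn : 3 ≤ n)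
    {d : V n →ₗ[ℂ] V n} (hd : coboundary n α d = 0)
    (h1 : ∀ k, 1 ≤ k → k ≤ n → coord n k (d (e n 1)) = 0) : d = 0 := by
  have hd0 : ∀ u v, coboundary n α d u v = 0 := fun u v => by
    rw [hd, LinearMap.zero_apply, LinearMap.zero_apply]
  obtain ⟨-, -, b0, p0, q0, hrec, -⟩ := coboundary_consequences (r := 0) (d := d) hα hn
    (fun u => hd0 u _) (fun i _ _ => hd0 _ _) (by rw [hd0, map_zero]) (by rw [hd0, map_zero])
    (by rw [hd0, map_zero]) (fun _ => by rw [hd0, hd0, map_zero, zero_smul, zero_add])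
  have d1 : d (e n 1) = 0 := by
    refine coord_ext fun k hk => ?_
    rw [map_zero]
    obtain rfl | hk1 : k = 0 ∨ 1 ≤ k := by omega
    · exact b0
    · exact h1 k hk1 hk
  have d0 : d (e n 0) = 0 := by
    refine eq_zero_of_opD_eq_zero hα hn (fun r hr => ?_) ?_
    · obtain rfl | rfl : r = 0 ∨ r = 1 := by omega
      · exact p0
      · exact q0
    · have := hd0 (e n 0) (e n 0)
      rw [coboundary_apply_x, opD_zero, opN_zero] at this
      simpa using this
  have d3 : d (e n 3) = 0 := by
    have := hd0 (e n 1) (e n 1)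
    rw [coboundary_apply_one, d1, opN_one hn] at this
    simpa using this
  have dge : ∀ m, d (e n (m + 3)) = 0 := by
    intro m
    induction m with
    | zero => exact d3
    | succ m ih =>
      have := hrec (m + 3) (by omega)
      rw [ih, d1, map_zero, map_zero, zero_smul, add_zero] at this
      exact this
  have d2 : d (e n 2) = 0 := by
    have := hd0 (e n 1) (e n 0)
    have hs : d (∑ k ∈ Icc 4 (n - 1), α k • e n k) = 0 := by
      rw [map_sum]
      refine sum_eq_zero fun k hk => ?_
      rw [mem_Icc] at hk
      obtain ⟨m, rfl⟩ : ∃ m, k = m + 3 := ⟨k - 3, by omega⟩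
      rw [map_smul, dge, smul_zero]
    rw [coboundary_apply_x, d1, d0, opD_one hn, map_add d, hs] at this
    simpa using this
  refine linearMap_ext fun i hi => ?_
  rw [LinearMap.zero_apply]
  obtain rfl | rfl | rfl | h3 : i = 0 ∨ i = 1 ∨ i = 2 ∨ 3 ≤ i := by omega
  · exact d0
  · exact d1
  · exact d2
  · obtain ⟨m, rfl⟩ : ∃ m, i = m + 3 := ⟨i - 3, by omega⟩
    exact dge m

/-- A nonzero `αₘ` rules out the derivations with a component of `d(e₁)` along `e₁`. -/
theorem derivation_coord_one (hα : ∀ k, ¬ (4 ≤ k ∧ k ≤ n) → α k = 0) (hn : 3 ≤ n)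
    {d : V n →ₗ[ℂ] V n} (hd : coboundary n α d = 0) {m : ℕ} (hm : α m ≠ 0) :
    coord n 1 (d (e n 1)) = 0 := by
  have hd0 : ∀ u v, coboundary n α d u v = 0 := fun u v => by
    rw [hd, LinearMap.zero_apply, LinearMap.zero_apply]
  obtain ⟨-, -, -, -, -, -, h⟩ := coboundary_consequences (r := 0) (d := d) hα hn
    (fun u => hd0 u _) (fun i _ _ => hd0 _ _) (by rw [hd0, map_zero]) (by rw [hd0, map_zero])
    (by rw [hd0, map_zero]) (fun _ => by rw [hd0, hd0, map_zero, zero_smul, zero_add])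
  have hmn : 4 ≤ m ∧ m ≤ n := by
    by_contra h'
    exact hm (hα m h')
  have h0 := h m hmn.1 hmn.2
  rw [hd0, map_zero, eq_comm, neg_eq_zero, mul_eq_zero, mul_eq_zero] at h0
  have h2 : ((m : ℂ) - 2) ≠ 0 := by
    rw [sub_ne_zero]
    exact_mod_cast (show m ≠ 2 by omega)
  tauto

/-- The kernel of the coboundary map is the space of derivations. -/
theorem finrank_ker_coboundary_le (I : Finset ℕ) (hI : ∀ d : V n →ₗ[ℂ] V n, coboundary n α d = 0 →
      (∀ k ∈ I, coord n k (d (e n 1)) = 0) → d = 0) :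
    Module.finrank ℂ (LinearMap.ker (coboundary n α)) ≤ #I := by
  set T : LinearMap.ker (coboundary n α) →ₗ[ℂ] (I → ℂ) :=
    (LinearMap.pi fun k : I => coord n k ∘ₗ LinearMap.applyₗ (e n 1)) ∘ₗ
      (LinearMap.ker (coboundary n α)).subtype with hT
  have hinj : Function.Injective T := by
    rw [← LinearMap.ker_eq_bot, LinearMap.ker_eq_bot']
    rintro ⟨d, hd⟩ h0
    exact Subtype.ext (hI d hd fun k hk => congrFun h0 ⟨k, hk⟩)
  have := LinearMap.finrank_le_finrank_of_injective hinj
  rwa [Module.finrank_fintype_fun_eq_card, Fintype.card_coe] at this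

/-! ### The cohomology -/

/-- The dimension of the cohomology: `BL²` is the quotient of the space of all linear maps, of
dimension `(n + 1)²`, by the space of derivations. -/
theorem finrank_HL2_add (hα : ∀ k, ¬ (4 ≤ k ∧ k ≤ n) → α k = 0) (hn : 3 ≤ n) :
    Module.finrank ℂ (HL2 (R5 n α)) + (n + 1) * (n + 1) =
      n ^ 2 + 3 * n - 3 + Module.finrank ℂ (LinearMap.ker (coboundary n α)) := by
  have h1 := Submodule.finrank_quotient_add_finrank ((BL2 (R5 n α)).submoduleOf (ZL2 (R5 n α)))
  have h2 := (Submodule.submoduleOfEquivOfLe (BL2_le_ZL2 (R5_isLeibniz hn α))).finrank_eq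
  have h3 := LinearMap.finrank_range_add_finrank_ker (coboundary n α)
  rw [Module.finrank_linearMap, Module.finrank_fin_fun] at h3
  rw [← BL2_eq_range] at h3
  rw [finrank_ZL2 hα hn, h2] at h1
  change Module.finrank ℂ (HL2 (R5 n α)) + _ = _ at h1
  omega

/-- The only combinations of the explicit cocycles that are coboundaries are trivial, provided that
some `m` with `αₘ ≠ 0` is omitted from the indices of the `ψₖ` unless all `αₖ` vanish. -/
theorem eq_zero_of_sum_mem_BL2 (hα : ∀ k, ¬ (4 ≤ k ∧ k ≤ n) → α k = 0) (hn : 3 ≤ n)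
    {K : Finset ℕ} (hK : K ⊆ Icc 4 n) (hm : (∀ k, α k = 0) ∨ ∃ m ∉ K, α m ≠ 0)
    (g : Unit ⊕ (↥K ⊕ ↥(Icc 2 (n - 1))) → ℂ)
    (hg : ∑ p, g p • cocycleFamily n α K p ∈ BL2 (R5 n α)) (p) : g p = 0 := by
  rw [BL2_eq_range] at hg
  obtain ⟨d, hd⟩ := hg
  have happ : ∀ u v, coboundary n α d u v = g (.inl ()) • rho n α u v
      + (∑ k : ↥K, g (.inr (.inl k)) • psi n k u v
        + ∑ k : ↥(Icc 2 (n - 1)), g (.inr (.inr k)) • phi n α k u v) := by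
    intro u v
    rw [hd]
    simp only [Fintype.sum_sum_type, LinearMap.add_apply, LinearMap.sum_apply,
      LinearMap.smul_apply, univ_unique, sum_singleton]
    rfl
  have hkK : ∀ k : ↥K, 4 ≤ (k : ℕ) ∧ (k : ℕ) ≤ n := fun k => mem_Icc.1 (hK k.2)
  have hkI : ∀ k : ↥(Icc 2 (n - 1)), 2 ≤ (k : ℕ) ∧ (k : ℕ) < n := fun k => by
    have := mem_Icc.1 k.2
    omega
  have hR : ∀ u, coboundary n α d u (e n 2) = 0 := by
    intro u
    have : (coboundary n α d).flip (e n 2) = 0 := linearMap_ext fun i hi => by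
      rw [LinearMap.flip_apply, happ, rho_right hi le_rfl (by omega),
        sum_eq_zero fun k _ => by rw [psi_right hi (by omega) (by omega), smul_zero],
        sum_eq_zero fun k _ => by rw [phi_right hi le_rfl (by omega), smul_zero]]
      simp
    exact congrArg (fun f => f u) this
  have psi0 : ∀ i, i ≤ n → ∑ k : ↥K, g (.inr (.inl k)) • psi n k (e n i) (e n 1) = 0 :=
    fun i hi => sum_eq_zero fun k _ => by rw [psi_right hi le_rfl (by omega), smul_zero]
  have h1 : ∀ i, 2 ≤ i → i < n → coboundary n α d (e n i) (e n 1) = 0 := by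
    intro i h2 hi
    rw [happ, rho_e_one hn (by omega), psi0 i hi.le,
      sum_eq_zero fun k _ => by rw [phi_e_one hn (by omega) (by omega), smul_zero]]
    simp
  have hw : coboundary n α d (e n n) (e n 1) =
      ∑ k : ↥(Icc 2 (n - 1)), g (.inr (.inr k)) • e n k := by
    rw [happ, rho_e_one hn (by omega), psi0 n le_rfl, smul_zero, zero_add, zero_add]
    exact sum_congr rfl fun k _ => by rw [phi_last_one hn]
  have hwn : coord n n (coboundary n α d (e n n) (e n 1)) = 0 := by
    rw [hw, map_sum]
    refine sum_eq_zero fun k _ => ?_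
    have := hkI k
    rw [map_smul, coord_e_ne (by omega), smul_zero]
  have hy : coboundary n α d (e n 2) (e n 0) = ∑ k : ↥K, g (.inr (.inl k)) • e n k := by
    have hphi : ∑ k : ↥(Icc 2 (n - 1)), g (.inr (.inr k)) • phi n α k (e n 2) (e n 0) = 0 := by
      refine sum_eq_zero fun k _ => ?_
      have hk := hkI k
      rw [phi_e_x hα hn hk.1 hk.2.le le_rfl (by omega), sum_eq_zero, smul_zero]
      intro l hl
      rw [mem_Icc] at hl
      rw [hα _ (by omega), zero_smul]
    rw [happ, rho_e_x le_rfl, hphi, add_zero]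
    have : ((2 : ℕ) : ℂ) - 2 = 0 := by norm_num
    rw [this, zero_smul, smul_zero, zero_add]
    refine sum_congr rfl fun k _ => ?_
    rw [psi_e_x (hkK k).1 (hkK k).2 le_rfl, Nat.add_sub_cancel]
  have coordw : ∀ k : ↥(Icc 2 (n - 1)),
      coord n k (coboundary n α d (e n n) (e n 1)) = g (.inr (.inr k)) := by
    intro k
    have hk := hkI k
    rw [hw, map_sum, sum_eq_single k]
    · rw [map_smul, coord_e_self (by omega), smul_eq_mul, mul_one]
    · intro l _ hl
      rw [map_smul, coord_e_ne fun h => hl (Subtype.ext h.symm), smul_zero]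
    · intro h
      exact absurd (mem_univ k) h
  have coordy : ∀ k : ↥K,
      coord n k (coboundary n α d (e n 2) (e n 0)) = g (.inr (.inl k)) := by
    intro k
    have hk := hkK k
    rw [hy, map_sum, sum_eq_single k]
    · rw [map_smul, coord_e_self (by omega), smul_eq_mul, mul_one]
    · intro l _ hl
      rw [map_smul, coord_e_ne fun h => hl (Subtype.ext h.symm), smul_zero]
    · intro h
      exact absurd (mem_univ k) h
  have coordy0 : ∀ m, m ∉ K → coord n m (coboundary n α d (e n 2) (e n 0)) = 0 := by
    intro m hm
    rw [hy, map_sum]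
    refine sum_eq_zero fun k _ => ?_
    rw [map_smul, coord_e_ne fun h => hm (by rw [h]; exact k.2), smul_zero]
  have hnot : ∀ m < 4, m ∉ K := fun m hm h => by
    have := mem_Icc.1 (hK h)
    omega
  obtain ⟨w0, r0, -, -, -, -, hk⟩ := coboundary_consequences (r := g (.inl ())) hα hn hR h1 hwn
    (coordy0 2 (hnot 2 (by omega))) (coordy0 3 (hnot 3 (by omega))) (fun w0 => by
      have g0 : ∀ k, g (.inr (.inr k)) = 0 := fun k => by rw [← coordw k, w0, map_zero]
      rw [happ, sum_eq_zero (s := (univ : Finset ↥(Icc 2 (n - 1)))) fun k _ => by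
        rw [g0, zero_smul], add_zero, hy, rho_e_x (by omega), map_sum]
      have : ((3 : ℕ) : ℂ) - 2 = 1 := by norm_num
      rw [this, one_smul]
      congr 1
      refine sum_congr rfl fun k _ => ?_
      have hk := hkK k
      rw [psi_e_x hk.1 hk.2 (by omega), map_smul, opN_e hn (by omega),
        show (k : ℕ) + 3 - 2 = k + 1 by omega])
  have ha : ∀ k, coord n 1 (d (e n 1)) * α k = 0 := by
    intro k
    obtain h0 | ⟨m, hmK, hm⟩ := hm
    · rw [h0, mul_zero]
    · have hmn : 4 ≤ m ∧ m ≤ n := by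
        by_contra h'
        exact hm (hα m h')
      have h0 := hk m hmn.1 hmn.2
      have h2 : ((m : ℂ) - 2) ≠ 0 := by
        rw [sub_ne_zero]
        exact_mod_cast (show m ≠ 2 by omega)
      rw [coordy0 m hmK, eq_comm, neg_eq_zero, mul_eq_zero, mul_eq_zero] at h0
      have : coord n 1 (d (e n 1)) = 0 := by tauto
      rw [this, zero_mul]
  rcases p with _ | k | k
  · exact r0
  · rw [← coordy k, hk k (hkK k).1 (hkK k).2]
    linear_combination (-((k : ℕ) : ℂ) + 2) * ha k
  · rw [← coordw k, w0, map_zero]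

theorem linearIndependent_classes (hα : ∀ k, ¬ (4 ≤ k ∧ k ≤ n) → α k = 0) (hn : 3 ≤ n)
    {K : Finset ℕ} (hK : K ⊆ Icc 4 n) (hm : (∀ k, α k = 0) ∨ ∃ m ∉ K, α m ≠ 0) :
    LinearIndependent ℂ fun p : Unit ⊕ (↥K ⊕ ↥(Icc 2 (n - 1))) =>
      (Submodule.Quotient.mk ⟨cocycleFamily n α K p, cocycleFamily_mem_ZL2 hα hn hK p⟩ :
        HL2 (R5 n α)) := by
  rw [Fintype.linearIndependent_iff]
  intro g hg
  refine eq_zero_of_sum_mem_BL2 hα hn hK hm g ?_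
  have h0 : ((BL2 (R5 n α)).submoduleOf (ZL2 (R5 n α))).mkQ
      (∑ p, g p • (⟨cocycleFamily n α K p, cocycleFamily_mem_ZL2 hα hn hK p⟩ :
        ↥(ZL2 (R5 n α)))) = 0 := by
    rw [map_sum]
    simpa only [map_smul, Submodule.mkQ_apply] using hg
  rw [Submodule.mkQ_apply, Submodule.Quotient.mk_eq_zero] at h0
  have h1 : ((∑ p, g p • (⟨cocycleFamily n α K p, cocycleFamily_mem_ZL2 hα hn hK p⟩ :
      ↥(ZL2 (R5 n α))) : ↥(ZL2 (R5 n α))) : Bil ℂ (V n)) ∈ BL2 (R5 n α) := h0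
  simpa only [Submodule.coe_sum, Submodule.coe_smul] using h1

/-- If the family of classes has as many members as derivations and cocycles leave room for, it is
a basis. -/
theorem classesFormBasis_of_card (hα : ∀ k, ¬ (4 ≤ k ∧ k ≤ n) → α k = 0) (hn : 3 ≤ n)
    {K I : Finset ℕ} (hK : K ⊆ Icc 4 n) (hm : (∀ k, α k = 0) ∨ ∃ m ∉ K, α m ≠ 0)
    (hI : ∀ d : V n →ₗ[ℂ] V n, coboundary n α d = 0 →
      (∀ k ∈ I, coord n k (d (e n 1)) = 0) → d = 0) (hKI : #I = #K + 3) :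
    Module.finrank ℂ (HL2 (R5 n α)) = #K + n - 1 ∧
      ClassesFormBasis (R5 n α) (cocycleFamily n α K) := by
  have hli := linearIndependent_classes hα hn hK hm
  have hcard : Fintype.card (Unit ⊕ (↥K ⊕ ↥(Icc 2 (n - 1)))) = #K + n - 1 := by
    simp only [Fintype.card_sum, Fintype.card_unit, Fintype.card_coe, Nat.card_Icc]
    omega
  have hle := hli.fintype_card_le_finrank
  rw [hcard] at hle
  change _ ≤ Module.finrank ℂ (HL2 (R5 n α)) at hle
  have h1 := finrank_HL2_add hα hn
  have h2 := finrank_ker_coboundary_le I hI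
  have hsq : (n + 1) * (n + 1) = n ^ 2 + 2 * n + 1 := by ring
  have hfin : Module.finrank ℂ (HL2 (R5 n α)) = #K + n - 1 := by omega
  refine ⟨hfin, basisOfLinearIndependentOfCardEqFinrank hli (hcard.trans hfin.symm), fun p =>
    ⟨cocycleFamily_mem_ZL2 hα hn hK p, ?_⟩⟩
  rw [coe_basisOfLinearIndependentOfCardEqFinrank]

theorem finrank_HL2_and_basis_of_zero (hn : 3 ≤ n) (h0 : ∀ k, α k = 0) :
    Module.finrank ℂ (HL2 (R5 n α)) = 2 * n - 4 ∧
      ClassesFormBasis (R5 n α) (cocycleFamily n α (Icc 4 n)) := by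
  have hα : ∀ k, ¬ (4 ≤ k ∧ k ≤ n) → α k = 0 := fun k _ => h0 k
  have h := classesFormBasis_of_card (I := Icc 1 n) hα hn subset_rfl (.inl h0)
    (fun d hd h1 => derivation_eq_zero hα hn hd fun k hk hkn => h1 k (mem_Icc.2 ⟨hk, hkn⟩))
    (by rw [Nat.card_Icc, Nat.card_Icc]; omega)
  refine ⟨?_, h.2⟩
  rw [h.1, Nat.card_Icc]
  omega

theorem finrank_HL2_and_basis_of_ne_zero (hα : ∀ k, ¬ (4 ≤ k ∧ k ≤ n) → α k = 0) (hn : 3 ≤ n)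
    {m : ℕ} (hm : α m ≠ 0) :
    Module.finrank ℂ (HL2 (R5 n α)) = 2 * n - 5 ∧
      ClassesFormBasis (R5 n α) (cocycleFamily n α ((Icc 4 n).erase m)) := by
  have hmn : 4 ≤ m ∧ m ≤ n := by
    by_contra h'
    exact hm (hα m h')
  have hcard : #((Icc 4 n).erase m) = n - 4 := by
    rw [card_erase_of_mem (mem_Icc.2 hmn), Nat.card_Icc]
    omega
  have h := classesFormBasis_of_card (I := Icc 2 n) hα hn (erase_subset m (Icc 4 n))
    (.inr ⟨m, by simp, hm⟩)
    (fun d hd h1 => derivation_eq_zero hα hn hd fun k hk hkn => by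
      obtain rfl | hk2 : k = 1 ∨ 2 ≤ k := by omega
      · exact derivation_coord_one hα hn hd hm
      · exact h1 k (mem_Icc.2 ⟨hk2, hkn⟩))
    (by rw [hcard, Nat.card_Icc]; omega)
  refine ⟨?_, h.2⟩
  rw [h.1, hcard]
  omega

end

end

end LeibnizR5

theorem theorem3p18 (n : ℕ) (hn : 3 ≤ n) (α : ℕ → ℂ)
    (hα : ∀ k, ¬ (4 ≤ k ∧ k ≤ n) → α k = 0) :
    (∀ φ : Bil ℂ (V n), φ ∈ ZL2 (R5 n α) ↔
      ∃ (a : ℕ → ℕ → ℂ) (c d : ℕ → ℂ) (β : ℂ), IsGeneralForm n α a c d β φ) ∧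
    Module.finrank ℂ (ZL2 (R5 n α)) = n ^ 2 + 3 * n - 3 ∧
    ((∀ k, α k = 0) → Module.finrank ℂ (HL2 (R5 n α)) = 2 * n - 4) ∧
    ((∃ k, α k ≠ 0) → Module.finrank ℂ (HL2 (R5 n α)) = 2 * n - 5) ∧
    ((∀ k, α k = 0) →
      ClassesFormBasis (R5 n α) (cocycleFamily n α (Finset.Icc 4 n))) ∧
    (∀ m, α m ≠ 0 →
      ClassesFormBasis (R5 n α) (cocycleFamily n α ((Finset.Icc 4 n).erase m))) := by
  refine ⟨fun φ => ⟨fun hφ => exists_isGeneralForm hα hn hφ, ?_⟩, finrank_ZL2 hα hn,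
    fun h0 => (finrank_HL2_and_basis_of_zero hn h0).1, ?_,
    fun h0 => (finrank_HL2_and_basis_of_zero hn h0).2,
    fun m hm => (finrank_HL2_and_basis_of_ne_zero hα hn hm).2⟩
  · rintro ⟨a, c, d, β, h⟩
    exact h.mem_ZL2 hα hn
  · rintro ⟨m, hm⟩
    exact (finrank_HL2_and_basis_of_ne_zero hα hn hm).1
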